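/- Let $T\ge 1$ and let $(a_n),(b_n)$ be real $T$-periodic sequences with $a_n>0$ (so $a_0=a_T$). For $z\in\mathbb C$ put $B_n(z)=\begin{pmatrix}0&1\\ -a_{n-1}/a_n&(z-b_n)/a_n\end{pmatrix}$ and let $M(z)=B_T(z)\cdots B_1(z)=\begin{pmatrix}p_1&p_2\\p_3&p_4\end{pmatrix}$ be the monodromy matrix of the period-$T$ Jacobi operator $J_T$. Let $\sigma_{ell}(J_T)\subset\mathbb R$ be the set of elliptic points, i.e. those $\lambda$ for which $M(\lambda)$ has two distinct eigenvalues of modulus one, and write these eigenvalues as $e^{\pm i\theta(\lambda)}$ with $0<\theta(\lambda)<\pi$ (the quasi-momentum). For $\lambda\in\sigma_{ell}(J_T)$, $\mu=e^{i\theta(\lambda)}$ and $0\le j<T$ write $B_T\cdots B_{T-j+1}=\begin{pmatrix}\alpha_1&\alpha_2\\\alpha_3&\alpha_4\end{pmatrix}$, $B_{T-j-1}\cdots B_1=\begin{pmatrix}\tilde\alpha_1&\tilde\alpha_2\\\tilde\alpha_3&\tilde\alpha_4\end{pmatrix}$ (empty products are the identity), and $$D_j(\lambda)=\frac{|\mu-p_1|^2\mu}{2p_2}\Bigl(\tilde\alpha_3\frac{p_2}{\mu-p_1}+\tilde\alpha_4\Bigr)\Bigl(-\alpha_2+\alpha_4\frac{p_2}{\mu-p_1}\Bigr),\qquad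 E_j(\lambda)=\frac{D_j(\lambda)}{2Ta_{T-j}}.$$ For $\omega,\phi\in\mathbb R$ with $\omega T+2\theta(\lambda)\in2\pi\mathbb Z$ or $\omega T-2\theta(\lambda)\in 2\pi\mathbb Z$ define the amplitude $R(\lambda,\omega,\phi)$ by $$R=\begin{cases}E=\sum_{j=0}^{T-1}E_je^{i((T-j)\omega+\phi)}&\text{if only }\omega T+2\theta\in2\pi\mathbb Z,\\ \widetilde E=\sum_{j=0}^{T-1}E_je^{-i((T-j)\omega+\phi)}&\text{if only }\omega T-2\theta\in2\pi\mathbb Z,\\ \widetilde{\widetilde E}=\sum_{j=0}^{T-1}E_j\bigl(e^{i((T-j)\omega+\phi)}-e^{-i((T-j)\omega+\phi)}\bigr)&\text{if both hold (then }\theta=\pi/2).\end{cases}$$ (i) There is a continuous function $g$ on $\{\operatorname{Im}z>0\}\cup\sigma_{ell}(J_T)$, holomorphic on $\{\operatorname{Im}z>0\}$, with $g(z)^T=\mu(z)^2$ for $\operatorname{Im} z>0$, where $\mu(z)$ is the eigenvalue of $M(z)$ with $|\mu(z)|<1$, and with $z^2g(z)\to\bigl(\prod_{s=1}^Ta_s\bigr)^{2/T}$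 as $|z|\to\infty$, $\operatorname{Im} z>0$. Moreover, for $\lambda\in\sigma_{ell}(J_T)$ one can choose $\omega_+(\lambda),\omega_-(\lambda)\in(0,2\pi)$ with $\omega_+(\lambda)T+2\theta(\lambda)\in2\pi\mathbb Z$, $\omega_-(\lambda)T-2\theta(\lambda)\in2\pi\mathbb Z$ and $e^{-i\omega_+(\lambda)},e^{i\omega_-(\lambda)}\in\{g(\lambda),\overline{g(\lambda)}\}$, such that for every $\phi\in\mathbb R$ the exceptional set $$\{\lambda\in\sigma_{ell}(J_T):R(\lambda,\omega_+(\lambda),\phi)=0\text{ or }R(\lambda,\omega_-(\lambda),\phi)=0\}$$ is finite. (ii) Let $\lambda\in\sigma_{ell}(J_T)$ and let $\omega,\phi\in\mathbb R$ be any numbers with $\omega T+2\theta(\lambda)\in2\pi\mathbb Z$ or $\omega T-2\theta(\lambda)\in2\pi\mathbb Z$, and with $R=R(\lambda,\omega,\phi)\ne0$. Then there is $\delta>0$ such that for every real $c\ne0$, with $q_n=\dfrac{c\sin(n\omega+\phi)}{n}$, the recurrence $$a_{n-1}u_{n-1}+(b_n+q_n)u_n+a_nu_{n+1}=\lambda u_n,\qquad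 n\ge2,$$ has a nonzero solution $u=(u_n)_{n\ge1}$ that is subordinate, meaning that $\bigl(\sum_{n=1}^N|u_n|^2\bigr)^{1/2}\big/\bigl(\sum_{n=1}^N|v_n|^2\bigr)^{1/2}\to0$ as $N\to\infty$ for every solution $v$ that is not a constant multiple of $u$. This $u$ tends to $0$ at the rate $n^{-\gamma}$ with $\gamma=\left|\dfrac{cR}{\sin\theta(\lambda)}\right|$, in the sense that $n^{\gamma}u_n-v_n\to0$ for some nonzero solution $v$ of the unperturbed recurrence (the one with $q\equiv0$). If $|c|>\delta$, then $u\in l^2$. -/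

import Mathlib

open Filter Topology

noncomputable section

/-! Periodic Jacobi operators. The sequences `a, b : ℕ → ℝ` have period `T`; the matrix entries are
`a n, b n` for `n ≥ 1`, and periodicity makes `a 0 = a T`, the usual convention. -/

/-- The one-step transfer matrix `B_n(z)`, for `n ≥ 1`. -/
def transferMatrix (a b : ℕ → ℝ) (z : ℂ) (n : ℕ) : Matrix (Fin 2) (Fin 2) ℂ :=
  !![0, 1; -(a (n - 1) : ℂ) / (a n : ℂ), (z - (b n : ℂ)) / (a n : ℂ)]

/-- The ordered product `B_{m+k}(z) ⋯ B_{m+2}(z) B_{m+1}(z)` of `k` transfer matrices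
(the identity when `k = 0`). -/
def transferProd (a b : ℕ → ℝ) (z : ℂ) (m : ℕ) : ℕ → Matrix (Fin 2) (Fin 2) ℂ
  | 0 => 1
  | k + 1 => transferMatrix a b z (m + k + 1) * transferProd a b z m k

/-- The monodromy matrix `M(z) = B_T(z) ⋯ B_1(z)`. -/
def monodromy (a b : ℕ → ℝ) (T : ℕ) (z : ℂ) : Matrix (Fin 2) (Fin 2) ℂ :=
  transferProd a b z 0 T

/-- `μ` is an eigenvalue of the monodromy matrix `M(z)`. -/
def IsMultiplier (a b : ℕ → ℝ) (T : ℕ) (z μ : ℂ) : Prop :=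
  Module.End.HasEigenvalue (Matrix.toLin' (monodromy a b T z)) μ

/-- The elliptic points: those for which the monodromy matrix has two distinct eigenvalues of
modulus one. (Elliptic points are always real.) -/
def ellipticSet (a b : ℕ → ℝ) (T : ℕ) : Set ℝ :=
  {x | ∃ μ₁ μ₂ : ℂ, μ₁ ≠ μ₂ ∧ ‖μ₁‖ = 1 ∧ ‖μ₂‖ = 1 ∧
    IsMultiplier a b T (x : ℂ) μ₁ ∧ IsMultiplier a b T (x : ℂ) μ₂}

/-- `θ ∈ (0, π)` is the quasi-momentum at `x`: the eigenvalues of `M(x)` are `e^{iθ}, e^{-iθ}`. -/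
def IsQuasiMomentum (a b : ℕ → ℝ) (T : ℕ) (x θ : ℝ) : Prop :=
  0 < θ ∧ θ < Real.pi ∧
    IsMultiplier a b T (x : ℂ) (Complex.exp (Complex.I * θ)) ∧
    IsMultiplier a b T (x : ℂ) (Complex.exp (-(Complex.I * θ)))

/-- `u` solves `a_{n-1} u_{n-1} + (b_n + q_n) u_n + a_n u_{n+1} = x u_n` for all `n ≥ 2`.
The entry `u 0` plays no role. -/
def IsSolution (a b q : ℕ → ℝ) (x : ℝ) (u : ℕ → ℂ) : Prop :=
  ∀ n : ℕ, 2 ≤ n →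
    (a (n - 1) : ℂ) * u (n - 1) + ((b n : ℂ) + (q n : ℂ)) * u n + (a n : ℂ) * u (n + 1)
      = (x : ℂ) * u n

/-- `(u_n)_{n ≥ 1}` is not the zero sequence. -/
def NonzeroSeq (u : ℕ → ℂ) : Prop := ∃ n : ℕ, 1 ≤ n ∧ u n ≠ 0

/-- The truncated norm `‖u‖_N = (∑_{n=1}^N |u_n|²)^{1/2}`. -/
def truncNorm (u : ℕ → ℂ) (N : ℕ) : ℝ :=
  Real.sqrt (∑ n ∈ Finset.Icc 1 N, ‖u n‖ ^ 2)

/-- `u` is a (nonzero) subordinate solution: `‖u‖_N / ‖v‖_N → 0` for every solution `v` that is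
not a constant multiple of `u`. -/
def IsSubordinate (a b q : ℕ → ℝ) (x : ℝ) (u : ℕ → ℂ) : Prop :=
  IsSolution a b q x u ∧ NonzeroSeq u ∧
    ∀ v : ℕ → ℂ, IsSolution a b q x v →
      (¬ ∃ C : ℂ, ∀ n : ℕ, 1 ≤ n → v n = C * u n) →
      Tendsto (fun N : ℕ => truncNorm u N / truncNorm v N) atTop (𝓝 0)

/-- The Wigner-von Neumann potential `q_n = c sin(n ω + φ) / n`. -/
def wvnPotential (c ω φ : ℝ) (n : ℕ) : ℝ := c * Real.sin (n * ω + φ) / n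

/-- The quantisation condition `ω T + 2θ ∈ 2πℤ`. -/
def QuantPlus (T : ℕ) (θ ω : ℝ) : Prop := ∃ m : ℤ, ω * T + 2 * θ = 2 * Real.pi * m

/-- The quantisation condition `ω T - 2θ ∈ 2πℤ`. -/
def QuantMinus (T : ℕ) (θ ω : ℝ) : Prop := ∃ m : ℤ, ω * T - 2 * θ = 2 * Real.pi * m

/-- The coefficient `D_j(x)`, `0 ≤ j < T`, with `μ = e^{iθ}`, `M = (p₁ p₂; p₃ p₄)`,
`α = B_T ⋯ B_{T-j+1}` and `α' = B_{T-j-1} ⋯ B_1`: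
`D_j = |μ - p₁|² μ / (2 p₂) * (α'₃ p₂/(μ - p₁) + α'₄) * (-α₂ + α₄ p₂/(μ - p₁))`. -/
def coeffD (a b : ℕ → ℝ) (T : ℕ) (x θ : ℝ) (j : ℕ) : ℂ :=
  let μ : ℂ := Complex.exp (Complex.I * θ)
  let p₁ : ℂ := monodromy a b T x 0 0
  let p₂ : ℂ := monodromy a b T x 0 1
  let α := transferProd a b x (T - j) j
  let α' := transferProd a b x 0 (T - j - 1)
  ((‖μ - p₁‖ ^ 2 : ℝ) : ℂ) * μ / (2 * p₂) *
    (α' 1 0 * (p₂ / (μ - p₁)) + α' 1 1) * (-(α 0 1) + α 1 1 * (p₂ / (μ - p₁)))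

/-- `E_j = D_j / (2 T a_{T-j})`. -/
def coeffE (a b : ℕ → ℝ) (T : ℕ) (x θ : ℝ) (j : ℕ) : ℂ :=
  coeffD a b T x θ j / (2 * (T : ℂ) * (a (T - j) : ℂ))

/-- `E = ∑_{j<T} E_j e^{i((T-j)ω+φ)}`. -/
def ampPlus (a b : ℕ → ℝ) (T : ℕ) (x θ ω φ : ℝ) : ℂ :=
  ∑ j ∈ Finset.range T,
    coeffE a b T x θ j * Complex.exp (Complex.I * (((T : ℂ) - j) * ω + φ))

/-- `E~ = ∑_{j<T} E_j e^{-i((T-j)ω+φ)}`. -/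
def ampMinus (a b : ℕ → ℝ) (T : ℕ) (x θ ω φ : ℝ) : ℂ :=
  ∑ j ∈ Finset.range T,
    coeffE a b T x θ j * Complex.exp (-(Complex.I * (((T : ℂ) - j) * ω + φ)))

/-- `E~~ = ∑_{j<T} E_j (e^{i((T-j)ω+φ)} - e^{-i((T-j)ω+φ)})`. -/
def ampBoth (a b : ℕ → ℝ) (T : ℕ) (x θ ω φ : ℝ) : ℂ :=
  ∑ j ∈ Finset.range T,
    coeffE a b T x θ j *
      (Complex.exp (Complex.I * (((T : ℂ) - j) * ω + φ)) -
        Complex.exp (-(Complex.I * (((T : ℂ) - j) * ω + φ))))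

open Classical in
/-- The amplitude that governs the resonance: `E` if only `ω T + 2θ ∈ 2πℤ`, `E~` if only
`ω T - 2θ ∈ 2πℤ`, and `E~~` if both hold (which forces `θ = π/2`). It is only used when at least
one of the two quantisation conditions holds. -/
def resonanceAmp (a b : ℕ → ℝ) (T : ℕ) (x θ ω φ : ℝ) : ℂ :=
  if QuantPlus T θ ω ∧ QuantMinus T θ ω then ampBoth a b T x θ ω φ
  else if QuantPlus T θ ω then ampPlus a b T x θ ω φ
  else ampMinus a b T x θ ω φ

/-- `g` is the branch of `μ^{2/T}` in the upper half-plane, `μ` being the eigenvalue of modulus less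
than one of the monodromy matrix, that is singled out by `g(z) ~ (∏ a_s)^{2/T} / z²` at infinity,
together with its boundary values on the elliptic set. These properties determine `g` uniquely on
the upper half-plane and on the elliptic set. -/
def IsMultiplierRoot (a b : ℕ → ℝ) (T : ℕ) (g : ℂ → ℂ) : Prop :=
  DifferentiableOn ℂ g {z | 0 < z.im} ∧
  ContinuousOn g ({z | 0 < z.im} ∪ ((fun x : ℝ => (x : ℂ)) '' ellipticSet a b T)) ∧
  (∀ z : ℂ, 0 < z.im → ∃ μ : ℂ, ‖μ‖ < 1 ∧ IsMultiplier a b T z μ ∧ g z ^ T = μ ^ 2) ∧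
  Tendsto (fun z : ℂ => z ^ 2 * g z) (Bornology.cobounded ℂ ⊓ 𝓟 {z | 0 < z.im})
    (𝓝 ((((∏ s ∈ Finset.Icc 1 T, a s) ^ ((2 : ℝ) / (T : ℝ)) : ℝ)) : ℂ))

end

/-!
Everything is expressed through the Floquet solution `ψ` of the unperturbed recurrence with
`(ψ₀, ψ₁) = (p₂, μ - p₁)`, an eigenvector of the monodromy matrix. The coefficients `E_j` are, up to
one common nonzero factor, the squares `ψ_{T-j}²` (`coeffE_eq`), so that the amplitudes are the
resonant Fourier sums of `ψ_k²` over one period.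

*The root `g` and the frequencies.* Green's identity (`flux_succ`) shows that in the upper
half-plane the solution with multiplier `|μ| < 1` has negative flux, i.e. the ratios
`r_k = ψ_{k+1} / ψ_k` lie in the lower half-plane. This singles out `μ` by the principal branch of a
square root (`weylMult`), which is analytic across the elliptic set as well. Since `μ` is the product
of `r_0, …, r_{T-1}`, one may put `g = exp ((2/T) ∑ log r_k)` with principal logarithms
(`weylRoot`). The normalisation at infinity follows from `z r_k → a_k`, which comes from the Riccati
equation for the ratios, and on the elliptic set the argument of `g` is in `(-2π, 0)`, which gives
frequencies in `(0, 2π)`.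

*Finiteness.* The function `Δ ∑ ψ_k² g^{T-k}`, which vanishes at the exceptional points, is algebraic
over the polynomials, is not identically zero in the upper half-plane by its asymptotics
(`exists_resonanceFun_ne_zero`), and is continuous up to the elliptic set. Such a function has only
finitely many zeros (`IsAlgebraicOn.finite_zeros`).

*The subordinate solution.* Variation of constants with respect to `ψ` and `\bar ψ` turns the
perturbed recurrence into `X_{n+1} = (1 + S_n / n) X_n`, where `S_n` is a sum of quasi-periodic terms.
The nonresonant terms have bounded partial sums, and the mean of `S_n` is an off-diagonal matrix `V`
with `V² = γ²`, `γ = |c R / sin θ|`. Asymptotic integration (`exists_decaying_solution_of_mean`)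
then yields a solution with `n^γ X_n` convergent to an eigenvector of `V`. It is subordinate because
it tends to zero while its Wronskian with any other solution is a nonzero constant
(`isSubordinate_of_tendsto_zero`).
-/

/-! ### Transfer matrices and Floquet solutions -/

section TransferMatrices

variable {a b : ℕ → ℝ} {T : ℕ}

lemma transferProd_succ_zero_row (a b : ℕ → ℝ) (z : ℂ) (m k : ℕ) (j : Fin 2) :
    transferProd a b z m (k + 1) 0 j = transferProd a b z m k 1 j := by
  simp [transferProd, transferMatrix, Matrix.mul_apply, Fin.sum_univ_two]

lemma transferProd_add (a b : ℕ → ℝ) (z : ℂ) (m j k : ℕ) :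
    transferProd a b z m (j + k) = transferProd a b z (m + j) k * transferProd a b z m j := by
  induction k with
  | zero => simp [transferProd]
  | succ k ih => rw [← add_assoc, transferProd, ih, transferProd, Matrix.mul_assoc, add_assoc m j k]

lemma transferProd_shift (haT : ∀ n, a (n + T) = a n) (hbT : ∀ n, b (n + T) = b n)
    (z : ℂ) (m k : ℕ) : transferProd a b z (m + T) k = transferProd a b z m k := by
  induction k with
  | zero => rfl
  | succ k ih =>
    rw [transferProd, transferProd, ih]
    congr 1
    have h1 : m + T + k + 1 - 1 = (m + k) + T := by omega
    have h2 : m + T + k + 1 = (m + k + 1) + T := by omega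
    simp only [transferMatrix, h1, haT, Nat.add_sub_cancel]
    rw [h2, haT, hbT]

lemma det_transferProd (ha : ∀ n, 0 < a n) (z : ℂ) (m k : ℕ) :
    (transferProd a b z m k).det = (a m : ℂ) / a (m + k) := by
  have ha' : ∀ n, (a n : ℂ) ≠ 0 := fun n => by exact_mod_cast (ha n).ne'
  induction k with
  | zero => simp [transferProd, ha' m]
  | succ k ih =>
    rw [transferProd, Matrix.det_mul, ih, transferMatrix, Matrix.det_fin_two_of]
    have := ha' (m + k); have := ha' (m + k + 1)
    simp only [Nat.add_sub_cancel, ← add_assoc]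
    field_simp
    ring

lemma monodromy_det (ha : ∀ n, 0 < a n) (haT : ∀ n, a (n + T) = a n) (z : ℂ) :
    monodromy a b T z 0 0 * monodromy a b T z 1 1
      - monodromy a b T z 0 1 * monodromy a b T z 1 0 = 1 := by
  have h := det_transferProd (b := b) ha z 0 T
  rw [haT 0, div_self (by exact_mod_cast (ha 0).ne'), Matrix.det_fin_two] at h
  exact h

/-- The discriminant of the periodic operator: the trace of the monodromy matrix. -/
noncomputable def floquetDisc (a b : ℕ → ℝ) (T : ℕ) (z : ℂ) : ℂ :=
  monodromy a b T z 0 0 + monodromy a b T z 1 1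

lemma isMultiplier_iff (ha : ∀ n, 0 < a n) (haT : ∀ n, a (n + T) = a n) (z μ : ℂ) :
    IsMultiplier a b T z μ ↔ μ ^ 2 - floquetDisc a b T z * μ + 1 = 0 := by
  have hd := monodromy_det (b := b) ha haT z
  rw [IsMultiplier, Module.End.hasEigenvalue_iff_isRoot_charpoly, Matrix.charpoly_toLin',
    Polynomial.IsRoot.def, Matrix.charpoly_fin_two, Matrix.trace_fin_two, Matrix.det_fin_two, hd]
  simp [floquetDisc]

lemma IsMultiplier.ne_zero (ha : ∀ n, 0 < a n) (haT : ∀ n, a (n + T) = a n) {z μ : ℂ}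
    (h : IsMultiplier a b T z μ) : μ ≠ 0 := by
  rintro rfl
  simp [isMultiplier_iff ha haT] at h

/-- The solution of the unperturbed recurrence with the values `v₀, v₁` at the sites `0, 1`. -/
noncomputable def transferSol (a b : ℕ → ℝ) (z v₀ v₁ : ℂ) (k : ℕ) : ℂ :=
  transferProd a b z 0 k 0 0 * v₀ + transferProd a b z 0 k 0 1 * v₁

@[simp] lemma transferSol_zero (a b : ℕ → ℝ) (z v₀ v₁ : ℂ) : transferSol a b z v₀ v₁ 0 = v₀ := by
  simp [transferSol, transferProd]

lemma transferSol_succ (a b : ℕ → ℝ) (z v₀ v₁ : ℂ) (k : ℕ) : transferSol a b z v₀ v₁ (k + 1) =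
    transferProd a b z 0 k 1 0 * v₀ + transferProd a b z 0 k 1 1 * v₁ := by
  simp [transferSol, transferProd_succ_zero_row]

@[simp] lemma transferSol_one (a b : ℕ → ℝ) (z v₀ v₁ : ℂ) : transferSol a b z v₀ v₁ 1 = v₁ := by
  rw [← zero_add 1, transferSol_succ]; simp [transferProd]

lemma transferSol_rec (ha : ∀ n, 0 < a n) (z v₀ v₁ : ℂ) (n : ℕ) :
    (a n : ℂ) * transferSol a b z v₀ v₁ n + b (n + 1) * transferSol a b z v₀ v₁ (n + 1)
      + a (n + 1) * transferSol a b z v₀ v₁ (n + 2) = z * transferSol a b z v₀ v₁ (n + 1) := by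
  have h1 : (a (n + 1) : ℂ) ≠ 0 := by exact_mod_cast (ha _).ne'
  rw [show n + 2 = (n + 1) + 1 from rfl, transferSol_succ a b z v₀ v₁ (n + 1), transferSol_succ]
  simp only [transferSol, transferProd, transferMatrix, zero_add, Nat.add_sub_cancel,
    Matrix.mul_apply, Fin.sum_univ_two, Matrix.of_apply, Matrix.cons_val', Matrix.cons_val_zero,
    Matrix.cons_val_one, Matrix.empty_val', Matrix.cons_val_fin_one]
  field_simp
  ring

/-- The Floquet solution with multiplier `μ`, normalised by the eigenvector `(p₂, μ - p₁)` of the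
monodromy matrix at the sites `0, 1`; this normalisation is polynomial in `z` and `μ`. -/
noncomputable def floquetSol (a b : ℕ → ℝ) (T : ℕ) (z μ : ℂ) (k : ℕ) : ℂ :=
  transferSol a b z (monodromy a b T z 0 1) (μ - monodromy a b T z 0 0) k

lemma floquetSol_rec (ha : ∀ n, 0 < a n) (z μ : ℂ) (n : ℕ) :
    (a n : ℂ) * floquetSol a b T z μ n + b (n + 1) * floquetSol a b T z μ (n + 1)
      + a (n + 1) * floquetSol a b T z μ (n + 2) = z * floquetSol a b T z μ (n + 1) :=
  transferSol_rec ha z _ _ n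

lemma floquetSol_add_period (ha : ∀ n, 0 < a n) (haT : ∀ n, a (n + T) = a n)
    (hbT : ∀ n, b (n + T) = b n) {z μ : ℂ} (hμ : IsMultiplier a b T z μ) (k : ℕ) :
    floquetSol a b T z μ (k + T) = μ * floquetSol a b T z μ k := by
  have hq := (isMultiplier_iff ha haT z μ).1 hμ
  have hd := monodromy_det (b := b) ha haT z
  have hp : transferProd a b z 0 (k + T) = transferProd a b z 0 k * monodromy a b T z := by
    rw [add_comm k T, transferProd_add, transferProd_shift haT hbT]; rfl
  simp only [floquetSol, transferSol, hp, Matrix.mul_apply, Fin.sum_univ_two]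
  simp only [floquetDisc] at hq
  linear_combination -(transferProd a b z 0 k 0 1) * (hd + hq)

/-- The adjugate of `B_T ⋯ B_{m+1}` takes the Floquet vector at the sites `0, 1` back to a multiple
of the one at the sites `m, m + 1`, since `B_T ⋯ B_1` only multiplies it by `μ`. -/
lemma mul_adjugate_floquet (ha : ∀ n, 0 < a n) (haT : ∀ n, a (n + T) = a n)
    {z μ : ℂ} (hμ : IsMultiplier a b T z μ) {m j : ℕ} (hm : m + j = T) :
    μ * (-(transferProd a b z m j 0 1) * (μ - monodromy a b T z 0 0)
      + transferProd a b z m j 1 1 * monodromy a b T z 0 1)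
      = (a m : ℂ) / a 0 * floquetSol a b T z μ m := by
  have hq := (isMultiplier_iff ha haT z μ).1 hμ
  have hd := monodromy_det (b := b) ha haT z
  have hα := det_transferProd (b := b) ha z m j
  rw [hm, show a T = a 0 by rw [← haT 0, zero_add], Matrix.det_fin_two] at hα
  have hM : monodromy a b T z = transferProd a b z m j * transferProd a b z 0 m := by
    rw [monodromy, ← hm, transferProd_add, zero_add]
  have e : ∀ i k, monodromy a b T z i k = transferProd a b z m j i 0 * transferProd a b z 0 m 0 k
      + transferProd a b z m j i 1 * transferProd a b z 0 m 1 k := by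
    intro i k; rw [hM, Matrix.mul_apply, Fin.sum_univ_two]
  rw [← hα]
  simp only [floquetSol, transferSol]
  simp only [floquetDisc] at hq
  set p₁ := monodromy a b T z 0 0
  set p₂ := monodromy a b T z 0 1
  set p₃ := monodromy a b T z 1 0
  set p₄ := monodromy a b T z 1 1
  set A := transferProd a b z m j
  set B := transferProd a b z 0 m
  linear_combination (-(A 0 1)) * (hq + hd) + (A 1 1 * p₂) * e 0 0 + A 1 1 * (μ - p₁) * e 0 1
    - A 0 1 * p₂ * e 1 0 - A 0 1 * (μ - p₁) * e 1 1

end TransferMatrices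

/-! ### Elliptic points and the amplitude coefficients -/

section EllipticPoints

open ComplexConjugate

variable {a b : ℕ → ℝ} {T : ℕ}

lemma conj_transferProd (a b : ℕ → ℝ) (z : ℂ) (m k : ℕ) (i j : Fin 2) :
    conj (transferProd a b z m k i j) = transferProd a b (conj z) m k i j := by
  induction k generalizing i j with
  | zero => fin_cases i <;> fin_cases j <;> simp [transferProd]
  | succ k ih =>
    simp only [transferProd, Matrix.mul_apply, Fin.sum_univ_two, map_add, map_mul, ih]
    congr 2 <;> fin_cases i <;> simp [transferMatrix]

lemma conj_floquetSol (a b : ℕ → ℝ) (T : ℕ) (z μ : ℂ) (k : ℕ) :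
    conj (floquetSol a b T z μ k) = floquetSol a b T (conj z) (conj μ) k := by
  simp [floquetSol, transferSol, monodromy, conj_transferProd]

lemma monodromy_ofReal_im (a b : ℕ → ℝ) (T : ℕ) (x : ℝ) (i j : Fin 2) :
    (monodromy a b T x i j).im = 0 := by
  rw [← Complex.conj_eq_iff_im]
  simpa [monodromy] using conj_transferProd a b x 0 T i j

lemma Complex.exp_I_mul_ofReal_re (θ : ℝ) : (Complex.exp (Complex.I * θ)).re = Real.cos θ := by
  rw [mul_comm]; exact Complex.exp_ofReal_mul_I_re θ

lemma Complex.exp_I_mul_ofReal_im (θ : ℝ) : (Complex.exp (Complex.I * θ)).im = Real.sin θ := by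
  rw [mul_comm]; exact Complex.exp_ofReal_mul_I_im θ

lemma Complex.conj_exp_I_mul_ofReal (θ : ℝ) :
    conj (Complex.exp (Complex.I * θ)) = Complex.exp (-(Complex.I * θ)) := by
  rw [← Complex.exp_conj]; simp

namespace IsQuasiMomentum

variable {x θ : ℝ}

lemma sin_pos (h : IsQuasiMomentum a b T x θ) : 0 < Real.sin θ :=
  Real.sin_pos_of_pos_of_lt_pi h.1 h.2.1

lemma floquetDisc_eq (h : IsQuasiMomentum a b T x θ) (ha : ∀ n, 0 < a n)
    (haT : ∀ n, a (n + T) = a n) : floquetDisc a b T x = 2 * Real.cos θ := by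
  have hq := (isMultiplier_iff ha haT _ _).1 h.2.2.1
  have h0 := Complex.exp_ne_zero (Complex.I * θ)
  have h1 : floquetDisc a b T x = Complex.exp (Complex.I * θ) + Complex.exp (-(Complex.I * θ)) := by
    rw [Complex.exp_neg]; field_simp; linear_combination -hq
  rw [h1, Complex.ofReal_cos, Complex.two_cos]; ring_nf

lemma sub_ne_zero (h : IsQuasiMomentum a b T x θ) :
    Complex.exp (Complex.I * θ) - monodromy a b T x 0 0 ≠ 0 := by
  intro h0
  have := congrArg Complex.im h0
  rw [Complex.sub_im, monodromy_ofReal_im, Complex.exp_I_mul_ofReal_im] at this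
  simp [h.sin_pos.ne'] at this

/-- If `p₂` vanished at a real point, the diagonal entries would be real and reciprocal, hence the
discriminant would not lie in `(-2, 2)`. -/
lemma monodromy_ne_zero (h : IsQuasiMomentum a b T x θ) (ha : ∀ n, 0 < a n)
    (haT : ∀ n, a (n + T) = a n) : monodromy a b T x 0 1 ≠ 0 := by
  intro h0
  have hd := monodromy_det (b := b) ha haT x
  have hD := h.floquetDisc_eq ha haT
  rw [floquetDisc] at hD
  have e1 := congrArg Complex.re hd
  have e2 := congrArg Complex.re hD
  simp [h0, monodromy_ofReal_im, Complex.cos_ofReal_re] at e1 e2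
  have e3 := congrArg (· ^ 2) e2
  nlinarith [Real.sin_sq_add_cos_sq θ, pow_pos h.sin_pos 2,
    sq_nonneg ((monodromy a b T x 0 0).re - (monodromy a b T x 1 1).re)]

end IsQuasiMomentum

/-- The common factor of the coefficients `E_j`. -/
noncomputable def coeffFactor (a b : ℕ → ℝ) (T : ℕ) (x θ : ℝ) : ℂ :=
  ((‖Complex.exp (Complex.I * θ) - monodromy a b T x 0 0‖ ^ 2 : ℝ) : ℂ) /
    (4 * T * a 0 * monodromy a b T x 0 1 *
      (Complex.exp (Complex.I * θ) - monodromy a b T x 0 0) ^ 2)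

/-- The coefficients of the resonance amplitude are the squares of the Floquet solution, up to a
common factor. -/
lemma coeffE_eq (ha : ∀ n, 0 < a n) (haT : ∀ n, a (n + T) = a n) {x θ : ℝ}
    (h : IsQuasiMomentum a b T x θ) {j : ℕ} (hj : j < T) :
    coeffE a b T x θ j = coeffFactor a b T x θ *
      floquetSol a b T x (Complex.exp (Complex.I * θ)) (T - j) ^ 2 := by
  have h1 := h.sub_ne_zero
  have h2 := h.monodromy_ne_zero ha haT
  have hT : (T : ℂ) ≠ 0 := by exact_mod_cast (by omega : T ≠ 0)
  have ha' : ∀ n, (a n : ℂ) ≠ 0 := fun n => by exact_mod_cast (ha n).ne'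
  have e1 := mul_adjugate_floquet ha haT h.2.2.1 (m := T - j) (j := j) (by omega)
  have e2 : floquetSol a b T x (Complex.exp (Complex.I * θ)) (T - j) =
      transferProd a b x 0 (T - j - 1) 1 0 * monodromy a b T x 0 1 +
      transferProd a b x 0 (T - j - 1) 1 1 *
        (Complex.exp (Complex.I * θ) - monodromy a b T x 0 0) := by
    rw [floquetSol, ← transferSol_succ]; congr 1; omega
  rw [coeffE, coeffD, coeffFactor]
  have := ha' (T - j)
  have := ha' 0
  set ψ := floquetSol a b T x (Complex.exp (Complex.I * θ)) (T - j)
  set μ := Complex.exp (Complex.I * θ)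
  set p₁ := monodromy a b T x 0 0
  set p₂ := monodromy a b T x 0 1
  set A := transferProd a b x (T - j) j
  set B := transferProd a b x 0 (T - j - 1)
  have f1 : B 1 0 * (p₂ / (μ - p₁)) + B 1 1 = ψ / (μ - p₁) := by
    rw [e2]; field_simp
  have f2 : -(A 0 1) + A 1 1 * (p₂ / (μ - p₁))
      = (-(A 0 1) * (μ - p₁) + A 1 1 * p₂) / (μ - p₁) := by
    field_simp
  rw [f1, f2]
  have f3 : ∀ N : ℂ, N * μ / (2 * p₂) * (ψ / (μ - p₁)) *
      ((-(A 0 1) * (μ - p₁) + A 1 1 * p₂) / (μ - p₁)) =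
      N / (2 * p₂) * (ψ / (μ - p₁)) * (μ * (-(A 0 1) * (μ - p₁) + A 1 1 * p₂) / (μ - p₁)) := by
    intro N; ring
  rw [f3, e1]
  field_simp
  ring

lemma coeffFactor_norm (ha : ∀ n, 0 < a n) {x θ : ℝ} (h : IsQuasiMomentum a b T x θ) :
    ‖coeffFactor a b T x θ‖ = 1 / (4 * T * a 0 * ‖monodromy a b T x 0 1‖) := by
  have h1 := norm_ne_zero_iff.2 h.sub_ne_zero
  rw [coeffFactor, norm_div, norm_mul, norm_pow, Complex.norm_real]
  simp only [norm_mul, norm_pow, norm_norm, Complex.norm_real, Complex.norm_natCast,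
    Complex.norm_ofNat, Real.norm_of_nonneg (ha 0).le]
  field_simp

lemma coeffFactor_ne_zero (hT : 0 < T) (ha : ∀ n, 0 < a n) (haT : ∀ n, a (n + T) = a n) {x θ : ℝ}
    (h : IsQuasiMomentum a b T x θ) : coeffFactor a b T x θ ≠ 0 := by
  have h2 := norm_pos_iff.2 (h.monodromy_ne_zero ha haT)
  have := ha 0
  have : (0 : ℝ) < T := by exact_mod_cast hT
  rw [← norm_pos_iff, coeffFactor_norm ha h]
  positivity

/-- Reindexing of the sums that define the resonance amplitudes by the site `i + 1 = T - j`. -/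
lemma sum_coeffE_mul (ha : ∀ n, 0 < a n) (haT : ∀ n, a (n + T) = a n) {x θ : ℝ}
    (h : IsQuasiMomentum a b T x θ) (f : ℂ → ℂ) :
    ∑ j ∈ Finset.range T, coeffE a b T x θ j * f ((T : ℂ) - j) =
      coeffFactor a b T x θ * ∑ i ∈ Finset.range T,
        floquetSol a b T x (Complex.exp (Complex.I * θ)) (i + 1) ^ 2 * f ((i + 1 : ℕ) : ℂ) := by
  rw [Finset.mul_sum, ← Finset.sum_range_reflect]
  refine Finset.sum_congr rfl fun i hi => ?_
  have hi' := Finset.mem_range.1 hi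
  rw [coeffE_eq ha haT h (by omega), show T - (T - 1 - i) = i + 1 by omega,
    ← Nat.cast_sub (by omega), show T - (T - 1 - i) = i + 1 by omega]
  ring

end EllipticPoints

/-! ### Weyl solutions on the upper half-plane and the elliptic set -/

section WeylSolutions

open ComplexConjugate

variable {a b : ℕ → ℝ} {T : ℕ}

/-- The flux `a_n Im(ψ_{n+1} \bar ψ_n)` of a sequence through the bond `(n, n + 1)`. -/
noncomputable def flux (a : ℕ → ℝ) (ψ : ℕ → ℂ) (n : ℕ) : ℝ := a n * (ψ (n + 1) * conj (ψ n)).im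

/-- Green's identity: the flux of a solution grows by `Im z |ψ_{n+1}|²` at the site `n + 1`. -/
lemma flux_succ {z : ℂ} {ψ : ℕ → ℂ} (hψ : ∀ n, (a n : ℂ) * ψ n + b (n + 1) * ψ (n + 1)
    + a (n + 1) * ψ (n + 2) = z * ψ (n + 1)) (n : ℕ) :
    flux a ψ (n + 1) = flux a ψ n + z.im * ‖ψ (n + 1)‖ ^ 2 := by
  have h := congrArg (fun w => (w * conj (ψ (n + 1))).im) (hψ n)
  simp only [flux, Complex.sq_norm, Complex.normSq_apply, Complex.mul_im, Complex.mul_re,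
    Complex.add_im, Complex.add_re, Complex.conj_re, Complex.conj_im, Complex.ofReal_re,
    Complex.ofReal_im, add_assoc, Nat.reduceAdd] at h ⊢
  linear_combination h

lemma flux_monotone {z : ℂ} (hz : 0 ≤ z.im) {ψ : ℕ → ℂ} (hψ : ∀ n, (a n : ℂ) * ψ n
    + b (n + 1) * ψ (n + 1) + a (n + 1) * ψ (n + 2) = z * ψ (n + 1)) : Monotone (flux a ψ) :=
  monotone_nat_of_le_succ fun n => by
    rw [flux_succ hψ n]; have := mul_nonneg hz (sq_nonneg ‖ψ (n + 1)‖); linarith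

/-- `p₂` is the value at the site `T` of the solution with values `0, 1` at the sites `0, 1`; if it
vanished, that solution would have flux `0` at both ends. -/
lemma monodromy_ne_zero_of_im_pos (hT : 0 < T) (ha : ∀ n, 0 < a n) {z : ℂ} (hz : 0 < z.im) :
    monodromy a b T z 0 1 ≠ 0 := by
  intro h0
  have hψ := transferSol_rec (b := b) ha z 0 1
  have hm := flux_monotone hz.le hψ hT
  have h1 := flux_succ hψ 0
  have hT0 : transferSol a b z 0 1 T = 0 := by
    rw [monodromy] at h0; simp [transferSol, h0]
  rw [Nat.succ_eq_add_one, h1] at hm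
  simp [flux, hT0] at hm
  linarith

lemma flux_floquetSol_add_period (ha : ∀ n, 0 < a n) (haT : ∀ n, a (n + T) = a n)
    (hbT : ∀ n, b (n + T) = b n) {z μ : ℂ} (hμ : IsMultiplier a b T z μ) (n : ℕ) :
    flux a (floquetSol a b T z μ) (n + T) = ‖μ‖ ^ 2 * flux a (floquetSol a b T z μ) n := by
  rw [flux, flux, haT, show n + T + 1 = (n + 1) + T by ring, floquetSol_add_period ha haT hbT hμ,
    floquetSol_add_period ha haT hbT hμ, map_mul, Complex.sq_norm, Complex.normSq_apply]
  simp only [Complex.mul_im, Complex.mul_re, Complex.conj_re, Complex.conj_im]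
  ring

lemma flux_floquetSol_zero (a b : ℕ → ℝ) (T : ℕ) (z μ : ℂ) (h : monodromy a b T z 0 1 ≠ 0) :
    flux a (floquetSol a b T z μ) 0 = a 0 * ‖monodromy a b T z 0 1‖ ^ 2 *
      ((μ - monodromy a b T z 0 0) / monodromy a b T z 0 1).im := by
  have h0 : Complex.normSq (monodromy a b T z 0 1) ≠ 0 := by simpa using h
  rw [flux, floquetSol, floquetSol, zero_add, transferSol_one, transferSol_zero, Complex.sq_norm,
    Complex.div_im]
  simp only [Complex.mul_im, Complex.conj_re, Complex.conj_im]
  field_simp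
  ring

/-- Over one period the flux of a Floquet solution gets multiplied by `|μ|²`, and it grows strictly
in the upper half-plane. -/
lemma sub_mul_flux_pos (hT : 0 < T) (ha : ∀ n, 0 < a n) (haT : ∀ n, a (n + T) = a n)
    (hbT : ∀ n, b (n + T) = b n) {z μ : ℂ} (hz : 0 < z.im) (hμ : IsMultiplier a b T z μ) :
    0 < (‖μ‖ ^ 2 - 1) * flux a (floquetSol a b T z μ) 0 := by
  have hψ := floquetSol_rec (b := b) (T := T) ha z μ
  have h1 := flux_floquetSol_add_period ha haT hbT hμ 0
  obtain ⟨N, rfl⟩ : ∃ N, T = N + 1 := ⟨T - 1, by omega⟩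
  have h2 := flux_succ hψ N
  have h3 := flux_monotone hz.le hψ (Nat.zero_le N)
  have h4 := floquetSol_add_period ha haT hbT hμ 0
  have h5 : floquetSol a b (N + 1) z μ (N + 1) ≠ 0 := by
    rw [zero_add] at h4
    rw [h4, floquetSol, transferSol_zero]
    exact mul_ne_zero (hμ.ne_zero ha haT) (monodromy_ne_zero_of_im_pos hT ha hz)
  rw [zero_add] at h1
  have := mul_pos hz (pow_pos (norm_pos_iff.2 h5) 2)
  linarith

/-- The multiplier of the Weyl solution, given by an explicit branch of
`(Δ ± √(Δ² - 4)) / 2`: among the two eigenvectors `(p₂, μ - p₁)` of the monodromy matrix it selects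
the one for which `(μ - p₁) / p₂` has negative imaginary part. In this form it is visibly analytic
across the elliptic set. -/
noncomputable def weylMult (a b : ℕ → ℝ) (T : ℕ) (z : ℂ) : ℂ :=
  (floquetDisc a b T z - Complex.I * monodromy a b T z 0 1 *
    ((4 - floquetDisc a b T z ^ 2) / monodromy a b T z 0 1 ^ 2) ^ (2⁻¹ : ℂ)) / 2

/-- The Floquet solution with multiplier `weylMult`. -/
noncomputable def weylSol (a b : ℕ → ℝ) (T : ℕ) (z : ℂ) (k : ℕ) : ℂ :=
  floquetSol a b T z (weylMult a b T z) k

/-- `z` is a point at which the Weyl solution exists, is analytic in `z`, and has negative flux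
through all bonds. -/
structure IsWeylPoint (a b : ℕ → ℝ) (T : ℕ) (z : ℂ) : Prop where
  ne_zero : monodromy a b T z 0 1 ≠ 0
  mem_slitPlane : (4 - floquetDisc a b T z ^ 2) / monodromy a b T z 0 1 ^ 2 ∈ Complex.slitPlane
  isMultiplier : IsMultiplier a b T z (weylMult a b T z)
  flux_neg : ∀ k, flux a (weylSol a b T z) k < 0

lemma sq_mem_slitPlane {s : ℂ} (hs : 0 < s.re) : s ^ 2 ∈ Complex.slitPlane := by
  rw [Complex.mem_slitPlane_iff, sq, Complex.mul_re, Complex.mul_im]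
  by_cases h : s.im = 0
  · left; rw [h]; nlinarith
  · right
    intro h'
    exact mul_ne_zero hs.ne' h (by linarith)

/-- The two roots `r` of `p₂ r² + (p₁ - p₄) r - p₃ = 0` are separated by the real axis, so that the
principal square root in `weylMult` selects the lower one. -/
lemma weylMult_eq {z μ ν : ℂ} (h0 : monodromy a b T z 0 1 ≠ 0) (hs : μ + ν = floquetDisc a b T z)
    (hp : μ * ν = 1) (h1 : ((μ - monodromy a b T z 0 0) / monodromy a b T z 0 1).im < 0)
    (h2 : 0 < ((ν - monodromy a b T z 0 0) / monodromy a b T z 0 1).im) :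
    (4 - floquetDisc a b T z ^ 2) / monodromy a b T z 0 1 ^ 2 ∈ Complex.slitPlane ∧
      weylMult a b T z = μ := by
  set s : ℂ := Complex.I * ((μ - ν) / monodromy a b T z 0 1) with hsdef
  have hre : 0 < s.re := by
    have : (μ - ν) / monodromy a b T z 0 1 = (μ - monodromy a b T z 0 0) / monodromy a b T z 0 1
      - (ν - monodromy a b T z 0 0) / monodromy a b T z 0 1 := by ring
    rw [hsdef, this, Complex.I_mul_re, Complex.sub_im]
    linarith
  have hsq : (4 - floquetDisc a b T z ^ 2) / monodromy a b T z 0 1 ^ 2 = s ^ 2 := by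
    rw [hsdef, mul_pow, Complex.I_sq, ← hs]
    field_simp
    linear_combination -4 * hp
  refine ⟨hsq ▸ sq_mem_slitPlane hre, ?_⟩
  rw [weylMult, hsq, Complex.sq_cpow_two_inv hre, hsdef, ← hs]
  field_simp
  linear_combination (-(μ - ν)) * Complex.I_sq

lemma exists_multiplier_pair (a b : ℕ → ℝ) (T : ℕ) (z : ℂ) :
    ∃ μ ν : ℂ, μ + ν = floquetDisc a b T z ∧ μ * ν = 1 := by
  obtain ⟨s, hs⟩ := IsAlgClosed.exists_pow_nat_eq (floquetDisc a b T z ^ 2 - 4) (n := 2) two_pos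
  exact ⟨(floquetDisc a b T z + s) / 2, (floquetDisc a b T z - s) / 2, by ring,
    by linear_combination (-1 / 4) * hs⟩

lemma isMultiplier_of_pair (ha : ∀ n, 0 < a n) (haT : ∀ n, a (n + T) = a n) {z μ ν : ℂ}
    (hs : μ + ν = floquetDisc a b T z) (hp : μ * ν = 1) : IsMultiplier a b T z μ := by
  rw [isMultiplier_iff ha haT, ← hs]; linear_combination -hp

lemma isWeylPoint_of_im_pos (hT : 0 < T) (ha : ∀ n, 0 < a n) (haT : ∀ n, a (n + T) = a n)
    (hbT : ∀ n, b (n + T) = b n) {z : ℂ} (hz : 0 < z.im) :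
    IsWeylPoint a b T z ∧ ‖weylMult a b T z‖ < 1 := by
  have h0 := monodromy_ne_zero_of_im_pos (b := b) hT ha hz
  have key : ∀ μ, IsMultiplier a b T z μ →
      0 < (‖μ‖ ^ 2 - 1) * ((μ - monodromy a b T z 0 0) / monodromy a b T z 0 1).im := by
    intro μ hμ
    have h := sub_mul_flux_pos hT ha haT hbT hz hμ
    rw [flux_floquetSol_zero _ _ _ _ _ h0] at h
    have hc : 0 < a 0 * ‖monodromy a b T z 0 1‖ ^ 2 :=
      mul_pos (ha 0) (pow_pos (norm_pos_iff.2 h0) 2)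
    refine (mul_pos_iff_of_pos_left hc).1 ?_
    linarith
  -- Label the two multipliers so that `μ` is the one inside the unit disc.
  obtain ⟨μ, ν, hs, hp, hlt⟩ : ∃ μ ν : ℂ, μ + ν = floquetDisc a b T z ∧ μ * ν = 1 ∧ ‖μ‖ < 1 := by
    obtain ⟨μ, ν, hs, hp⟩ := exists_multiplier_pair a b T z
    rcases lt_trichotomy ‖μ‖ 1 with h | h | h
    · exact ⟨μ, ν, hs, hp, h⟩
    · have := key μ (isMultiplier_of_pair ha haT hs hp)
      simp [h] at this
    · refine ⟨ν, μ, by rw [add_comm, hs], by rw [mul_comm, hp], ?_⟩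
      have h' : ‖μ‖ * ‖ν‖ = 1 := by rw [← norm_mul, hp, norm_one]
      nlinarith [norm_nonneg ν]
  have hμ := isMultiplier_of_pair ha haT hs hp
  have hν : IsMultiplier a b T z ν :=
    isMultiplier_of_pair (μ := ν) (ν := μ) ha haT (by rw [add_comm, hs]) (by rw [mul_comm, hp])
  have hgt : 1 < ‖ν‖ := by
    have h' : ‖μ‖ * ‖ν‖ = 1 := by rw [← norm_mul, hp, norm_one]
    nlinarith [norm_nonneg μ, norm_nonneg ν]
  have h1 : ((μ - monodromy a b T z 0 0) / monodromy a b T z 0 1).im < 0 := by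
    have := key μ hμ
    have : ‖μ‖ ^ 2 - 1 < 0 := by nlinarith [norm_nonneg μ]
    by_contra h; push Not at h
    nlinarith
  have h2 : 0 < ((ν - monodromy a b T z 0 0) / monodromy a b T z 0 1).im := by
    have := key ν hν
    have : 0 < ‖ν‖ ^ 2 - 1 := by nlinarith
    by_contra h; push Not at h
    nlinarith
  obtain ⟨h3, h4⟩ := weylMult_eq h0 hs hp h1 h2
  refine ⟨⟨h0, h3, h4 ▸ hμ, fun k => ?_⟩, h4 ▸ hlt⟩
  have hf : weylSol a b T z = floquetSol a b T z μ := by funext k; rw [weylSol, h4]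
  rw [hf]
  have hneg : ∀ m : ℕ, flux a (floquetSol a b T z μ) (m * T) < 0 := by
    intro m
    induction m with
    | zero =>
      rw [zero_mul, flux_floquetSol_zero _ _ _ _ _ h0]
      exact mul_neg_of_pos_of_neg (mul_pos (ha 0) (pow_pos (norm_pos_iff.2 h0) 2)) h1
    | succ m ih =>
      rw [add_mul, one_mul, flux_floquetSol_add_period ha haT hbT hμ]
      exact mul_neg_of_pos_of_neg (pow_pos (norm_pos_iff.2 (hμ.ne_zero ha haT)) 2) ih
  exact (flux_monotone hz.le (floquetSol_rec ha z μ)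
    (Nat.le_mul_of_pos_right k hT)).trans_lt (hneg k)

lemma isWeylPoint_of_isQuasiMomentum (ha : ∀ n, 0 < a n)
    (haT : ∀ n, a (n + T) = a n) {x θ : ℝ} (h : IsQuasiMomentum a b T x θ) :
    IsWeylPoint a b T x ∧ (weylMult a b T x = Complex.exp (Complex.I * θ) ∨
      weylMult a b T x = Complex.exp (-(Complex.I * θ))) := by
  have h0 := h.monodromy_ne_zero ha haT
  have hD := h.floquetDisc_eq ha haT
  have hs : Complex.exp (Complex.I * θ) + Complex.exp (-(Complex.I * θ)) =
      floquetDisc a b T x := by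
    rw [hD, Complex.ofReal_cos, Complex.two_cos]; ring_nf
  have hp : Complex.exp (Complex.I * θ) * Complex.exp (-(Complex.I * θ)) = 1 := by
    rw [← Complex.exp_add]; simp
  have key : ∀ μ : ℂ, ((μ - monodromy a b T x 0 0) / monodromy a b T x 0 1).im =
      μ.im / (monodromy a b T x 0 1).re := by
    intro μ
    have h2 : monodromy a b T x 0 1 = ((monodromy a b T x 0 1).re : ℂ) :=
      Complex.ext rfl (by simp [monodromy_ofReal_im])
    rw [h2, Complex.div_ofReal_im, Complex.sub_im, monodromy_ofReal_im, sub_zero,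
      Complex.ofReal_re]
  have him : (Complex.exp (-(Complex.I * θ))).im = -Real.sin θ := by
    rw [← Complex.conj_exp_I_mul_ofReal, Complex.conj_im, Complex.exp_I_mul_ofReal_im]
  have main : ∀ μ ν : ℂ, μ + ν = floquetDisc a b T x → μ * ν = 1 →
      μ.im / (monodromy a b T x 0 1).re < 0 → 0 < ν.im / (monodromy a b T x 0 1).re →
      IsWeylPoint a b T x ∧ weylMult a b T x = μ := by
    intro μ ν hs hp h1 h2
    have h1' := (key μ).trans_lt h1
    obtain ⟨h3, h4⟩ := weylMult_eq h0 hs hp h1' (h2.trans_eq (key ν).symm)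
    have hμ := isMultiplier_of_pair ha haT hs hp
    refine ⟨⟨h0, h3, h4 ▸ hμ, fun k => ?_⟩, h4⟩
    have hf : weylSol a b T x = floquetSol a b T x μ := by funext k; rw [weylSol, h4]
    rw [hf]
    induction k with
    | zero =>
      rw [flux_floquetSol_zero _ _ _ _ _ h0]
      exact mul_neg_of_pos_of_neg (mul_pos (ha 0) (pow_pos (norm_pos_iff.2 h0) 2)) h1'
    | succ k ih => rw [flux_succ (floquetSol_rec ha _ μ) k]; simpa using ih
  have hre : (monodromy a b T x 0 1).re ≠ 0 := fun h' => h0 (Complex.ext h' (monodromy_ofReal_im ..))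
  rcases lt_or_gt_of_ne hre with hneg | hpos
  · obtain ⟨h1, h2⟩ := main _ _ hs hp
      (by rw [Complex.exp_I_mul_ofReal_im]; exact div_neg_of_pos_of_neg h.sin_pos hneg)
      (by rw [him]; exact div_pos_of_neg_of_neg (by linarith [h.sin_pos]) hneg)
    exact ⟨h1, Or.inl h2⟩
  · obtain ⟨h1, h2⟩ := main _ _ (by rw [add_comm, hs]) (by rw [mul_comm, hp])
      (by rw [him]; exact div_neg_of_neg_of_pos (by linarith [h.sin_pos]) hpos)
      (by rw [Complex.exp_I_mul_ofReal_im]; exact div_pos h.sin_pos hpos)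
    exact ⟨h1, Or.inr h2⟩

end WeylSolutions

/-! ### The branch `g` of `μ^{2/T}` -/

section MultiplierRoot

open ComplexConjugate

variable {a b : ℕ → ℝ} {T : ℕ}

lemma differentiable_transferProd (a b : ℕ → ℝ) (m k : ℕ) (i j : Fin 2) :
    Differentiable ℂ fun z => transferProd a b z m k i j := by
  induction k generalizing i j with
  | zero => simp [transferProd]
  | succ k ih =>
    simp only [transferProd, Matrix.mul_apply, Fin.sum_univ_two]
    have : ∀ l, Differentiable ℂ fun z => transferMatrix a b z (m + k + 1) i l := by
      intro l
      fin_cases i <;> fin_cases l <;> simp [transferMatrix]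
    exact ((this 0).mul (ih 0 j)).add ((this 1).mul (ih 1 j))

lemma differentiable_monodromy (a b : ℕ → ℝ) (T : ℕ) (i j : Fin 2) :
    Differentiable ℂ fun z => monodromy a b T z i j := differentiable_transferProd a b 0 T i j

lemma differentiable_floquetDisc (a b : ℕ → ℝ) (T : ℕ) :
    Differentiable ℂ (floquetDisc a b T) :=
  (differentiable_monodromy a b T 0 0).add (differentiable_monodromy a b T 1 1)

/-- The quotient `ψ_{k+1} / ψ_k` of consecutive values of the Weyl solution. -/
noncomputable def weylRatio (a b : ℕ → ℝ) (T : ℕ) (z : ℂ) (k : ℕ) : ℂ :=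
  weylSol a b T z (k + 1) / weylSol a b T z k

/-- The branch of `μ^{2/T}`: since `μ` is the product of the Weyl ratios over one period, and these
lie in the lower half-plane, principal logarithms can be used for each of them. -/
noncomputable def weylRoot (a b : ℕ → ℝ) (T : ℕ) (z : ℂ) : ℂ :=
  Complex.exp (2 / T * ∑ k ∈ Finset.range T, Complex.log (weylRatio a b T z k))

namespace IsWeylPoint

variable {z : ℂ}

lemma weylSol_ne_zero (h : IsWeylPoint a b T z) (k : ℕ) : weylSol a b T z k ≠ 0 := by
  intro h0
  have := h.flux_neg k
  simp [flux, h0] at this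

lemma weylRatio_ne_zero (h : IsWeylPoint a b T z) (k : ℕ) : weylRatio a b T z k ≠ 0 :=
  div_ne_zero (h.weylSol_ne_zero _) (h.weylSol_ne_zero _)

lemma weylRatio_im_neg (h : IsWeylPoint a b T z) (ha : ∀ n, 0 < a n) (k : ℕ) :
    (weylRatio a b T z k).im < 0 := by
  have h1 := h.flux_neg k
  have h0 : 0 < Complex.normSq (weylSol a b T z k) := Complex.normSq_pos.2 (h.weylSol_ne_zero k)
  have h2 : (weylSol a b T z (k + 1) * conj (weylSol a b T z k)).im < 0 := by
    rw [flux] at h1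
    by_contra h'
    push Not at h'
    have := mul_nonneg (ha k).le h'
    linarith
  have h3 : (weylRatio a b T z k).im =
      (weylSol a b T z (k + 1) * conj (weylSol a b T z k)).im
        / Complex.normSq (weylSol a b T z k) := by
    rw [weylRatio, Complex.div_im, Complex.mul_im, Complex.conj_re, Complex.conj_im]
    ring
  rw [h3]
  exact div_neg_of_neg_of_pos h2 h0

lemma weylRatio_mem_slitPlane (h : IsWeylPoint a b T z) (ha : ∀ n, 0 < a n) (k : ℕ) :
    weylRatio a b T z k ∈ Complex.slitPlane :=
  Complex.mem_slitPlane_iff.2 (Or.inr (h.weylRatio_im_neg ha k).ne)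

lemma weylSol_add_period (h : IsWeylPoint a b T z) (ha : ∀ n, 0 < a n)
    (haT : ∀ n, a (n + T) = a n) (hbT : ∀ n, b (n + T) = b n) (k : ℕ) :
    weylSol a b T z (k + T) = weylMult a b T z * weylSol a b T z k :=
  floquetSol_add_period ha haT hbT h.isMultiplier k

lemma weylRatio_add_period (h : IsWeylPoint a b T z) (ha : ∀ n, 0 < a n)
    (haT : ∀ n, a (n + T) = a n) (hbT : ∀ n, b (n + T) = b n) (k : ℕ) :
    weylRatio a b T z (k + T) = weylRatio a b T z k := by
  rw [weylRatio, show k + T + 1 = k + 1 + T by ring, h.weylSol_add_period ha haT hbT,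
    h.weylSol_add_period ha haT hbT, mul_div_mul_left _ _ (h.isMultiplier.ne_zero ha haT)]
  rfl

lemma prod_weylRatio (h : IsWeylPoint a b T z) (n : ℕ) :
    ∏ k ∈ Finset.range n, weylRatio a b T z k = weylSol a b T z n / weylSol a b T z 0 := by
  induction n with
  | zero => simp [h.weylSol_ne_zero]
  | succ n ih =>
    have := h.weylSol_ne_zero n
    have := h.weylSol_ne_zero 0
    rw [Finset.prod_range_succ, ih, weylRatio]
    field_simp

lemma prod_weylRatio_period (h : IsWeylPoint a b T z) (ha : ∀ n, 0 < a n)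
    (haT : ∀ n, a (n + T) = a n) (hbT : ∀ n, b (n + T) = b n) :
    ∏ k ∈ Finset.range T, weylRatio a b T z k = weylMult a b T z := by
  have h1 := h.weylSol_add_period ha haT hbT 0
  rw [zero_add] at h1
  rw [h.prod_weylRatio, h1, mul_div_cancel_right₀ _ (h.weylSol_ne_zero 0)]

/-- The recurrence, as a Riccati equation for the ratios. -/
lemma weylRatio_riccati (h : IsWeylPoint a b T z) (ha : ∀ n, 0 < a n) (k : ℕ) :
    weylRatio a b T z k * (z - b (k + 1) - a (k + 1) * weylRatio a b T z (k + 1)) = a k := by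
  have h0 := h.weylSol_ne_zero k
  have h1 := h.weylSol_ne_zero (k + 1)
  have hr : (a k : ℂ) * weylSol a b T z k + b (k + 1) * weylSol a b T z (k + 1)
      + a (k + 1) * weylSol a b T z (k + 2) = z * weylSol a b T z (k + 1) :=
    floquetSol_rec ha z _ k
  rw [weylRatio, weylRatio, show k + 1 + 1 = k + 2 from rfl]
  field_simp
  linear_combination -hr

lemma weylRoot_pow (h : IsWeylPoint a b T z) (hT : 0 < T) (ha : ∀ n, 0 < a n)
    (haT : ∀ n, a (n + T) = a n) (hbT : ∀ n, b (n + T) = b n) :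
    weylRoot a b T z ^ T = weylMult a b T z ^ 2 := by
  have hT' : (T : ℂ) ≠ 0 := by exact_mod_cast hT.ne'
  rw [weylRoot, ← Complex.exp_nat_mul, ← h.prod_weylRatio_period ha haT hbT, ← mul_assoc,
    mul_div_cancel₀ _ hT', ← Nat.cast_ofNat (R := ℂ), Complex.exp_nat_mul, Complex.exp_sum]
  congr 1
  exact Finset.prod_congr rfl fun k _ => Complex.exp_log (h.weylRatio_ne_zero k)

lemma differentiableAt_weylMult (h : IsWeylPoint a b T z) :
    DifferentiableAt ℂ (weylMult a b T) z := by
  have hD := differentiable_floquetDisc a b T z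
  have hp := differentiable_monodromy a b T 0 1 z
  have hq : DifferentiableAt ℂ
      (fun z => (4 - floquetDisc a b T z ^ 2) / monodromy a b T z 0 1 ^ 2) z :=
    ((differentiableAt_const _).sub (hD.pow 2)).div (hp.pow 2) (pow_ne_zero 2 h.ne_zero)
  unfold weylMult
  exact (hD.sub (((differentiableAt_const _).mul hp).mul
    (hq.cpow_const h.mem_slitPlane))).div_const 2

lemma differentiableAt_weylSol (h : IsWeylPoint a b T z) (k : ℕ) :
    DifferentiableAt ℂ (fun z => weylSol a b T z k) z := by
  unfold weylSol floquetSol transferSol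
  exact ((differentiable_transferProd a b 0 k 0 0 z).mul (differentiable_monodromy a b T 0 1 z)).add
    ((differentiable_transferProd a b 0 k 0 1 z).mul
      (h.differentiableAt_weylMult.sub (differentiable_monodromy a b T 0 0 z)))

lemma differentiableAt_weylRoot (h : IsWeylPoint a b T z) (ha : ∀ n, 0 < a n) :
    DifferentiableAt ℂ (weylRoot a b T) z := by
  have hr : ∀ k, DifferentiableAt ℂ (fun z => Complex.log (weylRatio a b T z k)) z := fun k =>
    ((h.differentiableAt_weylSol (k + 1)).div (h.differentiableAt_weylSol k)
      (h.weylSol_ne_zero k)).clog (h.weylRatio_mem_slitPlane ha k)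
  unfold weylRoot
  exact ((differentiableAt_const _).mul (DifferentiableAt.fun_sum fun k _ => hr k)).cexp

/-- Where `|μ| = 1`, the value of the root has argument in `(-2π, 0)`: it is `2 / T` times a sum of
`T` arguments of numbers in the lower half-plane. In particular it is not `1`. -/
lemma exists_weylRoot_eq_exp (h : IsWeylPoint a b T z) (hT : 0 < T) (ha : ∀ n, 0 < a n)
    (haT : ∀ n, a (n + T) = a n) (hbT : ∀ n, b (n + T) = b n) (hμ : ‖weylMult a b T z‖ = 1) :
    ∃ w : ℝ, 0 < w ∧ w < 2 * Real.pi ∧ weylRoot a b T z = Complex.exp (-(Complex.I * w)) := by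
  have hT' : (0 : ℝ) < T := by exact_mod_cast hT
  have harg : ∀ k, -Real.pi < (weylRatio a b T z k).arg ∧ (weylRatio a b T z k).arg < 0 :=
    fun k => ⟨Complex.neg_pi_lt_arg _, Complex.arg_neg_iff.2 (h.weylRatio_im_neg ha k)⟩
  have hne : (Finset.range T).Nonempty := ⟨0, Finset.mem_range.2 hT⟩
  set s := ∑ k ∈ Finset.range T, (weylRatio a b T z k).arg with hs
  have hs0 : s < 0 := Finset.sum_neg (fun k _ => (harg k).2) hne
  have hs1 : -(T * Real.pi) < s := by
    have := Finset.sum_lt_sum_of_nonempty hne fun k _ => (harg k).1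
    simpa using this
  have hlog : ∑ k ∈ Finset.range T, Real.log ‖weylRatio a b T z k‖ = 0 := by
    rw [← Real.log_prod (fun k _ => norm_ne_zero_iff.2 (h.weylRatio_ne_zero k)), ← norm_prod,
      h.prod_weylRatio_period ha haT hbT, hμ, Real.log_one]
  refine ⟨-(2 / T * s), by have := mul_neg_of_pos_of_neg (by positivity : (0:ℝ) < 2 / T) hs0; linarith,
    ?_, ?_⟩
  · rw [← mul_neg, div_mul_eq_mul_div, div_lt_iff₀ hT']
    linarith
  · rw [weylRoot]
    congr 1
    have : ∑ k ∈ Finset.range T, Complex.log (weylRatio a b T z k) = (s : ℂ) * Complex.I := by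
      simp only [Complex.log, Finset.sum_add_distrib, ← Finset.sum_mul, ← Complex.ofReal_sum, hlog,
        hs, Complex.ofReal_zero, zero_add]
    rw [this]
    push_cast
    ring

end IsWeylPoint

lemma exists_bound_of_periodic {f : ℕ → ℝ} (hT : 0 < T) (hf : ∀ n, f (n + T) = f n) :
    ∃ C, ∀ n, |f n| ≤ C := by
  refine ⟨∑ i ∈ Finset.range T, |f i|, fun n => ?_⟩
  have hp : Function.Periodic f T := hf
  rw [← hp.map_mod_nat n]
  exact Finset.single_le_sum (f := fun i => |f i|) (fun i _ => abs_nonneg _)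
    (Finset.mem_range.2 (Nat.mod_lt n hT))

/-- For large `|z|` the Riccati equation maps the closed unit disc into a small disc, backwards in
`k`. One of the ratios lies in the unit disc because their product over a period is `μ`; hence, by
periodicity, all of them are small. -/
lemma weylRatio_norm_le (hT : 0 < T) (ha : ∀ n, 0 < a n) (haT : ∀ n, a (n + T) = a n)
    (hbT : ∀ n, b (n + T) = b n) {C : ℝ} (hCa : ∀ n, |a n| ≤ C) (hCb : ∀ n, |b n| ≤ C) {z : ℂ}
    (hz : 0 < z.im) (hzC : 3 * C < ‖z‖) (k : ℕ) :
    ‖weylRatio a b T z k‖ ≤ 1 ∧ ‖weylRatio a b T z k‖ ≤ C / (‖z‖ - 2 * C) := by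
  obtain ⟨h, hμ⟩ := isWeylPoint_of_im_pos hT ha haT hbT hz
  have hC : 0 < C := (ha 0).trans_le ((le_abs_self _).trans (hCa 0))
  have step : ∀ k, ‖weylRatio a b T z (k + 1)‖ ≤ 1 →
      ‖weylRatio a b T z k‖ ≤ 1 ∧ ‖weylRatio a b T z k‖ ≤ C / (‖z‖ - 2 * C) := by
    intro k hk
    have e := congrArg norm (h.weylRatio_riccati ha k)
    rw [norm_mul, Complex.norm_real, Real.norm_eq_abs] at e
    have h1 : ‖z‖ - 2 * C ≤ ‖z - b (k + 1) - a (k + 1) * weylRatio a b T z (k + 1)‖ := by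
      have h2 := norm_sub_norm_le (z - b (k + 1)) (a (k + 1) * weylRatio a b T z (k + 1))
      have h3 := norm_sub_norm_le z (b (k + 1))
      have h4 : ‖(a (k + 1) : ℂ) * weylRatio a b T z (k + 1)‖ ≤ C := by
        rw [norm_mul, Complex.norm_real, Real.norm_eq_abs]
        exact (mul_le_of_le_one_right (abs_nonneg _) hk).trans (hCa _)
      have h5 : ‖(b (k + 1) : ℂ)‖ ≤ C := by
        rw [Complex.norm_real, Real.norm_eq_abs]; exact hCb _
      linarith
    have h6 : ‖weylRatio a b T z k‖ ≤ C / (‖z‖ - 2 * C) := by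
      rw [le_div_iff₀ (by linarith)]
      exact (mul_le_mul_of_nonneg_left h1 (norm_nonneg _)).trans (e.trans_le (hCa k))
    refine ⟨h6.trans ?_, h6⟩
    rw [div_le_one (by linarith)]
    linarith
  obtain ⟨k₀, hk₀⟩ : ∃ k₀, ‖weylRatio a b T z k₀‖ ≤ 1 := by
    by_contra! hcon
    have h1 : ∏ k ∈ Finset.range T, (1 : ℝ) ≤ ∏ k ∈ Finset.range T, ‖weylRatio a b T z k‖ :=
      Finset.prod_le_prod (fun _ _ => zero_le_one) fun k _ => (hcon k).le
    rw [← norm_prod, h.prod_weylRatio_period ha haT hbT, Finset.prod_const_one] at h1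
    linarith
  have hper : ∀ m, ‖weylRatio a b T z (k₀ + m * T)‖ ≤ 1 := by
    intro m
    induction m with
    | zero => simpa using hk₀
    | succ m ih => rwa [add_mul, one_mul, ← add_assoc, h.weylRatio_add_period ha haT hbT]
  have hdown : ∀ j k, ‖weylRatio a b T z (k + j)‖ ≤ 1 → ‖weylRatio a b T z k‖ ≤ 1 := by
    intro j
    induction j with
    | zero => intro k hk; simpa using hk
    | succ j ih => intro k hk; exact ih k (step _ (by rwa [add_assoc])).1
  refine step k (hdown (k₀ + (k + 1) * T - (k + 1)) (k + 1) ?_)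
  have : k + 1 ≤ (k + 1) * T := Nat.le_mul_of_pos_right _ hT
  rw [show k + 1 + (k₀ + (k + 1) * T - (k + 1)) = k₀ + (k + 1) * T by omega]
  exact hper _

lemma tendsto_mul_weylRatio (hT : 0 < T) (ha : ∀ n, 0 < a n) (haT : ∀ n, a (n + T) = a n)
    (hbT : ∀ n, b (n + T) = b n) (k : ℕ) :
    Tendsto (fun z : ℂ => z * weylRatio a b T z k) (Bornology.cobounded ℂ ⊓ 𝓟 {z | 0 < z.im})
      (𝓝 (a k)) := by
  obtain ⟨C₁, h₁⟩ := exists_bound_of_periodic hT haT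
  obtain ⟨C₂, h₂⟩ := exists_bound_of_periodic hT hbT
  set C := max C₁ C₂
  have hCa : ∀ n, |a n| ≤ C := fun n => (h₁ n).trans (le_max_left _ _)
  have hCb : ∀ n, |b n| ≤ C := fun n => (h₂ n).trans (le_max_right _ _)
  have hC : 0 < C := (ha 0).trans_le ((le_abs_self _).trans (hCa 0))
  have hn : Tendsto (fun z : ℂ => ‖z‖) (Bornology.cobounded ℂ ⊓ 𝓟 {z | 0 < z.im}) atTop :=
    tendsto_norm_cobounded_atTop.mono_left inf_le_left
  have hlim : Tendsto (fun z : ℂ => C / (‖z‖ - 2 * C) * (2 * C))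
      (Bornology.cobounded ℂ ⊓ 𝓟 {z | 0 < z.im}) (𝓝 0) := by
    have : Tendsto (fun z : ℂ => C / (‖z‖ - 2 * C)) (Bornology.cobounded ℂ ⊓ 𝓟 {z | 0 < z.im})
        (𝓝 0) := (tendsto_atTop_add_const_right _ (-(2 * C)) hn).const_div_atTop C
    simpa using this.mul_const (2 * C)
  rw [tendsto_iff_norm_sub_tendsto_zero]
  refine squeeze_zero' (Eventually.of_forall fun _ => norm_nonneg _) ?_ hlim
  filter_upwards [hn.eventually_gt_atTop (3 * C), mem_inf_of_right (mem_principal_self _)]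
    with z hzC hz
  obtain ⟨h, -⟩ := isWeylPoint_of_im_pos hT ha haT hbT hz
  obtain ⟨-, hr⟩ := weylRatio_norm_le hT ha haT hbT hCa hCb hz hzC k
  have hr' := (weylRatio_norm_le hT ha haT hbT hCa hCb hz hzC (k + 1)).1
  have e : z * weylRatio a b T z k - a k =
      weylRatio a b T z k * (b (k + 1) + a (k + 1) * weylRatio a b T z (k + 1)) := by
    linear_combination h.weylRatio_riccati ha k
  rw [e, norm_mul]
  refine mul_le_mul hr ((norm_add_le _ _).trans ?_) (norm_nonneg _) ((norm_nonneg _).trans hr)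
  rw [norm_mul, Complex.norm_real, Complex.norm_real, Real.norm_eq_abs, Real.norm_eq_abs, two_mul]
  exact add_le_add (hCb _) ((mul_le_of_le_one_right (abs_nonneg _) hr').trans (hCa _))

lemma tendsto_sq_mul_weylRoot (hT : 0 < T) (ha : ∀ n, 0 < a n) (haT : ∀ n, a (n + T) = a n)
    (hbT : ∀ n, b (n + T) = b n) :
    Tendsto (fun z : ℂ => z ^ 2 * weylRoot a b T z) (Bornology.cobounded ℂ ⊓ 𝓟 {z | 0 < z.im})
      (𝓝 ((((∏ s ∈ Finset.Icc 1 T, a s) ^ ((2 : ℝ) / (T : ℝ)) : ℝ)) : ℂ)) := by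
  have hT' : (T : ℂ) ≠ 0 := by exact_mod_cast hT.ne'
  have hprod : ∏ s ∈ Finset.Icc 1 T, a s = ∏ k ∈ Finset.range T, a k := by
    obtain ⟨N, rfl⟩ : ∃ N, T = N + 1 := ⟨T - 1, by omega⟩
    rw [Finset.prod_range_succ', ← haT 0, zero_add, ← Finset.prod_range_succ (fun k => a (k + 1)),
      Finset.range_eq_Ico, Finset.prod_Ico_add' a 0 (N + 1) 1]
    rfl
  have hlim : Tendsto (fun z : ℂ => Complex.exp (2 / T * ∑ k ∈ Finset.range T,
      Complex.log (z * weylRatio a b T z k))) (Bornology.cobounded ℂ ⊓ 𝓟 {z | 0 < z.im})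
      (𝓝 (Complex.exp (2 / T * ∑ k ∈ Finset.range T, Complex.log (a k)))) := by
    refine (Complex.continuous_exp.tendsto _).comp (Tendsto.const_mul _
      (tendsto_finsetSum _ fun k _ => (tendsto_mul_weylRatio hT ha haT hbT k).clog ?_))
    exact Complex.ofReal_mem_slitPlane.2 (ha k)
  have hval : Complex.exp (2 / T * ∑ k ∈ Finset.range T, Complex.log (a k)) =
      (((∏ s ∈ Finset.Icc 1 T, a s) ^ ((2 : ℝ) / (T : ℝ)) : ℝ)) := by
    rw [hprod, Real.rpow_def_of_pos (Finset.prod_pos fun k _ => ha k),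
      Real.log_prod fun k _ => (ha k).ne']
    push_cast
    simp_rw [Complex.ofReal_log (ha _).le]
    rw [mul_comm]
  rw [← hval]
  refine hlim.congr' ?_
  filter_upwards [mem_inf_of_right (mem_principal_self _)] with z hz
  obtain ⟨h, -⟩ := isWeylPoint_of_im_pos hT ha haT hbT hz
  have hz0 : z ≠ 0 := by rintro rfl; simp at hz
  have hadd : ∀ k, Complex.log (z * weylRatio a b T z k) =
      Complex.log z + Complex.log (weylRatio a b T z k) := by
    intro k
    have h1 := Complex.neg_pi_lt_arg (weylRatio a b T z k)
    have h2 := Complex.arg_neg_iff.2 (h.weylRatio_im_neg ha k)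
    have h3 := Complex.arg_le_pi z
    have h4 : 0 ≤ z.arg := Complex.arg_nonneg_iff.2 (le_of_lt hz)
    exact Complex.log_mul hz0 (h.weylRatio_ne_zero k) ⟨by linarith, by linarith⟩
  have hz2 : z ^ 2 = Complex.exp (2 / T * (T * Complex.log z)) := by
    rw [← mul_assoc, div_mul_cancel₀ _ hT', two_mul, Complex.exp_add, Complex.exp_log hz0, sq]
  simp_rw [hadd]
  rw [Finset.sum_add_distrib, Finset.sum_const, Finset.card_range, nsmul_eq_mul, mul_add,
    Complex.exp_add, ← hz2, weylRoot]

lemma isMultiplierRoot_weylRoot (hT : 0 < T) (ha : ∀ n, 0 < a n) (haT : ∀ n, a (n + T) = a n)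
    (hbT : ∀ n, b (n + T) = b n) {θ : ℝ → ℝ}
    (hθ : ∀ x ∈ ellipticSet a b T, IsQuasiMomentum a b T x (θ x)) :
    IsMultiplierRoot a b T (weylRoot a b T) := by
  refine ⟨fun z hz => ?_, fun z hz => ?_, fun z hz => ?_, tendsto_sq_mul_weylRoot hT ha haT hbT⟩
  · exact ((isWeylPoint_of_im_pos hT ha haT hbT hz).1.differentiableAt_weylRoot
      ha).differentiableWithinAt
  · refine ContinuousAt.continuousWithinAt ?_
    rcases hz with hz | ⟨x, hx, rfl⟩
    · exact ((isWeylPoint_of_im_pos hT ha haT hbT hz).1.differentiableAt_weylRoot ha).continuousAt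
    · exact ((isWeylPoint_of_isQuasiMomentum ha haT (hθ x hx)).1.differentiableAt_weylRoot
        ha).continuousAt
  · obtain ⟨h, hlt⟩ := isWeylPoint_of_im_pos hT ha haT hbT hz
    exact ⟨_, hlt, h.isMultiplier, h.weylRoot_pow hT ha haT hbT⟩

end MultiplierRoot

/-! ### Zeros of algebraic functions -/

section AlgebraicFunctions

open Polynomial

/-- Functions on a set of complex numbers, as an algebra over the polynomials. -/
@[reducible] noncomputable def polynomialAlgebraFun (S : Set ℂ) : Algebra ℂ[X] (S → ℂ) :=
  (RingHom.pi fun s : S => evalRingHom (s : ℂ)).toAlgebra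

/-- The restriction of `f` to `S` is algebraic over the polynomials in `z`. -/
def IsAlgebraicOn (f : ℂ → ℂ) (S : Set ℂ) : Prop :=
  @IsAlgebraic ℂ[X] (S → ℂ) _ _ (polynomialAlgebraFun S) fun s => f s

namespace IsAlgebraicOn

variable {S : Set ℂ} {f g : ℂ → ℂ}

lemma congr (hf : IsAlgebraicOn f S) (h : ∀ s ∈ S, g s = f s) : IsAlgebraicOn g S := by
  rw [IsAlgebraicOn, show (fun s : S => g s) = fun s : S => f s from funext fun s => h s s.2]
  exact hf

lemma polynomial (p : ℂ[X]) (S : Set ℂ) : IsAlgebraicOn (fun z => p.eval z) S := by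
  let _ := polynomialAlgebraFun S
  exact isAlgebraic_algebraMap (R := ℂ[X]) (A := S → ℂ) p

lemma const (c : ℂ) (S : Set ℂ) : IsAlgebraicOn (fun _ => c) S := by
  simpa using polynomial (C c) S

lemma id (S : Set ℂ) : IsAlgebraicOn (fun z => z) S := by simpa using polynomial X S

lemma add (hf : IsAlgebraicOn f S) (hg : IsAlgebraicOn g S) :
    IsAlgebraicOn (fun z => f z + g z) S := by
  let _ := polynomialAlgebraFun S
  exact (Subalgebra.algebraicClosure ℂ[X] (S → ℂ)).add_mem hf hg

lemma mul (hf : IsAlgebraicOn f S) (hg : IsAlgebraicOn g S) :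
    IsAlgebraicOn (fun z => f z * g z) S := by
  let _ := polynomialAlgebraFun S
  exact (Subalgebra.algebraicClosure ℂ[X] (S → ℂ)).mul_mem hf hg

lemma sub (hf : IsAlgebraicOn f S) (hg : IsAlgebraicOn g S) :
    IsAlgebraicOn (fun z => f z - g z) S :=
  (hf.add ((const (-1) S).mul hg)).congr fun _ _ => by ring

lemma pow (hf : IsAlgebraicOn f S) (n : ℕ) : IsAlgebraicOn (fun z => f z ^ n) S := by
  let _ := polynomialAlgebraFun S
  exact (Subalgebra.algebraicClosure ℂ[X] (S → ℂ)).pow_mem hf n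

lemma sum {ι : Type*} (s : Finset ι) {F : ι → ℂ → ℂ} (hF : ∀ i ∈ s, IsAlgebraicOn (F i) S) :
    IsAlgebraicOn (fun z => ∑ i ∈ s, F i z) S := by
  classical
  induction s using Finset.induction_on with
  | empty => simpa using const 0 S
  | insert i s hi ih =>
    simp only [Finset.sum_insert hi]
    exact (hF i (Finset.mem_insert_self i s)).add
      (ih fun j hj => hF j (Finset.mem_insert_of_mem hj))

lemma of_pow {n : ℕ} (hn : 0 < n) (h : IsAlgebraicOn (fun z => f z ^ n) S) :
    IsAlgebraicOn f S := by
  let _ := polynomialAlgebraFun S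
  exact IsAlgebraic.of_pow (R := ℂ[X]) (A := S → ℂ) hn h

/-- If `f` satisfies a polynomial equation, then after division by a power of `f` there is one whose
constant coefficient `c(z)` is a nonzero polynomial. At points that are limits of points with
`f ≠ 0` the reduced equation still holds, so that `c` vanishes at the zeros of `f`. -/
lemma finite_zeros (hf : IsAlgebraicOn f S) (hcont : ContinuousOn f S)
    (hd : ∀ s ∈ S, s ∈ closure {z ∈ S | f z ≠ 0}) : {s ∈ S | f s = 0}.Finite := by
  obtain ⟨P, hP, hP0⟩ : ∃ P : ℂ[X][X], P ≠ 0 ∧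
      ∀ s ∈ S, P.eval₂ (evalRingHom s) (f s) = 0 := by
    let _ := polynomialAlgebraFun S
    obtain ⟨P, hP, hP0⟩ := (hf : IsAlgebraic ℂ[X] fun s : S => f s)
    refine ⟨P, hP, fun s hs => ?_⟩
    have h := congrFun hP0 ⟨s, hs⟩
    rw [aeval_def] at h
    have h' := hom_eval₂ P (algebraMap ℂ[X] (S → ℂ)) (Pi.evalRingHom (fun _ : S => ℂ) ⟨s, hs⟩)
      (fun s : S => f s)
    rw [Pi.evalRingHom_apply, h] at h'
    exact h'.symm
  obtain ⟨Q, hQ, hQ0⟩ := exists_eq_pow_rootMultiplicity_mul_and_not_dvd P hP 0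
  rw [C_0, sub_zero] at hQ hQ0
  have hc : Q.coeff 0 ≠ 0 := fun h => hQ0 (X_dvd_iff.2 h)
  have hQf : ∀ s ∈ S, f s ≠ 0 → Q.eval₂ (evalRingHom s) (f s) = 0 := by
    intro s hs hfs
    have h := hP0 s hs
    rw [hQ, eval₂_mul, eval₂_X_pow] at h
    exact (mul_eq_zero.1 h).resolve_left (pow_ne_zero _ hfs)
  have hQc : ContinuousOn (fun s => Q.eval₂ (evalRingHom s) (f s)) S := by
    simp only [eval₂_eq_sum_range, coe_evalRingHom]
    exact continuousOn_finsetSum _ fun i _ =>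
      (Q.coeff i).continuous.continuousOn.mul (hcont.pow i)
  refine ((Q.coeff 0).roots.toFinset.finite_toSet).subset ?_
  rintro s ⟨hs, hfs⟩
  have hlim : Q.eval₂ (evalRingHom s) (f s) = 0 := by
    have hne : (𝓝[{z ∈ S | f z ≠ 0}] s).NeBot := mem_closure_iff_nhdsWithin_neBot.1 (hd s hs)
    have h1 : Tendsto (fun s => Q.eval₂ (evalRingHom s) (f s)) (𝓝[{z ∈ S | f z ≠ 0}] s)
        (𝓝 (Q.eval₂ (evalRingHom s) (f s))) :=
      (hQc s hs).mono_left (nhdsWithin_mono s fun z hz => hz.1)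
    refine tendsto_nhds_unique h1 (tendsto_const_nhds.congr' ?_)
    filter_upwards [self_mem_nhdsWithin] with z hz
    exact (hQf z hz.1 hz.2).symm
  rw [hfs, eval₂_at_zero] at hlim
  simpa [hc] using hlim

end IsAlgebraicOn

end AlgebraicFunctions

/-! ### Finiteness of the exceptional set -/

section ExceptionalSet

variable {a b : ℕ → ℝ} {T : ℕ}

/-- Up to nonvanishing factors, the discriminant times the resonance amplitudes on the elliptic set,
as a function that is also defined in the upper half-plane. The discriminant accounts for the
points with quasi-momentum `π / 2`, at which the amplitude has another form. -/
noncomputable def resonanceFun (a b : ℕ → ℝ) (T : ℕ) (z : ℂ) : ℂ :=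
  floquetDisc a b T z *
    ∑ i ∈ Finset.range T, weylSol a b T z (i + 1) ^ 2 * weylRoot a b T z ^ (T - (i + 1))

lemma isAlgebraicOn_transferProd (a b : ℕ → ℝ) (m k : ℕ) (i j : Fin 2) (S : Set ℂ) :
    IsAlgebraicOn (fun z => transferProd a b z m k i j) S := by
  induction k generalizing i j with
  | zero => exact IsAlgebraicOn.const ((1 : Matrix (Fin 2) (Fin 2) ℂ) i j) S
  | succ k ih =>
    simp only [transferProd, Matrix.mul_apply, Fin.sum_univ_two]
    have : ∀ l, IsAlgebraicOn (fun z => transferMatrix a b z (m + k + 1) i l) S := by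
      intro l
      fin_cases i <;> fin_cases l <;> simp only [transferMatrix]
      · exact IsAlgebraicOn.const 0 S
      · exact IsAlgebraicOn.const 1 S
      · exact IsAlgebraicOn.const _ S
      · exact (((IsAlgebraicOn.id S).sub (IsAlgebraicOn.const (b (m + k + 1)) S)).mul
          (IsAlgebraicOn.const (a (m + k + 1) : ℂ)⁻¹ S)).congr fun s _ => div_eq_mul_inv _ _
    exact ((this 0).mul (ih 0 j)).add ((this 1).mul (ih 1 j))

lemma isAlgebraicOn_resonanceFun (hT : 0 < T) (ha : ∀ n, 0 < a n) (haT : ∀ n, a (n + T) = a n)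
    (hbT : ∀ n, b (n + T) = b n) {S : Set ℂ} (hS : ∀ z ∈ S, IsWeylPoint a b T z) :
    IsAlgebraicOn (resonanceFun a b T) S := by
  have hM : ∀ i j, IsAlgebraicOn (fun z => monodromy a b T z i j) S := fun i j =>
    isAlgebraicOn_transferProd a b 0 T i j S
  have hD : IsAlgebraicOn (floquetDisc a b T) S := (hM 0 0).add (hM 1 1)
  have hμ : IsAlgebraicOn (weylMult a b T) S := by
    -- The square of `2μ - Δ` is the polynomial `Δ² - 4`.
    have h1 : IsAlgebraicOn (fun z => 2 * weylMult a b T z - floquetDisc a b T z) S :=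
      IsAlgebraicOn.of_pow two_pos (((hD.pow 2).sub (IsAlgebraicOn.const 4 S)).congr fun z hz => by
        linear_combination 4 * (isMultiplier_iff ha haT _ _).1 (hS z hz).isMultiplier)
    exact ((h1.add hD).mul (IsAlgebraicOn.const 2⁻¹ S)).congr fun z _ => by ring
  have hψ : ∀ k, IsAlgebraicOn (fun z => weylSol a b T z k) S := fun k =>
    ((isAlgebraicOn_transferProd a b 0 k 0 0 S).mul (hM 0 1)).add
      ((isAlgebraicOn_transferProd a b 0 k 0 1 S).mul (hμ.sub (hM 0 0)))
  have hg : IsAlgebraicOn (weylRoot a b T) S :=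
    IsAlgebraicOn.of_pow hT ((hμ.pow 2).congr fun z hz => (hS z hz).weylRoot_pow hT ha haT hbT)
  exact hD.mul (IsAlgebraicOn.sum _ fun i _ => ((hψ (i + 1)).pow 2).mul (hg.pow _))

lemma IsWeylPoint.differentiableAt_resonanceFun {z : ℂ} (h : IsWeylPoint a b T z)
    (ha : ∀ n, 0 < a n) : DifferentiableAt ℂ (resonanceFun a b T) z := by
  unfold resonanceFun
  exact (differentiable_floquetDisc a b T z).mul (DifferentiableAt.fun_sum fun i _ =>
    ((h.differentiableAt_weylSol (i + 1)).pow 2).mul ((h.differentiableAt_weylRoot ha).pow _))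

/-- Far out in the upper half-plane `ψ_k / ψ_0` behaves like `a_0 ⋯ a_{k-1} z^{-k}` and `g` like a
positive multiple of `z^{-2}`, so that `∑ ψ_k² g^{-k}` is asymptotic to a positive multiple of
`ψ_0²`. -/
lemma exists_resonanceFun_ne_zero (hT : 0 < T) (ha : ∀ n, 0 < a n) (haT : ∀ n, a (n + T) = a n)
    (hbT : ∀ n, b (n + T) = b n) : ∃ z : ℂ, 0 < z.im ∧ resonanceFun a b T z ≠ 0 := by
  set A : ℝ := (∏ s ∈ Finset.Icc 1 T, a s) ^ ((2 : ℝ) / (T : ℝ)) with hA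
  have hA0 : 0 < A := Real.rpow_pos_of_pos (Finset.prod_pos fun k _ => ha k) _
  set l : Filter ℂ := Bornology.cobounded ℂ ⊓ 𝓟 {z | 0 < z.im} with hl
  set L : ℝ := ∑ i ∈ Finset.range T, (∏ j ∈ Finset.range (i + 1), a j) ^ 2 / A ^ (i + 1) with hL
  have hL0 : 0 < L := Finset.sum_pos (fun i _ => div_pos
    (pow_pos (Finset.prod_pos fun j _ => ha j) 2) (pow_pos hA0 _)) ⟨0, Finset.mem_range.2 hT⟩
  have hlim : Tendsto (fun z : ℂ => ∑ i ∈ Finset.range T,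
      (∏ j ∈ Finset.range (i + 1), (z * weylRatio a b T z j)) ^ 2 /
        (z ^ 2 * weylRoot a b T z) ^ (i + 1)) l (𝓝 (L : ℂ)) := by
    rw [hL]
    push_cast
    exact tendsto_finsetSum _ fun i _ => ((tendsto_finsetProd _ fun j _ =>
      tendsto_mul_weylRatio hT ha haT hbT j).pow 2).div
        ((tendsto_sq_mul_weylRoot hT ha haT hbT).pow (i + 1))
        (pow_ne_zero _ (by exact_mod_cast hA0.ne'))
  have hI : Tendsto (fun y : ℝ => Complex.I * y) atTop l := by
    rw [hl, tendsto_inf, tendsto_principal]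
    refine ⟨?_, (eventually_gt_atTop 0).mono fun y hy => by simpa using hy⟩
    rw [← tendsto_norm_atTop_iff_cobounded]
    simpa using tendsto_abs_atTop_atTop
  have hev := hlim.eventually_ne (Complex.ofReal_ne_zero.2 hL0.ne')
  obtain ⟨y, hy, hy0⟩ := ((hI.eventually hev).and (eventually_gt_atTop 0)).exists
  set z : ℂ := Complex.I * y
  have hz : 0 < z.im := by simpa [z] using hy0
  obtain ⟨h, hlt⟩ := isWeylPoint_of_im_pos hT ha haT hbT hz
  have hz0 : z ≠ 0 := by intro h0; simp [h0] at hz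
  have hg : weylRoot a b T z ≠ 0 := Complex.exp_ne_zero _
  refine ⟨z, hz, mul_ne_zero ?_ ?_⟩
  · intro h0
    have hq := (isMultiplier_iff ha haT _ _).1 h.isMultiplier
    rw [h0, zero_mul, sub_zero] at hq
    have : ‖weylMult a b T z‖ ^ 2 = 1 := by
      rw [← norm_pow, eq_neg_of_add_eq_zero_left hq, norm_neg, norm_one]
    nlinarith [norm_nonneg (weylMult a b T z)]
  · intro h0
    apply hy
    have e : ∀ i ∈ Finset.range T, (∏ j ∈ Finset.range (i + 1), (z * weylRatio a b T z j)) ^ 2 /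
        (z ^ 2 * weylRoot a b T z) ^ (i + 1) = (weylSol a b T z (i + 1) ^ 2 *
          weylRoot a b T z ^ (T - (i + 1))) / (weylSol a b T z 0 ^ 2 * weylRoot a b T z ^ T) := by
      intro i hi
      have h1 : T = (i + 1) + (T - (i + 1)) := by have := Finset.mem_range.1 hi; omega
      have hpow : weylRoot a b T z ^ T =
          weylRoot a b T z ^ (i + 1) * weylRoot a b T z ^ (T - (i + 1)) := by
        rw [← pow_add, ← h1]
      rw [Finset.prod_mul_distrib, h.prod_weylRatio, Finset.prod_const, Finset.card_range, hpow]
      have := h.weylSol_ne_zero 0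
      field_simp
      ring
    rw [Finset.sum_congr rfl e, ← Finset.sum_div, h0, zero_div]

lemma finite_resonanceFun_zeros (hT : 0 < T) (ha : ∀ n, 0 < a n) (haT : ∀ n, a (n + T) = a n)
    (hbT : ∀ n, b (n + T) = b n) {θ : ℝ → ℝ}
    (hθ : ∀ x ∈ ellipticSet a b T, IsQuasiMomentum a b T x (θ x)) :
    {x ∈ ellipticSet a b T | resonanceFun a b T (x : ℂ) = 0}.Finite := by
  set U : Set ℂ := {z | 0 < z.im} with hU
  set S : Set ℂ := U ∪ (fun x : ℝ => (x : ℂ)) '' ellipticSet a b T with hSdef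
  have hUW : ∀ z ∈ U, IsWeylPoint a b T z := fun z hz =>
    (isWeylPoint_of_im_pos hT ha haT hbT hz).1
  have hS : ∀ z ∈ S, IsWeylPoint a b T z := by
    rintro z (hz | ⟨x, hx, rfl⟩)
    · exact hUW z hz
    · exact (isWeylPoint_of_isQuasiMomentum ha haT (hθ x hx)).1
  have hcont : ContinuousOn (resonanceFun a b T) S := fun z hz =>
    ((hS z hz).differentiableAt_resonanceFun ha).continuousAt.continuousWithinAt
  have hUo : IsOpen U := Complex.isOpen_im_gt 0
  have han : AnalyticOnNhd ℂ (resonanceFun a b T) U := DifferentiableOn.analyticOnNhd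
    (fun z hz => ((hUW z hz).differentiableAt_resonanceFun ha).differentiableWithinAt) hUo
  have hconn : IsPreconnected U := (convex_halfSpace_im_gt 0).isPreconnected
  obtain ⟨z₀, hz₀, hne⟩ := exists_resonanceFun_ne_zero (b := b) hT ha haT hbT
  have hUd : U ⊆ closure {z ∈ S | resonanceFun a b T z ≠ 0} := by
    intro z hz
    rcases (han z hz).eventually_eq_zero_or_eventually_ne_zero with h | h
    · exact absurd (han.eqOn_zero_of_preconnected_of_eventuallyEq_zero hconn hz h hz₀) hne
    · have h1 : ∀ᶠ w in 𝓝[≠] z, w ∈ {z ∈ S | resonanceFun a b T z ≠ 0} := by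
        filter_upwards [h, mem_nhdsWithin_of_mem_nhds (hUo.mem_nhds hz)] with w hw hwU
        exact ⟨Or.inl hwU, hw⟩
      exact mem_closure_iff_frequently.2 (h1.frequently.filter_mono nhdsWithin_le_nhds)
  have hd : ∀ s ∈ S, s ∈ closure {z ∈ S | resonanceFun a b T z ≠ 0} := by
    intro s hs
    refine closure_minimal hUd isClosed_closure ?_
    rw [hU, Complex.closure_setOfPred_lt_im]
    rcases hs with hs | ⟨x, -, rfl⟩
    · exact (show 0 < s.im from hs).le
    · simp
  have hfin := (isAlgebraicOn_resonanceFun hT ha haT hbT hS).finite_zeros hcont hd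
  refine (hfin.preimage (f := fun x : ℝ => (x : ℂ)) Complex.ofReal_injective.injOn).subset ?_
  rintro x ⟨hx, h0⟩
  exact ⟨Or.inr ⟨x, hx, rfl⟩, h0⟩

end ExceptionalSet

/-! ### Amplitudes and the choice of frequencies -/

section Frequencies

open ComplexConjugate

variable {a b : ℕ → ℝ} {T : ℕ}

lemma ampPlus_eq (ha : ∀ n, 0 < a n) (haT : ∀ n, a (n + T) = a n) {x θ : ℝ}
    (h : IsQuasiMomentum a b T x θ) (ω φ : ℝ) :
    ampPlus a b T x θ ω φ = coeffFactor a b T x θ * ∑ i ∈ Finset.range T,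
      floquetSol a b T x (Complex.exp (Complex.I * θ)) (i + 1) ^ 2 *
        Complex.exp (Complex.I * ((i + 1 : ℕ) * ω + φ)) :=
  sum_coeffE_mul ha haT h fun k => Complex.exp (Complex.I * (k * ω + φ))

lemma ampMinus_eq (ha : ∀ n, 0 < a n) (haT : ∀ n, a (n + T) = a n) {x θ : ℝ}
    (h : IsQuasiMomentum a b T x θ) (ω φ : ℝ) :
    ampMinus a b T x θ ω φ = coeffFactor a b T x θ * ∑ i ∈ Finset.range T,
      floquetSol a b T x (Complex.exp (Complex.I * θ)) (i + 1) ^ 2 *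
        Complex.exp (-(Complex.I * ((i + 1 : ℕ) * ω + φ))) :=
  sum_coeffE_mul ha haT h fun k => Complex.exp (-(Complex.I * (k * ω + φ)))

lemma ampBoth_eq (ha : ∀ n, 0 < a n) (haT : ∀ n, a (n + T) = a n) {x θ : ℝ}
    (h : IsQuasiMomentum a b T x θ) (ω φ : ℝ) :
    ampBoth a b T x θ ω φ = coeffFactor a b T x θ * ∑ i ∈ Finset.range T,
      floquetSol a b T x (Complex.exp (Complex.I * θ)) (i + 1) ^ 2 *
        (Complex.exp (Complex.I * ((i + 1 : ℕ) * ω + φ)) -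
          Complex.exp (-(Complex.I * ((i + 1 : ℕ) * ω + φ)))) :=
  sum_coeffE_mul ha haT h fun k => Complex.exp (Complex.I * (k * ω + φ)) -
    Complex.exp (-(Complex.I * (k * ω + φ)))

lemma IsQuasiMomentum.eq_pi_div_two {x θ ω : ℝ} (h : IsQuasiMomentum a b T x θ)
    (hp : QuantPlus T θ ω) (hm : QuantMinus T θ ω) : θ = Real.pi / 2 := by
  obtain ⟨m, hm⟩ := hm
  obtain ⟨n, hn⟩ := hp
  have hπ := Real.pi_pos
  have e : 2 * θ = Real.pi * ((n - m : ℤ) : ℝ) := by push_cast; linarith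
  have h1 : (0 : ℝ) < ((n - m : ℤ) : ℝ) := by
    by_contra h'; push Not at h'
    nlinarith [h.1]
  have h2 : ((n - m : ℤ) : ℝ) < 2 := by
    by_contra h'; push Not at h'
    nlinarith [h.2.1]
  have h3 : n - m = 1 := by
    have h1' : 0 < n - m := by exact_mod_cast h1
    have h2' : n - m < 2 := by exact_mod_cast h2
    omega
  rw [h3] at e
  push_cast at e
  linarith

lemma quantPlus_of_exp_eq {θ ω : ℝ}
    (h : Complex.exp (-(Complex.I * ω)) ^ T = Complex.exp (Complex.I * θ) ^ 2) :
    QuantPlus T θ ω := by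
  rw [← Complex.exp_nat_mul, ← Complex.exp_nat_mul, Complex.exp_eq_exp_iff_exists_int] at h
  obtain ⟨n, hn⟩ := h
  refine ⟨-n, ?_⟩
  have h1 := congrArg Complex.im hn
  simp at h1
  push_cast
  linarith

/-- The two candidates for `e^{-iω₊}`, namely `g` and its conjugate, according to whether the
boundary value of the Weyl multiplier is `e^{iθ}` or `e^{-iθ}`. -/
lemma exists_frequency (hT : 0 < T) (ha : ∀ n, 0 < a n) (haT : ∀ n, a (n + T) = a n)
    (hbT : ∀ n, b (n + T) = b n) {x θ : ℝ} (h : IsQuasiMomentum a b T x θ) :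
    ∃ ω : ℝ, 0 < ω ∧ ω < 2 * Real.pi ∧ QuantPlus T θ ω ∧
      ((Complex.exp (-(Complex.I * ω)) = weylRoot a b T x ∧
        weylMult a b T x = Complex.exp (Complex.I * θ)) ∨
      (Complex.exp (-(Complex.I * ω)) = conj (weylRoot a b T x) ∧
        weylMult a b T x = conj (Complex.exp (Complex.I * θ)))) := by
  obtain ⟨hW, hμ⟩ := isWeylPoint_of_isQuasiMomentum ha haT h
  rw [← Complex.conj_exp_I_mul_ofReal] at hμ
  have hμ1 : ‖weylMult a b T x‖ = 1 := by
    rcases hμ with hμ | hμ <;> simp [hμ]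
  obtain ⟨w, hw0, hw1, hw⟩ := hW.exists_weylRoot_eq_exp hT ha haT hbT hμ1
  have hpow := hW.weylRoot_pow hT ha haT hbT
  rcases hμ with hμ | hμ
  · refine ⟨w, hw0, hw1, quantPlus_of_exp_eq ?_, Or.inl ⟨hw.symm, hμ⟩⟩
    rw [← hw, hpow, hμ]
  · have hc : Complex.exp (-(Complex.I * ((2 * Real.pi - w : ℝ) : ℂ))) =
        conj (weylRoot a b T x) := by
      rw [hw, ← Complex.conj_exp_I_mul_ofReal w, Complex.conj_conj]
      have : -(Complex.I * ((2 * Real.pi - w : ℝ) : ℂ)) =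
          Complex.I * w - 2 * Real.pi * Complex.I := by push_cast; ring
      rw [this, Complex.exp_sub, Complex.exp_two_pi_mul_I, div_one]
    refine ⟨2 * Real.pi - w, by linarith, by linarith, quantPlus_of_exp_eq ?_, Or.inr ⟨hc, hμ⟩⟩
    rw [hc, ← map_pow, hpow, hμ, map_pow, Complex.conj_conj]

lemma Complex.exp_I_mul_two_pi_sub (ω : ℝ) : Complex.exp (Complex.I * ((2 * Real.pi - ω : ℝ) : ℂ)) =
    Complex.exp (-(Complex.I * ω)) := by
  have : Complex.I * ((2 * Real.pi - ω : ℝ) : ℂ) =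
      -(Complex.I * ω) + 2 * Real.pi * Complex.I := by push_cast; ring
  rw [this, Complex.exp_add, Complex.exp_two_pi_mul_I, mul_one]

lemma QuantPlus.quantMinus {θ ω : ℝ} (h : QuantPlus T θ ω) :
    QuantMinus T θ (2 * Real.pi - ω) := by
  obtain ⟨n, hn⟩ := h
  exact ⟨T - n, by push_cast; linarith⟩

/-- The vanishing of the sum in the amplitude, transported to the values of the Weyl solution and of
the root. -/
lemma resonanceFun_eq_zero {x θ ω : ℝ}
    (hg : (Complex.exp (-(Complex.I * ω)) = weylRoot a b T x ∧
        weylMult a b T x = Complex.exp (Complex.I * θ)) ∨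
      (Complex.exp (-(Complex.I * ω)) = conj (weylRoot a b T x) ∧
        weylMult a b T x = conj (Complex.exp (Complex.I * θ))))
    (h0 : ∑ i ∈ Finset.range T, floquetSol a b T x (Complex.exp (Complex.I * θ)) (i + 1) ^ 2 *
      Complex.exp (Complex.I * ω) ^ (i + 1) = 0) : resonanceFun a b T x = 0 := by
  have h1 : ∑ i ∈ Finset.range T, floquetSol a b T x (Complex.exp (Complex.I * θ)) (i + 1) ^ 2 *
      Complex.exp (-(Complex.I * ω)) ^ (T - (i + 1)) = 0 := by
    have : ∀ i ∈ Finset.range T, floquetSol a b T x (Complex.exp (Complex.I * θ)) (i + 1) ^ 2 *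
        Complex.exp (-(Complex.I * ω)) ^ (T - (i + 1)) =
        Complex.exp (-(Complex.I * ω)) ^ T * (floquetSol a b T x (Complex.exp (Complex.I * θ))
          (i + 1) ^ 2 * Complex.exp (Complex.I * ω) ^ (i + 1)) := by
      intro i hi
      have hT : T = (T - (i + 1)) + (i + 1) := by have := Finset.mem_range.1 hi; omega
      have hinv : Complex.exp (-(Complex.I * ω)) ^ (i + 1) * Complex.exp (Complex.I * ω) ^ (i + 1)
          = 1 := by
        rw [← mul_pow, ← Complex.exp_add, neg_add_cancel, Complex.exp_zero, one_pow]
      conv_rhs => rw [hT, pow_add]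
      rw [← hT]
      linear_combination (-(floquetSol a b T x (Complex.exp (Complex.I * θ)) (i + 1) ^ 2 *
        Complex.exp (-(Complex.I * ω)) ^ (T - (i + 1)))) * hinv
    rw [Finset.sum_congr rfl this, ← Finset.mul_sum, h0, mul_zero]
  rw [resonanceFun]
  refine mul_eq_zero_of_right _ ?_
  rcases hg with ⟨hω, hμ⟩ | ⟨hω, hμ⟩
  · rw [hω] at h1
    simpa only [weylSol, hμ] using h1
  · have h2 := congrArg conj h1
    simp only [map_sum, map_mul, map_pow, map_zero, hω, Complex.conj_conj, conj_floquetSol,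
      Complex.conj_ofReal] at h2
    simpa only [weylSol, hμ] using h2

lemma resonanceFun_eq_zero_of_amp (hT : 0 < T) (ha : ∀ n, 0 < a n) (haT : ∀ n, a (n + T) = a n)
    {x θ ω φ : ℝ} (h : IsQuasiMomentum a b T x θ) (hq : QuantPlus T θ ω)
    (hg : (Complex.exp (-(Complex.I * ω)) = weylRoot a b T x ∧
        weylMult a b T x = Complex.exp (Complex.I * θ)) ∨
      (Complex.exp (-(Complex.I * ω)) = conj (weylRoot a b T x) ∧
        weylMult a b T x = conj (Complex.exp (Complex.I * θ))))
    (h0 : resonanceAmp a b T x θ ω φ = 0 ∨ resonanceAmp a b T x θ (2 * Real.pi - ω) φ = 0) :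
    resonanceFun a b T x = 0 := by
  have hC := coeffFactor_ne_zero hT ha haT h
  have hboth : ∀ ω', QuantPlus T θ ω' → QuantMinus T θ ω' → resonanceFun a b T x = 0 := by
    intro ω' h1 h2
    rw [resonanceFun, h.floquetDisc_eq ha haT, h.eq_pi_div_two h1 h2, Real.cos_pi_div_two]
    simp
  rcases h0 with h0 | h0
  · by_cases hm : QuantMinus T θ ω
    · exact hboth ω hq hm
    rw [resonanceAmp, if_neg (fun h' => hm h'.2), if_pos hq, ampPlus_eq ha haT h] at h0
    refine resonanceFun_eq_zero hg ?_
    have h1 := (mul_eq_zero.1 h0).resolve_left hC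
    simp_rw [mul_add Complex.I, Complex.exp_add, ← mul_assoc, ← Finset.sum_mul] at h1
    rw [← (mul_eq_zero.1 h1).resolve_right (Complex.exp_ne_zero _)]
    refine Finset.sum_congr rfl fun i _ => ?_
    rw [← Complex.exp_nat_mul]
    ring_nf
  · by_cases hp : QuantPlus T θ (2 * Real.pi - ω)
    · exact hboth _ hp hq.quantMinus
    rw [resonanceAmp, if_neg (fun h' => hp h'.1), if_neg hp, ampMinus_eq ha haT h] at h0
    refine resonanceFun_eq_zero hg ?_
    have h1 := (mul_eq_zero.1 h0).resolve_left hC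
    simp_rw [mul_add Complex.I, neg_add, Complex.exp_add, ← mul_assoc, ← Finset.sum_mul] at h1
    rw [← (mul_eq_zero.1 h1).resolve_right (Complex.exp_ne_zero _)]
    refine Finset.sum_congr rfl fun i _ => ?_
    have e : Complex.exp (Complex.I * ω) =
        Complex.exp (-(Complex.I * ((2 * Real.pi - ω : ℝ) : ℂ))) := by
      rw [Complex.exp_neg, Complex.exp_I_mul_two_pi_sub, ← Complex.exp_neg, neg_neg]
    rw [e, ← Complex.exp_nat_mul]
    ring_nf

end Frequencies

/-! ### Asymptotic integration of `X_{n+1} = (1 + S_n / n) X_n` -/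

section AsymptoticIntegration

variable {E : Type*} [NormedAddCommGroup E] [NormedSpace ℝ E] [CompleteSpace E]

open BoundedContinuousFunction in
/-- Bounded solutions of a summation equation with a small kernel. -/
lemma exists_bounded_solution (L : ℕ → ℕ → E →L[ℝ] E) {ρ : ℕ → ℝ} (hρ : Summable ρ)
    (hρ1 : ∑' m, ρ m < 1) (hL : ∀ n m, ‖L n m‖ ≤ ρ m) (e : E) :
    ∃ (w : ℕ → E) (C : ℝ), (∀ n, ‖w n‖ ≤ C) ∧ ∀ n, w n = e + ∑' m, L n m (w m) := by
  have hρ0 : ∀ m, 0 ≤ ρ m := fun m => (norm_nonneg _).trans (hL 0 m)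
  have hb : ∀ (f : ℕ →ᵇ E) n m, ‖L n m (f m)‖ ≤ ρ m * ‖f‖ := fun f n m =>
    ((L n m).le_opNorm _).trans
      (mul_le_mul (hL n m) (f.norm_coe_le_norm m) (norm_nonneg _) (hρ0 m))
  have hs : ∀ (f : ℕ →ᵇ E) n, Summable fun m => L n m (f m) := fun f n =>
    Summable.of_norm_bounded (hρ.mul_right ‖f‖) (hb f n)
  let Φ : (ℕ →ᵇ E) → (ℕ →ᵇ E) := fun f =>
    ofNormedAddCommGroupDiscrete (fun n => e + ∑' m, L n m (f m)) (‖e‖ + (∑' m, ρ m) * ‖f‖)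
      fun n => (norm_add_le _ _).trans (add_le_add_right
        (tsum_of_norm_bounded (hρ.mul_right ‖f‖).hasSum (hb f n) |>.trans_eq
          (tsum_mul_right)) _)
  have hΦ : ContractingWith ⟨∑' m, ρ m, tsum_nonneg hρ0⟩ Φ := by
    refine ⟨by exact_mod_cast hρ1, LipschitzWith.of_dist_le_mul fun f g => ?_⟩
    refine (dist_le (mul_nonneg (tsum_nonneg hρ0) dist_nonneg)).2 fun n => ?_
    have : Φ f n - Φ g n = ∑' m, L n m ((f - g) m) := by
      change (e + ∑' m, L n m (f m)) - (e + ∑' m, L n m (g m)) = _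
      rw [add_sub_add_left_eq_sub, ← (hs f n).tsum_sub (hs g n)]
      simp
    rw [dist_eq_norm, this, dist_eq_norm]
    exact (tsum_of_norm_bounded (hρ.mul_right ‖f - g‖).hasSum (hb (f - g) n)).trans_eq
      tsum_mul_right
  have hfix := hΦ.fixedPoint_isFixedPt
  set w := hΦ.fixedPoint Φ
  refine ⟨w, ‖w‖, w.norm_coe_le_norm, fun n => ?_⟩
  exact (congrArg (fun f : ℕ →ᵇ E => f n) hfix.eq).symm

lemma abs_rpow_sub_one_sub_le (γ : ℝ) {n : ℕ} (hn : 0 < n) (hγ : |γ| ≤ n) :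
    |(((n + 1 : ℕ) : ℝ) / n) ^ γ - 1 - γ / n| ≤ (γ ^ 2 + |γ|) / (n : ℝ) ^ 2 := by
  have hn' : (0 : ℝ) < n := by exact_mod_cast hn
  have hx : (0 : ℝ) < ((n + 1 : ℕ) : ℝ) / n := by positivity
  set l := Real.log (((n + 1 : ℕ) : ℝ) / n) with hl
  have e1 : ((n + 1 : ℕ) : ℝ) / n = 1 + 1 / n := by push_cast; field_simp
  have h1 : l ≤ 1 / n := by
    have := Real.log_le_sub_one_of_pos hx
    rw [← hl, e1] at this; linarith
  have h2 : 1 / n - 1 / (n : ℝ) ^ 2 ≤ l := by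
    have := Real.one_sub_inv_le_log_of_pos hx
    refine le_trans ?_ this
    rw [inv_div, sub_le_iff_le_add, ← sub_nonneg]
    have : 1 - (n : ℝ) / ((n + 1 : ℕ) : ℝ) + 1 / (n : ℝ) ^ 2 - 1 / n = 1 / (n ^ 2 * (n + 1)) := by
      push_cast; field_simp; ring
    rw [this]; positivity
  have h0 : 0 ≤ l := Real.log_nonneg (by rw [e1]; linarith [one_div_pos.2 hn'])
  have h3 : |γ * l| ≤ |γ| / n := by
    rw [abs_mul, abs_of_nonneg h0, div_eq_mul_one_div]
    exact mul_le_mul_of_nonneg_left h1 (abs_nonneg _)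
  have h4 : |γ * l| ≤ 1 := h3.trans ((div_le_one hn').2 hγ)
  have h5 := Real.abs_exp_sub_one_sub_id_le h4
  have h6 : |γ * l - γ / n| ≤ |γ| / (n : ℝ) ^ 2 := by
    have hl' : |l - 1 / n| ≤ 1 / (n : ℝ) ^ 2 :=
      abs_le.2 ⟨by linarith, by have := one_div_pos.2 (pow_pos hn' 2); linarith⟩
    rw [show γ * l - γ / n = γ * (l - 1 / n) by ring, abs_mul, div_eq_mul_one_div |γ|]
    exact mul_le_mul_of_nonneg_left hl' (abs_nonneg _)
  have h7 : (γ * l) ^ 2 ≤ γ ^ 2 / (n : ℝ) ^ 2 := by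
    rw [← sq_abs (γ * l), ← sq_abs γ, ← div_pow]
    exact pow_le_pow_left₀ (abs_nonneg _) h3 2
  rw [Real.rpow_def_of_pos hx, ← hl, mul_comm l γ, add_div]
  calc |Real.exp (γ * l) - 1 - γ / n|
      = |(Real.exp (γ * l) - 1 - γ * l) + (γ * l - γ / n)| := by ring_nf
    _ ≤ _ := (abs_add_le _ _).trans (add_le_add (h5.trans h7) h6)

/-- For a summable perturbation of `1 + V / n`, where `V = γ (P - Q)` with complementary projections
`P, Q`, every vector in the range of `Q` is the limit of `n^γ Y_n` for some solution `Y`: the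
rescaled solution is the fixed point of a summation equation whose kernel vanishes below the
diagonal. -/
lemma exists_decaying_solution {P Q : E →L[ℝ] E} (hPP : P * P = P) (hQQ : Q * Q = Q)
    (hPQ : P * Q = 0) (hQP : Q * P = 0) (hadd : P + Q = 1) {γ : ℝ} (hγ : 0 ≤ γ)
    {R : ℕ → E →L[ℝ] E} {C : ℝ} {N₀ : ℕ} (hR : ∀ n, N₀ ≤ n → ‖R n‖ ≤ C / (n : ℝ) ^ 2) {e : E}
    (he : Q e = e) :
    ∃ (Y : ℕ → E) (N : ℕ), (∀ n, N ≤ n →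
      Y (n + 1) = Y n + (n : ℝ)⁻¹ • (γ • (P - Q)) (Y n) + R n (Y n)) ∧
      Tendsto (fun n : ℕ => (n : ℝ) ^ γ • Y n) atTop (𝓝 e) := by
  -- `x n = ((n + 1) / n) ^ γ`; the free evolution is replaced by `x P + x⁻¹ Q`.
  set x : ℕ → ℝ := fun n => (((n + 1 : ℕ) : ℝ) / n) ^ γ with hx
  set R' : ℕ → E →L[ℝ] E := fun n =>
    x n • (1 + (n : ℝ)⁻¹ • (γ • (P - Q)) + R n - (x n • P + (x n)⁻¹ • Q)) with hR'
  obtain ⟨C', N₁, hN₁, hR'b⟩ : ∃ (C' : ℝ) (N₁ : ℕ), 0 < N₁ ∧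
      ∀ n, N₁ ≤ n → ‖R' n‖ ≤ C' / (n : ℝ) ^ 2 := by
    refine ⟨2 ^ γ * ((γ ^ 2 + γ) * ‖P‖ + (γ ^ 2 + γ) * ‖Q‖ + C), max N₀ (⌈γ⌉₊ + 1), by positivity,
      fun n hn => ?_⟩
    have hn1 : N₀ ≤ n := (le_max_left _ _).trans hn
    have hn2 : ⌈γ⌉₊ + 1 ≤ n := (le_max_right _ _).trans hn
    have hn0 : 0 < n := by omega
    have hn' : (0 : ℝ) < n := by exact_mod_cast hn0
    have hγn : |γ| ≤ n := by
      rw [abs_of_nonneg hγ]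
      exact (Nat.le_ceil γ).trans (by exact_mod_cast (by omega : ⌈γ⌉₊ ≤ n))
    have a1 := abs_rpow_sub_one_sub_le γ hn0 hγn
    have a2 := abs_rpow_sub_one_sub_le (-γ) hn0 (by rwa [abs_neg])
    rw [Real.rpow_neg (by positivity), neg_sq, abs_neg] at a2
    rw [abs_of_nonneg hγ] at a1 a2
    have hdec : 1 + (n : ℝ)⁻¹ • (γ • (P - Q)) + R n - (x n • P + (x n)⁻¹ • Q) =
        (-(x n - 1 - γ / n)) • P + (-((x n)⁻¹ - 1 - -γ / n)) • Q + R n := by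
      rw [← hadd]
      module
    have hx2 : |x n| ≤ 2 ^ γ := by
      rw [hx, abs_of_nonneg (by positivity)]
      refine Real.rpow_le_rpow (by positivity) ?_ hγ
      rw [div_le_iff₀ hn']
      have : (1 : ℝ) ≤ n := by exact_mod_cast hn0
      push_cast; linarith
    rw [hR']
    simp only
    rw [hdec, norm_smul, Real.norm_eq_abs, mul_div_assoc]
    refine mul_le_mul hx2 ?_ (norm_nonneg _) (by positivity)
    refine (norm_add₃_le).trans ?_
    rw [norm_smul, norm_smul, Real.norm_eq_abs, Real.norm_eq_abs, abs_neg, abs_neg]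
    have b1 := mul_le_mul_of_nonneg_right a1 (norm_nonneg P)
    have b2 := mul_le_mul_of_nonneg_right a2 (norm_nonneg Q)
    have b3 := hR n hn1
    refine (add_le_add_three b1 b2 b3).trans_eq ?_
    ring
  set K := (‖P‖ + ‖Q‖) * C' with hK
  have hsum : Summable fun m : ℕ => K / (m : ℝ) ^ 2 := by
    simpa [div_eq_mul_inv] using (Real.summable_nat_pow_inv.2 one_lt_two).mul_left K
  obtain ⟨N, hNN, hN⟩ : ∃ N, N₁ ≤ N ∧ ∑' m : ℕ, (if N ≤ m then K / (m : ℝ) ^ 2 else 0) < 1 := by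
    have hlim : Tendsto (fun N => ∑' m : ℕ, (if N ≤ m then K / (m : ℝ) ^ 2 else 0)) atTop
        (𝓝 (∑' _ : ℕ, (0 : ℝ))) := by
      refine tendsto_tsum_of_dominated_convergence hsum.norm (fun m => ?_) ?_
      · refine tendsto_const_nhds.congr' ?_
        filter_upwards [eventually_gt_atTop m] with N hN
        rw [if_neg (by omega)]
      · refine Eventually.of_forall fun N m => ?_
        split_ifs
        · exact le_rfl
        · rw [norm_zero]
          exact norm_nonneg _
    rw [tsum_zero] at hlim
    obtain ⟨N, h1, h2⟩ := ((eventually_ge_atTop N₁).and (hlim.eventually_lt_const one_pos)).exists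
    exact ⟨N, h1, h2⟩
  set ρ : ℕ → ℝ := fun m => if N ≤ m then K / (m : ℝ) ^ 2 else 0 with hρ
  have hK0 : ∀ m, N ≤ m → 0 ≤ K / (m : ℝ) ^ 2 := fun m hm => by
    rw [hK, mul_div_assoc]
    exact mul_nonneg (by positivity) ((norm_nonneg _).trans (hR'b m (hNN.trans hm)))
  have hρs : Summable ρ := by
    refine Summable.of_norm_bounded hsum.norm fun m => ?_
    rw [hρ]
    dsimp only
    split_ifs
    · exact le_rfl
    · rw [norm_zero]
      exact norm_nonneg _
  let G : ℕ → ℕ → E →L[ℝ] E := fun n m => ((n : ℝ) / (m + 1 : ℕ)) ^ (2 * γ) • P + Q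
  let L : ℕ → ℕ → E →L[ℝ] E := fun n m => if N ≤ m ∧ n ≤ m then -(G n m * R' m) else 0
  have hL : ∀ n m, ‖L n m‖ ≤ ρ m := by
    intro n m
    by_cases h : N ≤ m ∧ n ≤ m
    · simp only [L, hρ, if_pos h, if_pos h.1, norm_neg]
      have hG : ‖G n m‖ ≤ ‖P‖ + ‖Q‖ := by
        refine (norm_add_le _ _).trans (add_le_add_left ?_ _)
        rw [norm_smul, Real.norm_of_nonneg (by positivity)]
        refine mul_le_of_le_one_left (norm_nonneg _) (Real.rpow_le_one (by positivity) ?_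
          (by positivity))
        exact (div_le_one (by positivity)).2 (by exact_mod_cast (by omega : n ≤ m + 1))
      refine (norm_mul_le _ _).trans ?_
      rw [hK, mul_div_assoc]
      exact mul_le_mul hG (hR'b m (hNN.trans h.1)) (norm_nonneg _) (by positivity)
    · simp only [L, hρ, if_neg h, norm_zero]
      split_ifs with h1
      · exact hK0 m h1
      · exact le_rfl
  obtain ⟨w, B, hB, hw⟩ := exists_bounded_solution L hρs hN hL e
  have hLw : ∀ n m, ‖L n m (w m)‖ ≤ ρ m * B := fun n m =>
    ((L n m).le_opNorm _).trans
      (mul_le_mul (hL n m) (hB m) (norm_nonneg _) ((norm_nonneg _).trans (hL n m)))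
  have hLs : ∀ n, Summable fun m => L n m (w m) := fun n =>
    Summable.of_norm_bounded (hρs.mul_right B) (hLw n)
  have hlim : Tendsto w atTop (𝓝 e) := by
    have h1 : Tendsto (fun n => ∑' m, L n m (w m)) atTop (𝓝 (∑' _ : ℕ, (0 : E))) := by
      refine tendsto_tsum_of_dominated_convergence (hρs.mul_right B) (fun m => ?_)
        (Eventually.of_forall fun n m => hLw n m)
      refine tendsto_const_nhds.congr' ?_
      filter_upwards [eventually_gt_atTop m] with n hn
      simp only [L]
      rw [if_neg (by omega)]
      rfl
    rw [tsum_zero] at h1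
    simpa [← hw] using h1.const_add e
  have hPe : P e = 0 := by
    rw [← he]; exact congrArg (fun A : E →L[ℝ] E => A e) hPQ
  have hxpos : ∀ n, 0 < n → 0 < x n := fun n hn => by
    have : (0 : ℝ) < n := by exact_mod_cast hn
    simp only [hx]; positivity
  have hrec : ∀ n, N ≤ n → w (n + 1) = (x n ^ 2 • P + Q) (w n) + R' n (w n) := by
    intro n hn
    have hn0 : 0 < n := by omega
    have hn' : (0 : ℝ) < n := by exact_mod_cast hn0
    have hx2 : x n ^ 2 = (((n + 1 : ℕ) : ℝ) / n) ^ (2 * γ) := by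
      rw [hx, mul_comm, Real.rpow_mul (by positivity), Real.rpow_two]
    have hG : ∀ m, (x n ^ 2 • P + Q) * G n m = G (n + 1) m := by
      intro m
      have : x n ^ 2 * ((n : ℝ) / (m + 1 : ℕ)) ^ (2 * γ) =
          (((n + 1 : ℕ) : ℝ) / (m + 1 : ℕ)) ^ (2 * γ) := by
        rw [hx2, ← Real.mul_rpow (by positivity) (by positivity)]
        congr 1
        field_simp
      simp only [G]
      rw [← this, add_mul, mul_add, mul_add, smul_mul_smul_comm, hPP, smul_mul_assoc, hPQ,
        mul_smul_comm, hQP, hQQ]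
      simp
    have hGn : G (n + 1) n = 1 := by
      simp only [G]
      rw [div_self (by positivity), Real.one_rpow, one_smul, hadd]
    have hAL : ∀ m, (x n ^ 2 • P + Q) (L n m (w m)) =
        L (n + 1) m (w m) + if m = n then -R' n (w n) else 0 := by
      intro m
      rcases lt_trichotomy m n with h | h | h
      · simp only [L]
        rw [if_neg (by omega), if_neg (by omega), if_neg (by omega)]
        simp
      · subst h
        simp only [L]
        rw [if_pos ⟨hn, le_rfl⟩, if_neg (by omega)]
        have h' : (x m ^ 2 • P + Q) * -(G m m * R' m) = -R' m := by
          rw [mul_neg, ← mul_assoc, hG, hGn, one_mul]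
        change ((x m ^ 2 • P + Q) * -(G m m * R' m)) (w m) = _
        rw [h']
        simp
      · simp only [L]
        rw [if_pos ⟨by omega, by omega⟩, if_pos ⟨by omega, by omega⟩, if_neg (by omega), add_zero]
        have h' : (x n ^ 2 • P + Q) * -(G n m * R' m) = -(G (n + 1) m * R' m) := by
          rw [mul_neg, ← mul_assoc, hG]
        exact congrArg (fun A : E →L[ℝ] E => A (w m)) h'
    have hAe : (x n ^ 2 • P + Q) e = e := by simp [hPe, he]
    have h1 : (x n ^ 2 • P + Q) (w n) = w (n + 1) - R' n (w n) := by
      conv_lhs => rw [hw n]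
      rw [map_add, hAe, ContinuousLinearMap.map_tsum _ (hLs n), tsum_congr hAL,
        (hLs (n + 1)).tsum_add (hasSum_ite_eq n _).summable, tsum_ite_eq]
      conv_rhs => rw [hw (n + 1)]
      abel
    rw [h1, sub_add_cancel]
  refine ⟨fun n => (n : ℝ) ^ (-γ) • w n, N, fun n hn => ?_, ?_⟩
  · have hn0 : 0 < n := by omega
    have hn' : (0 : ℝ) < n := by exact_mod_cast hn0
    have hx0 := (hxpos n hn0).ne'
    have hxn : ((n + 1 : ℕ) : ℝ) ^ (-γ) = (n : ℝ) ^ (-γ) * (x n)⁻¹ := by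
      rw [hx, ← Real.rpow_neg (by positivity), Real.div_rpow (by positivity) (by positivity),
        mul_div_cancel₀ _ (by positivity)]
    have hw' : w (n + 1) =
        x n • (w n + (n : ℝ)⁻¹ • (γ • (P - Q)) (w n) + R n (w n)) := by
      rw [hrec n hn, hR']
      simp only [add_apply, smul_apply, sub_apply, one_apply_eq_self, smul_add, smul_sub, smul_smul,
        mul_inv_cancel₀ hx0, sq]
      module
    simp only
    rw [hxn, hw', smul_smul, mul_assoc, inv_mul_cancel₀ hx0, mul_one, map_smul, map_smul]
    module
  · refine hlim.congr' ?_
    filter_upwards [eventually_gt_atTop 0] with n hn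
    have hn' : (0 : ℝ) < n := by exact_mod_cast hn
    rw [smul_smul, ← Real.rpow_add hn', add_neg_cancel, Real.rpow_zero, one_smul]

/-- A perturbation `S_n / n` whose mean is `V`, in the sense that the partial sums of `S_n - V` are
bounded, can be replaced by `V / n` up to a summable error, by the substitution
`X_n = (1 + F_n / n) Y_n`, where `F_n` are these partial sums. -/
lemma exists_decaying_solution_of_mean {V : E →L[ℝ] E} {γ : ℝ} (hγ : 0 < γ)
    (hV : V * V = γ ^ 2 • (1 : E →L[ℝ] E)) {S : ℕ → E →L[ℝ] E} {K K' : ℝ} (hS : ∀ n, ‖S n‖ ≤ K)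
    (hF : ∀ n, ‖∑ m ∈ Finset.range n, (S m - V)‖ ≤ K') {e : E} (he : V e = -γ • e) :
    ∃ (X : ℕ → E) (N : ℕ), (∀ n, N ≤ n → X (n + 1) = X n + (n : ℝ)⁻¹ • S n (X n)) ∧
      Tendsto (fun n : ℕ => (n : ℝ) ^ γ • X n) atTop (𝓝 e) := by
  set F : ℕ → E →L[ℝ] E := fun n => ∑ m ∈ Finset.range n, (S m - V) with hFdef
  set G : ℕ → E →L[ℝ] E := fun n => (n : ℝ)⁻¹ • F n with hG
  have hG0 : Tendsto G atTop (𝓝 0) := by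
    refine squeeze_zero_norm (a := fun n : ℕ => (n : ℝ)⁻¹ * K') (fun n => ?_)
      (by simpa using tendsto_inv_atTop_nhds_zero_nat.mul_const K')
    rw [hG, norm_smul, norm_inv, Real.norm_natCast]
    exact mul_le_mul_of_nonneg_left (hF n) (by positivity)
  have hGn : Tendsto (fun n => -G (n + 1)) atTop (𝓝 0) := by
    simpa using (hG0.comp (tendsto_add_atTop_nat 1)).neg
  obtain ⟨c, hc⟩ := ((NormedRing.inverse_one_sub_norm (R := E →L[ℝ] E)).comp_tendsto hGn).bound
  have hunit : ∀ᶠ n in atTop, ‖-G (n + 1)‖ < 1 := by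
    simpa using hGn.norm.eventually_lt_const (by simp)
  set R : ℕ → E →L[ℝ] E := fun n => Ring.inverse (1 - -G (n + 1)) *
    ((1 + (n : ℝ)⁻¹ • S n) * (1 + G n) - (1 + G (n + 1)) * (1 + (n : ℝ)⁻¹ • V)) with hR
  obtain ⟨N₀, hN₀⟩ := eventually_atTop.1 (hc.and (hunit.and (eventually_gt_atTop 0)))
  have hRb : ∀ n, N₀ ≤ n → ‖R n‖ ≤ c * (K' + K * K' + K' * ‖V‖) / (n : ℝ) ^ 2 := by
    intro n hn
    obtain ⟨h1, -, hn0⟩ := hN₀ n hn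
    have hn' : (0 : ℝ) < n := by exact_mod_cast hn0
    simp only [Function.comp_apply, norm_one, mul_one] at h1
    have hFs : F (n + 1) = F n + (S n - V) := Finset.sum_range_succ _ _
    have e1 : (1 + (n : ℝ)⁻¹ • S n) * (1 + G n) - (1 + G (n + 1)) * (1 + (n : ℝ)⁻¹ • V) =
        ((n : ℝ)⁻¹ * ((n + 1 : ℕ) : ℝ)⁻¹) • F (n + 1) + ((n : ℝ)⁻¹ * (n : ℝ)⁻¹) • (S n * F n)
          + (-((n : ℝ)⁻¹ * ((n + 1 : ℕ) : ℝ)⁻¹)) • (F (n + 1) * V) := by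
      have e2 : (n : ℝ)⁻¹ • S n + G n - G (n + 1) - (n : ℝ)⁻¹ • V =
          ((n : ℝ)⁻¹ * ((n + 1 : ℕ) : ℝ)⁻¹) • F (n + 1) := by
        have e3 : F n = F (n + 1) - (S n - V) := by rw [hFs]; abel
        have e4 : (n : ℝ)⁻¹ * ((n + 1 : ℕ) : ℝ)⁻¹ = (n : ℝ)⁻¹ - ((n + 1 : ℕ) : ℝ)⁻¹ := by
          push_cast; field_simp; ring
        simp only [hG]
        rw [e3, e4]
        generalize ((n + 1 : ℕ) : ℝ)⁻¹ = y
        module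
      have e5 : (1 + (n : ℝ)⁻¹ • S n) * (1 + G n) - (1 + G (n + 1)) * (1 + (n : ℝ)⁻¹ • V) =
          ((n : ℝ)⁻¹ • S n + G n - G (n + 1) - (n : ℝ)⁻¹ • V) + (n : ℝ)⁻¹ • S n * G n
            - G (n + 1) * (n : ℝ)⁻¹ • V := by
        simp only [add_mul, mul_add, one_mul, mul_one]
        abel
      rw [e5, e2]
      simp only [hG, smul_mul_smul_comm, neg_smul]
      rw [mul_comm (((n + 1 : ℕ) : ℝ)⁻¹) ((n : ℝ)⁻¹)]
      abel
    have hle : (n : ℝ)⁻¹ * ((n + 1 : ℕ) : ℝ)⁻¹ ≤ (n : ℝ)⁻¹ * (n : ℝ)⁻¹ :=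
      mul_le_mul_of_nonneg_left (inv_anti₀ hn' (by push_cast; linarith)) (by positivity)
    have hnn : (0 : ℝ) ≤ (n : ℝ)⁻¹ * ((n + 1 : ℕ) : ℝ)⁻¹ := by positivity
    have hK0 : 0 ≤ K' := (norm_nonneg _).trans (hF 0)
    have hK : 0 ≤ K := (norm_nonneg _).trans (hS 0)
    have e6 : ‖(1 + (n : ℝ)⁻¹ • S n) * (1 + G n) - (1 + G (n + 1)) * (1 + (n : ℝ)⁻¹ • V)‖ ≤
        ((n : ℝ)⁻¹ * (n : ℝ)⁻¹) * (K' + K * K' + K' * ‖V‖) := by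
      rw [e1, mul_add, mul_add]
      refine norm_add₃_le.trans (add_le_add_three ?_ ?_ ?_)
      · rw [norm_smul, Real.norm_of_nonneg hnn]
        exact mul_le_mul hle (hF _) (norm_nonneg _) (by positivity)
      · rw [norm_smul, Real.norm_of_nonneg (by positivity)]
        exact mul_le_mul_of_nonneg_left ((norm_mul_le _ _).trans
          (mul_le_mul (hS n) (hF n) (norm_nonneg _) hK)) (by positivity)
      · rw [norm_smul, norm_neg, Real.norm_of_nonneg hnn]
        exact mul_le_mul hle ((norm_mul_le _ _).trans
          (mul_le_mul_of_nonneg_right (hF _) (norm_nonneg _))) (norm_nonneg _) (by positivity)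
    have hc0 : 0 ≤ c := (norm_nonneg _).trans h1
    refine (norm_mul_le _ _).trans ((mul_le_mul h1 e6 (norm_nonneg _) hc0).trans_eq ?_)
    field_simp
  -- The spectral projections of `V`.
  set P : E →L[ℝ] E := (1 / 2 : ℝ) • (1 + γ⁻¹ • V) with hP
  set Q : E →L[ℝ] E := (1 / 2 : ℝ) • (1 - γ⁻¹ • V) with hQ
  have hVV : (γ⁻¹ • V) * (γ⁻¹ • V) = 1 := by
    rw [smul_mul_smul_comm, hV, smul_smul, show γ⁻¹ * γ⁻¹ * γ ^ 2 = 1 by field_simp, one_smul]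
  have hPQV : V = γ • (P - Q) := by
    have : P - Q = γ⁻¹ • V := by rw [hP, hQ]; module
    rw [this, smul_inv_smul₀ hγ.ne']
  have hPP : P * P = P := by
    have : (1 + γ⁻¹ • V) * (1 + γ⁻¹ • V) = (2 : ℝ) • (1 + γ⁻¹ • V) := by
      rw [add_mul, mul_add, mul_add, hVV, one_mul, one_mul, mul_one]; module
    rw [hP, smul_mul_smul_comm, this]; module
  have hQQ : Q * Q = Q := by
    have : (1 - γ⁻¹ • V) * (1 - γ⁻¹ • V) = (2 : ℝ) • (1 - γ⁻¹ • V) := by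
      rw [sub_mul, mul_sub, mul_sub, hVV, one_mul, one_mul, mul_one]; module
    rw [hQ, smul_mul_smul_comm, this]; module
  have hPQ : P * Q = 0 := by
    have : (1 + γ⁻¹ • V) * (1 - γ⁻¹ • V) = 0 := by
      rw [add_mul, mul_sub, mul_sub, hVV, one_mul, one_mul, mul_one]; module
    rw [hP, hQ, smul_mul_smul_comm, this, smul_zero]
  have hQP : Q * P = 0 := by
    have : (1 - γ⁻¹ • V) * (1 + γ⁻¹ • V) = 0 := by
      rw [sub_mul, mul_add, mul_add, hVV, one_mul, one_mul, mul_one]; module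
    rw [hP, hQ, smul_mul_smul_comm, this, smul_zero]
  have hadd : P + Q = 1 := by rw [hP, hQ]; module
  have hQe : Q e = e := by
    rw [hQ]
    simp only [smul_apply, sub_apply, one_apply_eq_self, he, smul_smul]
    rw [show γ⁻¹ * -γ = -1 by field_simp]
    module
  obtain ⟨Y, N, hY, hlim⟩ := exists_decaying_solution hPP hQQ hPQ hQP hadd hγ.le hRb hQe
  rw [← hPQV] at hY
  refine ⟨fun n => Y n + G n (Y n), max N N₀, fun n hn => ?_, ?_⟩
  · obtain ⟨-, h1, -⟩ := hN₀ n ((le_max_right _ _).trans hn)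
    have hinv : (1 + G (n + 1)) * R n =
        (1 + (n : ℝ)⁻¹ • S n) * (1 + G n) - (1 + G (n + 1)) * (1 + (n : ℝ)⁻¹ • V) := by
      have : (1 - -G (n + 1)) * Ring.inverse (1 - -G (n + 1)) = 1 :=
        Ring.mul_inverse_cancel _ (isUnit_one_sub_of_norm_lt_one h1)
      rw [hR]
      simp only
      rw [← mul_assoc, ← sub_neg_eq_add 1 (G (n + 1)), this, one_mul]
    have h2 := hY n ((le_max_left _ _).trans hn)
    have h3 : Y (n + 1) = (1 + (n : ℝ)⁻¹ • V + R n) (Y n) := by rw [h2]; simp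
    have h4 : (1 + G (n + 1)) * (1 + (n : ℝ)⁻¹ • V + R n) =
        (1 + (n : ℝ)⁻¹ • S n) * (1 + G n) := by rw [mul_add, hinv]; abel
    have h5 : Y (n + 1) + G (n + 1) (Y (n + 1)) =
        ((1 + G (n + 1)) * (1 + (n : ℝ)⁻¹ • V + R n)) (Y n) := by
      rw [h3]; simp
    simp only
    rw [h5, h4]
    simp
  · have h1 : Tendsto (fun n : ℕ => G n ((n : ℝ) ^ γ • Y n)) atTop (𝓝 ((0 : E →L[ℝ] E) e)) :=
      (isBoundedBilinearMap_apply.continuous.tendsto ((0 : E →L[ℝ] E), e)).comp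
        (hG0.prodMk_nhds hlim)
    simpa using hlim.add h1

end AsymptoticIntegration

/-! ### Means of quasi-periodic sequences -/

section QuasiPeriodic

variable {T : ℕ}

lemma exists_bound_sum_quasiPeriodic (hT : 0 < T) {f : ℕ → ℂ} {ζ : ℂ} (hζ : ‖ζ‖ = 1)
    (hf : ∀ n, f (n + T) = ζ * f n) :
    ∃ C, ∀ n, ‖∑ m ∈ Finset.range n,
      (f m - if ζ = 1 then (∑ i ∈ Finset.range T, f (i + 1)) / T else 0)‖ ≤ C := by
  have hT' : (T : ℂ) ≠ 0 := by exact_mod_cast hT.ne'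
  set β : ℂ := if ζ = 1 then (∑ i ∈ Finset.range T, f (i + 1)) / T else 0 with hβ
  set s : ℕ → ℂ := fun n => ∑ m ∈ Finset.range n, (f m - β) with hs
  have hbdd : ∀ {t : ℕ → ℂ}, (∀ n, ‖t (n + T)‖ = ‖t n‖) → ∃ C, ∀ n, ‖t n‖ ≤ C := by
    intro t ht
    obtain ⟨C, hC⟩ := exists_bound_of_periodic (f := fun n => ‖t n‖) hT ht
    exact ⟨C, fun n => (le_abs_self _).trans (hC n)⟩
  have hrec : ∀ n, s (n + T) = s T + ∑ m ∈ Finset.range n, (ζ * f m - β) := by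
    intro n
    rw [hs]
    simp only
    rw [add_comm n T, Finset.sum_range_add]
    congr 1
    exact Finset.sum_congr rfl fun m _ => by rw [add_comm T m, hf]
  by_cases h1 : ζ = 1
  · have hsT : s T = 0 := by
      have : ∑ i ∈ Finset.range T, f i = ∑ i ∈ Finset.range T, f (i + 1) := by
        have e1 := Finset.sum_range_succ f T
        have e2 := Finset.sum_range_succ' f T
        have e3 := hf 0
        rw [zero_add, h1, one_mul] at e3
        rw [e1, e3] at e2
        exact add_right_cancel e2
      rw [hs]
      simp only
      rw [Finset.sum_sub_distrib, Finset.sum_const, Finset.card_range, this, hβ, if_pos h1,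
        nsmul_eq_mul, mul_div_cancel₀ _ hT', sub_self]
    exact hbdd (t := s) fun n => by rw [hrec n, hsT, zero_add, h1]; simp only [one_mul, hs]
  · have hβ0 : β = 0 := if_neg h1
    have h2 : 1 - ζ ≠ 0 := sub_ne_zero.2 (Ne.symm h1)
    obtain ⟨C, hC⟩ := hbdd (t := fun n => s n - s T / (1 - ζ)) fun n => by
      have : s (n + T) - s T / (1 - ζ) = ζ * (s n - s T / (1 - ζ)) := by
        have e : ∑ m ∈ Finset.range n, (ζ * f m - β) = ζ * s n := by
          simp only [hs, hβ0, sub_zero, Finset.mul_sum]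
        rw [hrec, e]
        field_simp
        ring
      rw [this, norm_mul, hζ, one_mul]
    refine ⟨C + ‖s T / (1 - ζ)‖, fun n => ?_⟩
    have h3 := norm_add_le (s n - s T / (1 - ζ)) (s T / (1 - ζ))
    rw [sub_add_cancel] at h3
    exact h3.trans (add_le_add_left (hC n) _)

/-- The mean of `h_n sin(n ω + φ)` for a sequence with `h_{n+T} = η h_n`, `|η| = 1`: only those of
the two exponentials in the sine contribute that are resonant with `η`. -/
noncomputable def sinMean (h : ℕ → ℂ) (η : ℂ) (T : ℕ) (ω φ : ℝ) : ℂ :=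
  ((if η * Complex.exp (Complex.I * (T * ω)) = 1 then ∑ i ∈ Finset.range T,
      h (i + 1) * Complex.exp (Complex.I * ((i + 1 : ℕ) * ω + φ)) else 0) -
    (if η * Complex.exp (-(Complex.I * (T * ω))) = 1 then ∑ i ∈ Finset.range T,
      h (i + 1) * Complex.exp (-(Complex.I * ((i + 1 : ℕ) * ω + φ))) else 0)) /
    (2 * Complex.I * T)

lemma exists_bound_sum_sub_sinMean (hT : 0 < T) {h : ℕ → ℂ} {η : ℂ} (hη : ‖η‖ = 1)
    (hh : ∀ n, h (n + T) = η * h n) (ω φ : ℝ) :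
    ∃ C, ∀ n, ‖∑ m ∈ Finset.range n,
      (h m * (Real.sin (m * ω + φ) : ℂ) - sinMean h η T ω φ)‖ ≤ C := by
  have hT' : (T : ℂ) ≠ 0 := by exact_mod_cast hT.ne'
  have hn1 : ‖Complex.exp (Complex.I * (T * ω))‖ = 1 := by
    have := Complex.norm_exp_I_mul_ofReal (T * ω)
    rwa [Complex.ofReal_mul, Complex.ofReal_natCast] at this
  have hn2 : ‖Complex.exp (-(Complex.I * (T * ω)))‖ = 1 := by
    rw [Complex.exp_neg, norm_inv, hn1, inv_one]
  obtain ⟨C₁, h₁⟩ := exists_bound_sum_quasiPeriodic hT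
    (f := fun n => h n * Complex.exp (Complex.I * (n * ω + φ)))
    (ζ := η * Complex.exp (Complex.I * (T * ω))) (by rw [norm_mul, hη, hn1, one_mul]) fun n => by
      rw [hh, show Complex.I * (((n + T : ℕ) : ℂ) * ω + φ) =
        Complex.I * (T * ω) + Complex.I * (n * ω + φ) by push_cast; ring, Complex.exp_add]
      ring
  obtain ⟨C₂, h₂⟩ := exists_bound_sum_quasiPeriodic hT
    (f := fun n => h n * Complex.exp (-(Complex.I * (n * ω + φ))))
    (ζ := η * Complex.exp (-(Complex.I * (T * ω)))) (by rw [norm_mul, hη, hn2, one_mul])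
    fun n => by
      rw [hh, show -(Complex.I * (((n + T : ℕ) : ℂ) * ω + φ)) =
        -(Complex.I * (T * ω)) + -(Complex.I * (n * ω + φ)) by push_cast; ring, Complex.exp_add]
      ring
  refine ⟨(C₁ + C₂) / 2, fun n => ?_⟩
  set m₁ := if η * Complex.exp (Complex.I * (T * ω)) = 1 then (∑ i ∈ Finset.range T,
    h (i + 1) * Complex.exp (Complex.I * (((i + 1 : ℕ) : ℂ) * ω + φ))) / T else 0 with hm₁
  set m₂ := if η * Complex.exp (-(Complex.I * (T * ω))) = 1 then (∑ i ∈ Finset.range T,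
    h (i + 1) * Complex.exp (-(Complex.I * (((i + 1 : ℕ) : ℂ) * ω + φ)))) / T else 0 with hm₂
  have hmean : sinMean h η T ω φ = (m₁ - m₂) / (2 * Complex.I) := by
    rw [sinMean, hm₁, hm₂]
    have : ∀ (p : Prop) [Decidable p] (z : ℂ), (if p then z / T else 0) = (if p then z else 0) / T := by
      intro p _ z; split_ifs <;> simp
    rw [this, this]
    field_simp
  have hterm : ∀ m : ℕ, h m * (Real.sin (m * ω + φ) : ℂ) - sinMean h η T ω φ =
      ((h m * Complex.exp (Complex.I * (m * ω + φ)) - m₁) -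
        (h m * Complex.exp (-(Complex.I * (m * ω + φ))) - m₂)) / (2 * Complex.I) := by
    intro m
    rw [hmean, Complex.ofReal_sin, Complex.sin]
    push_cast
    rw [mul_comm Complex.I, neg_mul]
    field_simp
    linear_combination (h m * Complex.exp (-((m * ω + φ) * Complex.I)) -
      h m * Complex.exp ((m * ω + φ) * Complex.I)) * Complex.I_sq
  rw [Finset.sum_congr rfl fun m _ => hterm m, ← Finset.sum_div, Finset.sum_sub_distrib, norm_div]
  have : ‖(2 * Complex.I : ℂ)‖ = 2 := by simp
  rw [this]
  exact div_le_div_of_nonneg_right ((norm_sub_le _ _).trans (add_le_add (h₁ n) (h₂ n))) two_pos.le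

end QuasiPeriodic

section ResonantMean

open ComplexConjugate

variable {a b : ℕ → ℝ} {T : ℕ}

lemma sq_exp_mul_exp_eq_one_iff_quantPlus (T : ℕ) (θ ω : ℝ) :
    Complex.exp (Complex.I * θ) ^ 2 * Complex.exp (Complex.I * (T * ω)) = 1 ↔
      QuantPlus T θ ω := by
  rw [← Complex.exp_nat_mul, ← Complex.exp_add, Complex.exp_eq_one_iff, QuantPlus]
  refine exists_congr fun n => ⟨fun h => ?_, fun h => ?_⟩
  · have := congrArg Complex.im h
    simp at this
    linarith
  · have h' : (ω : ℂ) * T + 2 * θ = 2 * Real.pi * n := by exact_mod_cast h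
    push_cast
    linear_combination Complex.I * h'

lemma sq_exp_mul_exp_eq_one_iff_quantMinus (T : ℕ) (θ ω : ℝ) :
    Complex.exp (Complex.I * θ) ^ 2 * Complex.exp (-(Complex.I * (T * ω))) = 1 ↔
      QuantMinus T θ ω := by
  rw [← Complex.exp_nat_mul, ← Complex.exp_add, Complex.exp_eq_one_iff, QuantMinus]
  constructor
  · rintro ⟨n, h⟩
    refine ⟨-n, ?_⟩
    have := congrArg Complex.im h
    simp at this
    push_cast
    linarith
  · rintro ⟨n, h⟩
    refine ⟨-n, ?_⟩
    have h' : (ω : ℂ) * T - 2 * θ = 2 * Real.pi * n := by exact_mod_cast h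
    push_cast
    linear_combination -Complex.I * h'

/-- The resonance amplitude is, up to normalisation, the mean of `ψ_n² sin(n ω + φ)`. -/
lemma norm_resonanceAmp (hT : 0 < T) (ha : ∀ n, 0 < a n) (haT : ∀ n, a (n + T) = a n) {x θ ω φ : ℝ}
    (h : IsQuasiMomentum a b T x θ) (hq : QuantPlus T θ ω ∨ QuantMinus T θ ω) :
    ‖resonanceAmp a b T x θ ω φ‖ =
      ‖sinMean (fun n => floquetSol a b T x (Complex.exp (Complex.I * θ)) n ^ 2)
        (Complex.exp (Complex.I * θ) ^ 2) T ω φ‖ / (2 * a 0 * ‖monodromy a b T x 0 1‖) := by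
  have hT' : (0 : ℝ) < T := by exact_mod_cast hT
  have hp := norm_pos_iff.2 (h.monodromy_ne_zero ha haT)
  have ha0 := ha 0
  have key : ∀ y z : ℂ, ‖y‖ = ‖z‖ → ‖coeffFactor a b T x θ * y‖ =
      ‖z / (2 * Complex.I * T)‖ / (2 * a 0 * ‖monodromy a b T x 0 1‖) := by
    intro y z hyz
    rw [norm_mul, coeffFactor_norm ha h, norm_div, hyz]
    have : ‖(2 * Complex.I * T : ℂ)‖ = 2 * T := by simp
    rw [this]
    field_simp
    ring
  have hP := sq_exp_mul_exp_eq_one_iff_quantPlus T θ ω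
  have hM := sq_exp_mul_exp_eq_one_iff_quantMinus T θ ω
  rw [resonanceAmp, sinMean]
  by_cases h1 : QuantPlus T θ ω
  · by_cases h2 : QuantMinus T θ ω
    · rw [if_pos ⟨h1, h2⟩, if_pos (hP.2 h1), if_pos (hM.2 h2), ampBoth_eq ha haT h]
      refine key _ _ ?_
      rw [← Finset.sum_sub_distrib]
      simp only [mul_sub]
    · rw [if_neg (fun h' => h2 h'.2), if_pos h1, if_pos (hP.2 h1), if_neg (fun h' => h2 (hM.1 h')),
        ampPlus_eq ha haT h]
      exact key _ _ (by rw [sub_zero])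
  · have h2 := hq.resolve_left h1
    rw [if_neg (fun h' => h1 h'.1), if_neg h1, if_neg (fun h' => h1 (hP.1 h')), if_pos (hM.2 h2),
      ampMinus_eq ha haT h]
    exact key _ _ (by rw [zero_sub, norm_neg])

/-- Under a quantisation condition `ω T` is `∓ 2θ` modulo `2π`, which is not a multiple of `2π`. -/
lemma sinMean_eq_zero {x θ ω : ℝ} (h : IsQuasiMomentum a b T x θ)
    (hq : QuantPlus T θ ω ∨ QuantMinus T θ ω) (f : ℕ → ℂ) (φ : ℝ) : sinMean f 1 T ω φ = 0 := by
  have hne : Complex.exp (Complex.I * θ) ^ 2 ≠ 1 := by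
    intro h1
    have h2 := congrArg Complex.re h1
    have h3 := Real.sin_sq_add_cos_sq θ
    rw [sq, Complex.mul_re, Complex.exp_I_mul_ofReal_re, Complex.exp_I_mul_ofReal_im,
      Complex.one_re] at h2
    nlinarith [pow_pos h.sin_pos 2]
  have hinv : Complex.exp (Complex.I * (T * ω)) * Complex.exp (-(Complex.I * (T * ω))) = 1 := by
    rw [← Complex.exp_add, add_neg_cancel, Complex.exp_zero]
  have h1 : Complex.exp (Complex.I * (T * ω)) ≠ 1 := by
    intro h1
    rw [h1, one_mul] at hinv
    rcases hq with hq | hq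
    · have := (sq_exp_mul_exp_eq_one_iff_quantPlus T θ ω).2 hq
      rw [h1, mul_one] at this
      exact hne this
    · have := (sq_exp_mul_exp_eq_one_iff_quantMinus T θ ω).2 hq
      rw [hinv, mul_one] at this
      exact hne this
  have h2 : Complex.exp (-(Complex.I * (T * ω))) ≠ 1 := by
    intro h2
    rw [h2, mul_one] at hinv
    exact h1 hinv
  rw [sinMean, one_mul, one_mul, if_neg h1, if_neg h2, sub_zero, zero_div]

end ResonantMean

/-! ### Decaying solutions are subordinate -/

section Subordinacy

variable {a b q : ℕ → ℝ} {x : ℝ}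

lemma exists_isSolution_eventuallyEq (ha : ∀ n, 0 < a n) (N : ℕ) (u : ℕ → ℂ)
    (hu : ∀ n, N ≤ n → 2 ≤ n → (a (n - 1) : ℂ) * u (n - 1) + ((b n : ℂ) + (q n : ℂ)) * u n
      + (a n : ℂ) * u (n + 1) = (x : ℂ) * u n) :
    ∃ u' : ℕ → ℂ, IsSolution a b q x u' ∧ ∀ᶠ n in atTop, u' n = u n := by
  induction N generalizing u with
  | zero => exact ⟨u, fun n hn => hu n (Nat.zero_le n) hn, Eventually.of_forall fun _ => rfl⟩
  | succ N ih =>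
    by_cases hN : N < 2
    · exact ih u fun n _ h2 => hu n (by omega) h2
    have ha' : (a (N - 1) : ℂ) ≠ 0 := by exact_mod_cast (ha _).ne'
    -- The value at the site `N - 1` is determined by the equation at the site `N`.
    set u₁ := Function.update u (N - 1)
      (((x : ℂ) * u N - ((b N : ℂ) + q N) * u N - a N * u (N + 1)) / a (N - 1)) with hu₁
    have hne : ∀ k, N ≤ k → u₁ k = u k := fun k hk => Function.update_of_ne (by omega) _ _
    obtain ⟨u', h1, h2⟩ := ih u₁ fun n hn h2 => by
      rcases hn.eq_or_lt with rfl | hn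
      · rw [hne N le_rfl, hne (N + 1) (by omega), hu₁, Function.update_self,
          mul_div_cancel₀ _ ha']
        ring
      · rw [hne _ (by omega), hne n (by omega), hne (n + 1) (by omega)]
        exact hu n hn h2
    refine ⟨u', h1, ?_⟩
    filter_upwards [h2, eventually_ge_atTop N] with n hn hN'
    rw [hn, hne n hN']

/-- Constancy of the Wronskian. -/
lemma wronskian_eq {u v : ℕ → ℂ} (hu : IsSolution a b q x u) (hv : IsSolution a b q x v) (n : ℕ) :
    (a (n + 1) : ℂ) * (u (n + 1) * v (n + 2) - u (n + 2) * v (n + 1)) =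
      a 1 * (u 1 * v 2 - u 2 * v 1) := by
  induction n with
  | zero => rfl
  | succ n ih =>
    have h1 := hu (n + 2) (by omega)
    have h2 := hv (n + 2) (by omega)
    rw [← ih]
    simp only [show n + 2 - 1 = n + 1 from rfl, show n + 1 + 1 = n + 2 from rfl,
      show n + 1 + 2 = n + 2 + 1 from rfl] at h1 h2 ⊢
    linear_combination u (n + 2) * h2 - v (n + 2) * h1

lemma IsSolution.eq_of_eq (ha : ∀ n, 0 < a n) {u v : ℕ → ℂ} (hu : IsSolution a b q x u)
    (hv : IsSolution a b q x v) (h1 : u 1 = v 1) (h2 : u 2 = v 2) (n : ℕ) (hn : 1 ≤ n) :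
    u n = v n := by
  suffices ∀ n, u (n + 1) = v (n + 1) ∧ u (n + 2) = v (n + 2) by
    obtain ⟨m, rfl⟩ : ∃ m, n = m + 1 := ⟨n - 1, by omega⟩
    exact (this m).1
  intro n
  induction n with
  | zero => exact ⟨h1, h2⟩
  | succ n ih =>
    refine ⟨ih.2, ?_⟩
    have e1 := hu (n + 2) (by omega)
    have e2 := hv (n + 2) (by omega)
    have ha' : (a (n + 2) : ℂ) ≠ 0 := by exact_mod_cast (ha _).ne'
    simp only [show n + 2 - 1 = n + 1 from rfl] at e1 e2
    rw [ih.1, ih.2] at e1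
    exact mul_left_cancel₀ ha' (add_left_cancel (e1.trans e2.symm))

lemma IsSolution.const_mul {u : ℕ → ℂ} (hu : IsSolution a b q x u) (C : ℂ) :
    IsSolution a b q x fun n => C * u n := fun n hn => by linear_combination C * hu n hn

lemma wronskian_ne_zero (ha : ∀ n, 0 < a n) {u v : ℕ → ℂ} (hu : IsSolution a b q x u)
    (hu0 : NonzeroSeq u) (hv : IsSolution a b q x v)
    (hne : ¬ ∃ C : ℂ, ∀ n : ℕ, 1 ≤ n → v n = C * u n) : u 1 * v 2 - u 2 * v 1 ≠ 0 := by
  intro hW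
  by_cases h1 : u 1 = 0
  · by_cases h2 : u 2 = 0
    · obtain ⟨n, hn, hun⟩ := hu0
      refine hun (IsSolution.eq_of_eq ha hu (v := fun _ => 0) (fun n _ => by simp) h1 h2 n hn)
    · refine hne ⟨v 2 / u 2, fun n hn => IsSolution.eq_of_eq ha hv (hu.const_mul _) ?_ ?_ n hn⟩
      · rw [h1, zero_mul, zero_sub, neg_eq_zero] at hW
        rw [h1, mul_zero, (mul_eq_zero.1 hW).resolve_left h2]
      · rw [div_mul_cancel₀ _ h2]
  · refine hne ⟨v 1 / u 1, fun n hn => IsSolution.eq_of_eq ha hv (hu.const_mul _) ?_ ?_ n hn⟩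
    · rw [div_mul_cancel₀ _ h1]
    · field_simp
      linear_combination hW

lemma sq_truncNorm (u : ℕ → ℂ) (N : ℕ) :
    truncNorm u N ^ 2 = ∑ n ∈ Finset.range N, ‖u (n + 1)‖ ^ 2 := by
  rw [truncNorm, Real.sq_sqrt (Finset.sum_nonneg fun _ _ => by positivity), Finset.range_eq_Ico,
    Finset.sum_Ico_add' (fun n => ‖u n‖ ^ 2) 0 N 1]
  rfl

/-- A decaying solution is subordinate: since the Wronskian with an independent solution `v` is a
nonzero constant, the energy `|v_n|² + |v_{n+1}|²` is at least a constant times the reciprocal of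
that of `u`. -/
lemma isSubordinate_of_tendsto_zero (ha : ∀ n, 0 < a n) {A : ℝ} (hA : ∀ n, |a n| ≤ A) {u : ℕ → ℂ}
    (hu : IsSolution a b q x u) (hu0 : NonzeroSeq u) (hlim : Tendsto u atTop (𝓝 0)) :
    IsSubordinate a b q x u := by
  refine ⟨hu, hu0, fun v hv hne => ?_⟩
  have hW := wronskian_ne_zero ha hu hu0 hv hne
  set f : (ℕ → ℂ) → ℕ → ℝ := fun u n => ‖u (n + 1)‖ ^ 2 + ‖u (n + 2)‖ ^ 2 with hf
  have hf0 : ∀ u n, 0 ≤ f u n := fun u n => by positivity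
  set W : ℝ := ‖(a 1 : ℂ) * (u 1 * v 2 - u 2 * v 1)‖ with hWdef
  have hWpos : 0 < W :=
    norm_pos_iff.2 (mul_ne_zero (by exact_mod_cast (ha 1).ne') hW)
  have hA0 : 0 < A := (ha 0).trans_le ((le_abs_self _).trans (hA 0))
  -- Cauchy-Schwarz for the Wronskian.
  have hCS : ∀ n, W ^ 2 ≤ A ^ 2 * (f u n * f v n) := by
    intro n
    rw [hWdef, ← wronskian_eq hu hv n, norm_mul, mul_pow, Complex.norm_real, Real.norm_eq_abs]
    refine mul_le_mul (pow_le_pow_left₀ (abs_nonneg _) (hA _) 2) ?_ (by positivity) (by positivity)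
    have h1 : ‖u (n + 1) * v (n + 2) - u (n + 2) * v (n + 1)‖ ≤
        ‖u (n + 1)‖ * ‖v (n + 2)‖ + ‖u (n + 2)‖ * ‖v (n + 1)‖ := by
      refine (norm_sub_le _ _).trans ?_
      rw [norm_mul, norm_mul]
    refine (pow_le_pow_left₀ (norm_nonneg _) h1 2).trans ?_
    simp only [hf]
    nlinarith [sq_nonneg (‖u (n + 1)‖ * ‖v (n + 1)‖ - ‖u (n + 2)‖ * ‖v (n + 2)‖)]
  have hfu : Tendsto (f u) atTop (𝓝 0) := by
    have h1 := ((hlim.comp (tendsto_add_atTop_nat 1)).norm.pow 2).add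
      ((hlim.comp (tendsto_add_atTop_nat 2)).norm.pow 2)
    simpa using h1
  have hfv : ∀ᶠ n in atTop, W ^ 2 / A ^ 2 ≤ f v n := by
    filter_upwards [hfu.eventually_le_const one_pos] with n hn
    rw [div_le_iff₀ (by positivity), mul_comm]
    refine (hCS n).trans (mul_le_mul_of_nonneg_left ?_ (by positivity))
    exact mul_le_of_le_one_left (hf0 v n) hn
  have hlo : (f u) =o[atTop] (f v) := by
    rw [Asymptotics.isLittleO_iff]
    intro c hc
    have hev := hfu.eventually_le_const
      (show (0 : ℝ) < Real.sqrt (c * (W ^ 2 / A ^ 2)) by positivity)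
    filter_upwards [hev] with n hn
    rw [Real.norm_of_nonneg (hf0 _ _), Real.norm_of_nonneg (hf0 _ _)]
    rcases (hf0 u n).eq_or_lt with h0 | h0
    · rw [← h0]; exact mul_nonneg hc.le (hf0 _ _)
    · have h1 : f u n ^ 2 ≤ c * (W ^ 2 / A ^ 2) := (Real.le_sqrt' h0).1 hn
      have h2 : W ^ 2 / A ^ 2 ≤ f u n * f v n := by
        rw [div_le_iff₀ (by positivity), mul_comm]; exact hCS n
      have h3 := h1.trans (mul_le_mul_of_nonneg_left h2 hc.le)
      refine le_of_mul_le_mul_left ?_ h0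
      linarith
  have hdiv : Tendsto (fun n => ∑ i ∈ Finset.range n, f v i) atTop atTop := by
    have hnot : ¬ Summable (f v) := by
      intro hs
      have := hs.tendsto_atTop_zero
      have h1 := ge_of_tendsto this hfv
      have : 0 < W ^ 2 / A ^ 2 := by positivity
      linarith
    exact (not_summable_iff_tendsto_nat_atTop_of_nonneg (hf0 v)).1 hnot
  have hsum := hlo.sum_range (hf0 v) hdiv
  have hconst : (fun _ : ℕ => ‖u 1‖ ^ 2) =o[atTop] fun n => ∑ i ∈ Finset.range n, f v i :=
    Asymptotics.isLittleO_const_left.2 (Or.inr (tendsto_norm_atTop_atTop.comp hdiv))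
  have hratio := ((hconst.add hsum).tendsto_div_nhds_zero).const_mul 2
  rw [mul_zero] at hratio
  rw [← tendsto_add_atTop_iff_nat 1]
  have hsq : Tendsto (fun N => (truncNorm u (N + 1) / truncNorm v (N + 1)) ^ 2) atTop (𝓝 0) := by
    refine squeeze_zero' (Eventually.of_forall fun _ => by positivity) ?_ hratio
    filter_upwards [hdiv.eventually_gt_atTop 0] with N hN
    rw [div_pow, sq_truncNorm, sq_truncNorm, ← mul_div_assoc]
    have hU : ∑ n ∈ Finset.range (N + 1), ‖u (n + 1)‖ ^ 2 ≤
        ‖u 1‖ ^ 2 + ∑ i ∈ Finset.range N, f u i := by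
      rw [Finset.sum_range_succ', add_comm]
      exact add_le_add le_rfl (Finset.sum_le_sum fun i _ => by
        simp only [hf]; linarith [sq_nonneg ‖u (i + 1)‖])
    have hV : ∑ i ∈ Finset.range N, f v i ≤ 2 * ∑ n ∈ Finset.range (N + 1), ‖v (n + 1)‖ ^ 2 := by
      simp only [hf]
      rw [Finset.sum_add_distrib, two_mul]
      refine add_le_add ?_ ?_
      · rw [Finset.sum_range_succ]; linarith [sq_nonneg ‖v (N + 1)‖]
      · rw [Finset.sum_range_succ']; linarith [sq_nonneg ‖v (0 + 1)‖]
    have hV0 : 0 < ∑ n ∈ Finset.range (N + 1), ‖v (n + 1)‖ ^ 2 := by linarith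
    have hU0 : 0 ≤ ‖u 1‖ ^ 2 + ∑ i ∈ Finset.range N, f u i :=
      add_nonneg (by positivity) (Finset.sum_nonneg fun i _ => hf0 u i)
    rw [div_le_div_iff₀ hV0 hN]
    nlinarith [mul_le_mul hU hV hN.le hU0]
  have h := hsq.sqrt
  simp only [Real.sqrt_zero] at h
  refine h.congr fun N => Real.sqrt_sq ?_
  exact div_nonneg (Real.sqrt_nonneg _) (Real.sqrt_nonneg _)

end Subordinacy

/-! ### The resonant system -/

section ResonantSystem

open ComplexConjugate

/-- The operator on `ℂ × ℂ` with the matrix `(p, q; r, s)`. -/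
noncomputable def prodMatrix (p q r s : ℂ) : ℂ × ℂ →L[ℝ] ℂ × ℂ :=
  ((ContinuousLinearMap.mul ℝ ℂ p).comp (ContinuousLinearMap.fst ℝ ℂ ℂ) +
    (ContinuousLinearMap.mul ℝ ℂ q).comp (ContinuousLinearMap.snd ℝ ℂ ℂ)).prod
  ((ContinuousLinearMap.mul ℝ ℂ r).comp (ContinuousLinearMap.fst ℝ ℂ ℂ) +
    (ContinuousLinearMap.mul ℝ ℂ s).comp (ContinuousLinearMap.snd ℝ ℂ ℂ))

@[simp] lemma prodMatrix_apply (p q r s : ℂ) (v : ℂ × ℂ) :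
    prodMatrix p q r s v = (p * v.1 + q * v.2, r * v.1 + s * v.2) := rfl

lemma prodMatrix_norm_le (p q r s : ℂ) :
    ‖prodMatrix p q r s‖ ≤ ‖p‖ + ‖q‖ + ‖r‖ + ‖s‖ := by
  refine ContinuousLinearMap.opNorm_le_bound _ (by positivity) fun v => ?_
  have h1 := norm_fst_le v
  have h2 := norm_snd_le v
  have key : ∀ p q : ℂ, ‖p * v.1 + q * v.2‖ ≤ (‖p‖ + ‖q‖) * ‖v‖ := by
    intro p q
    refine (norm_add_le _ _).trans ?_
    rw [norm_mul, norm_mul, add_mul]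
    gcongr
  rw [prodMatrix_apply, Prod.norm_def]
  refine max_le ((key p q).trans ?_) ((key r s).trans ?_)
  · exact mul_le_mul_of_nonneg_right (by linarith [norm_nonneg r, norm_nonneg s]) (norm_nonneg v)
  · exact mul_le_mul_of_nonneg_right (by linarith [norm_nonneg p, norm_nonneg q]) (norm_nonneg v)

lemma prodMatrix_sub (p q r s p' q' r' s' : ℂ) : prodMatrix p q r s - prodMatrix p' q' r' s' =
    prodMatrix (p - p') (q - q') (r - r') (s - s') := by
  ext v <;> simp <;> ring

lemma sum_prodMatrix {ι : Type*} (t : Finset ι) (p q r s : ι → ℂ) :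
    ∑ i ∈ t, prodMatrix (p i) (q i) (r i) (s i) =
      prodMatrix (∑ i ∈ t, p i) (∑ i ∈ t, q i) (∑ i ∈ t, r i) (∑ i ∈ t, s i) := by
  classical
  induction t using Finset.induction_on with
  | empty => ext v <;> simp
  | insert i t hi ih =>
    simp only [Finset.sum_insert hi, ih]
    ext v <;> simp <;> ring

variable {a b : ℕ → ℝ} {T : ℕ}

/-- The Wronskian of a Floquet solution and its conjugate is `-2i` times the flux, which is constant
at real points. -/
lemma floquet_wronskian (ha : ∀ n, 0 < a n) (x θ : ℝ) (n : ℕ) :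
    (a n : ℂ) * (floquetSol a b T x (Complex.exp (Complex.I * θ)) n *
        conj (floquetSol a b T x (Complex.exp (Complex.I * θ)) (n + 1)) -
      floquetSol a b T x (Complex.exp (Complex.I * θ)) (n + 1) *
        conj (floquetSol a b T x (Complex.exp (Complex.I * θ)) n)) =
    -2 * Complex.I * (a 0 * Real.sin θ * (monodromy a b T x 0 1).re : ℝ) := by
  set ψ := floquetSol a b T x (Complex.exp (Complex.I * θ)) with hψ
  have hf : flux a ψ n = a 0 * Real.sin θ * (monodromy a b T x 0 1).re := by
    induction n with
    | zero =>
      rw [flux, hψ, floquetSol, floquetSol, zero_add, transferSol_one, transferSol_zero,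
        Complex.mul_im, Complex.conj_re, Complex.conj_im, Complex.sub_im, monodromy_ofReal_im,
        monodromy_ofReal_im, Complex.exp_I_mul_ofReal_im]
      ring
    | succ n ih => rw [flux_succ (floquetSol_rec ha _ _) n, ← hψ, ih]; simp
  have hc := Complex.sub_conj (ψ (n + 1) * conj (ψ n))
  rw [← hf, flux]
  simp only [map_mul, Complex.conj_conj] at hc
  push_cast at hc ⊢
  linear_combination (-(a n : ℂ)) * hc

/-- A combination of a Floquet solution and its conjugate does not tend to zero unless the
coefficients vanish, by the constancy of the Wronskian. -/
lemma not_tendsto_floquet_combination (hT : 0 < T) (ha : ∀ n, 0 < a n)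
    (haT : ∀ n, a (n + T) = a n) (hbT : ∀ n, b (n + T) = b n) {x θ : ℝ}
    (h : IsQuasiMomentum a b T x θ) {e₁ e₂ : ℂ} (he : e₁ ≠ 0) :
    ¬ Tendsto (fun n => e₁ * floquetSol a b T x (Complex.exp (Complex.I * θ)) n +
      e₂ * conj (floquetSol a b T x (Complex.exp (Complex.I * θ)) n)) atTop (𝓝 0) := by
  intro hlim
  have hw := floquet_wronskian (b := b) (T := T) ha x θ
  set ψ := floquetSol a b T x (Complex.exp (Complex.I * θ)) with hψ
  set v := fun n => e₁ * ψ n + e₂ * conj (ψ n) with hv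
  obtain ⟨A, hA⟩ := exists_bound_of_periodic hT haT
  obtain ⟨C, hC⟩ := exists_bound_of_periodic (f := fun n => ‖ψ n‖) hT fun n => by
    rw [hψ, floquetSol_add_period ha haT hbT h.2.2.1, norm_mul, Complex.norm_exp_I_mul_ofReal,
      one_mul]
  have hψb : ∀ n, ‖conj (ψ n)‖ ≤ C := fun n => by
    rw [RCLike.norm_conj]; exact (le_abs_self _).trans (hC n)
  have hab : ∀ n, ‖(a n : ℂ)‖ ≤ A := fun n => by
    rw [Complex.norm_real]; exact hA n
  have hz : ∀ {f g : ℕ → ℂ} {B : ℝ}, (∀ n, ‖f n‖ ≤ B) → Tendsto g atTop (𝓝 0) →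
      Tendsto (fun n => f n * g n) atTop (𝓝 0) := by
    intro f g B hf hg
    refine squeeze_zero_norm (a := fun n => B * ‖g n‖) (fun n => ?_)
      (by simpa using hg.norm.const_mul B)
    rw [norm_mul]
    exact mul_le_mul_of_nonneg_right (hf n) (norm_nonneg _)
  have h1 : Tendsto (fun n => (a n : ℂ) * (conj (ψ (n + 1)) * v n - conj (ψ n) * v (n + 1)))
      atTop (𝓝 0) := by
    refine hz hab ?_
    simpa using (hz (fun n => hψb (n + 1)) hlim).sub
      (hz hψb (hlim.comp (tendsto_add_atTop_nat 1)))
  have h2 : ∀ n, (a n : ℂ) * (conj (ψ (n + 1)) * v n - conj (ψ n) * v (n + 1)) =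
      e₁ * (-2 * Complex.I * (a 0 * Real.sin θ * (monodromy a b T x 0 1).re : ℝ)) := by
    intro n
    rw [← hw n]
    simp only [hv]
    ring
  have h3 := tendsto_nhds_unique (h1.congr h2) tendsto_const_nhds
  have hre : (monodromy a b T x 0 1).re ≠ 0 := fun h' =>
    h.monodromy_ne_zero ha haT (Complex.ext h' (monodromy_ofReal_im ..))
  have h4 : a 0 * Real.sin θ * (monodromy a b T x 0 1).re ≠ 0 :=
    mul_ne_zero (mul_ne_zero (ha 0).ne' h.sin_pos.ne') hre
  refine mul_ne_zero he (mul_ne_zero (by simp) ?_) h3.symm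
  exact_mod_cast h4

/-- Variation of constants: solutions of the first order system for the coefficients with respect to
`ψ` and `\bar ψ` give solutions of the perturbed recurrence. -/
lemma recurrence_of_coefficients (ha : ∀ n, 0 < a n) {x θ : ℝ} (h : IsQuasiMomentum a b T x θ)
    (haT : ∀ n, a (n + T) = a n) {q : ℕ → ℝ} {X : ℕ → ℂ × ℂ} {u : ℕ → ℂ} {W : ℂ} {N : ℕ}
    (hW : W = -2 * Complex.I * (a 0 * Real.sin θ * (monodromy a b T x 0 1).re : ℝ))
    (hu : ∀ n, u n = (X n).1 * floquetSol a b T x (Complex.exp (Complex.I * θ)) n +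
      (X n).2 * conj (floquetSol a b T x (Complex.exp (Complex.I * θ)) n))
    (hX₁ : ∀ n, N ≤ n → (X (n + 1)).1 = (X n).1 +
      q n / W * conj (floquetSol a b T x (Complex.exp (Complex.I * θ)) n) * u n)
    (hX₂ : ∀ n, N ≤ n → (X (n + 1)).2 = (X n).2 -
      q n / W * floquetSol a b T x (Complex.exp (Complex.I * θ)) n * u n) (n : ℕ)
    (hn : N ≤ n) :
    (a n : ℂ) * u n + ((b (n + 1) : ℂ) + q (n + 1)) * u (n + 1) + a (n + 1) * u (n + 2) =
      x * u (n + 1) := by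
  have hre : (monodromy a b T x 0 1).re ≠ 0 := fun h' =>
    h.monodromy_ne_zero ha haT (Complex.ext h' (monodromy_ofReal_im ..))
  have h4 : a 0 * Real.sin θ * (monodromy a b T x 0 1).re ≠ 0 :=
    mul_ne_zero (mul_ne_zero (ha 0).ne' h.sin_pos.ne') hre
  have hW0 : W ≠ 0 := by
    rw [hW]; exact mul_ne_zero (by simp) (by exact_mod_cast h4)
  have hw := floquet_wronskian (b := b) (T := T) ha x θ (n + 1)
  rw [← hW] at hw
  have hr := floquetSol_rec (b := b) (T := T) ha x (Complex.exp (Complex.I * θ)) n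
  set ψ := floquetSol a b T x (Complex.exp (Complex.I * θ)) with hψ
  have hrc := congrArg conj hr
  simp only [map_add, map_mul, Complex.conj_ofReal] at hrc
  have hu0 : u n = (X (n + 1)).1 * ψ n + (X (n + 1)).2 * conj (ψ n) := by
    rw [hX₁ n hn, hX₂ n hn, hu n]; ring
  have hu2 : a (n + 1) * u (n + 2) = a (n + 1) * ((X (n + 1)).1 * ψ (n + 2) +
      (X (n + 1)).2 * conj (ψ (n + 2))) - q (n + 1) * u (n + 1) := by
    rw [hu (n + 2), hX₁ (n + 1) (by omega), hX₂ (n + 1) (by omega)]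
    have hqW : (q (n + 1) : ℂ) / W * W = q (n + 1) := div_mul_cancel₀ _ hW0
    linear_combination (-(q (n + 1) / W * u (n + 1))) * hw - u (n + 1) * hqW
  rw [hu2, hu0]
  linear_combination (X (n + 1)).1 * hr + (X (n + 1)).2 * hrc + (b (n + 1) - x) * hu (n + 1)

end ResonantSystem

/-! ### Existence of the subordinate solution -/

section SubordinateSolution

open ComplexConjugate

variable {a b : ℕ → ℝ} {T : ℕ}

/-- The coefficients of a solution with respect to `ψ` and `\bar ψ` satisfy
`X_{n+1} = (1 + S_n / n) X_n`, where the mean of `S_n` squares to `γ²`; asymptotic integration yields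
a solution with `n^γ X_n → e` for an eigenvector `e` of the mean. -/
lemma exists_coefficients (hT : 0 < T) (ha : ∀ n, 0 < a n) (haT : ∀ n, a (n + T) = a n)
    (hbT : ∀ n, b (n + T) = b n) {x θ ω φ c γ : ℝ} (h : IsQuasiMomentum a b T x θ)
    (hq : QuantPlus T θ ω ∨ QuantMinus T θ ω)
    (hγ : γ = ‖(c : ℂ) * resonanceAmp a b T x θ ω φ / (Real.sin θ : ℂ)‖) (hγ0 : 0 < γ) {W : ℂ}
    (hW : W = -2 * Complex.I * (a 0 * Real.sin θ * (monodromy a b T x 0 1).re : ℝ)) :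
    ∃ (X : ℕ → ℂ × ℂ) (e : ℂ × ℂ) (N : ℕ), e.1 ≠ 0 ∧
      Tendsto (fun n : ℕ => (n : ℝ) ^ γ • X n) atTop (𝓝 e) ∧ ∀ n, N ≤ n →
      (X (n + 1)).1 = (X n).1 + wvnPotential c ω φ n / W *
        conj (floquetSol a b T x (Complex.exp (Complex.I * θ)) n) *
        ((X n).1 * floquetSol a b T x (Complex.exp (Complex.I * θ)) n +
          (X n).2 * conj (floquetSol a b T x (Complex.exp (Complex.I * θ)) n)) ∧
      (X (n + 1)).2 = (X n).2 - wvnPotential c ω φ n / W *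
        floquetSol a b T x (Complex.exp (Complex.I * θ)) n *
        ((X n).1 * floquetSol a b T x (Complex.exp (Complex.I * θ)) n +
          (X n).2 * conj (floquetSol a b T x (Complex.exp (Complex.I * θ)) n)) := by
  have hnorm := norm_resonanceAmp hT ha haT h hq (φ := φ)
  have hper : ∀ n, floquetSol a b T x (Complex.exp (Complex.I * θ)) (n + T) =
      Complex.exp (Complex.I * θ) * floquetSol a b T x (Complex.exp (Complex.I * θ)) n :=
    floquetSol_add_period ha haT hbT h.2.2.1
  have hμ := Complex.norm_exp_I_mul_ofReal θ
  have hp0 := h.monodromy_ne_zero ha haT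
  have hre : ‖monodromy a b T x 0 1‖ = |(monodromy a b T x 0 1).re| := by
    have h2 : monodromy a b T x 0 1 = ((monodromy a b T x 0 1).re : ℂ) :=
      Complex.ext rfl (by simp [monodromy_ofReal_im])
    conv_lhs => rw [h2, Complex.norm_real, Real.norm_eq_abs]
  have hsin := h.sin_pos
  have ha0 := ha 0
  set ψ := floquetSol a b T x (Complex.exp (Complex.I * θ)) with hψ
  set μ := Complex.exp (Complex.I * θ) with hμdef
  set p := (monodromy a b T x 0 1).re with hp
  have hp' : 0 < |p| := by rw [← hre]; exact norm_pos_iff.2 hp0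
  set β := sinMean (fun n => ψ n ^ 2) (μ ^ 2) T ω φ with hβ
  obtain ⟨C, hC⟩ := exists_bound_of_periodic (f := fun n => ‖ψ n‖) hT fun n => by
    rw [hper, norm_mul, hμ, one_mul]
  have hψC : ∀ n, ‖ψ n‖ ≤ C := fun n => (le_abs_self _).trans (hC n)
  have hC0 : 0 ≤ C := (norm_nonneg _).trans (hψC 0)
  set f₁ : ℕ → ℂ := fun n => ψ n * conj (ψ n) * (Real.sin (n * ω + φ) : ℂ) with hf₁
  set f₂ : ℕ → ℂ := fun n => ψ n ^ 2 * (Real.sin (n * ω + φ) : ℂ) with hf₂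
  obtain ⟨C₁, hC₁⟩ : ∃ C₁, ∀ n, ‖∑ m ∈ Finset.range n, f₁ m‖ ≤ C₁ := by
    obtain ⟨C₁, hC₁⟩ := exists_bound_sum_sub_sinMean hT (h := fun n => ψ n * conj (ψ n)) norm_one
      (fun n => by
        have : μ * conj μ = 1 := by rw [Complex.mul_conj, Complex.normSq_eq_norm_sq, hμ]; simp
        rw [hper, map_mul, one_mul]
        linear_combination ψ n * conj (ψ n) * this) ω φ
    rw [sinMean_eq_zero h hq] at hC₁
    exact ⟨C₁, by simpa only [sub_zero] using hC₁⟩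
  obtain ⟨C₂, hC₂⟩ := exists_bound_sum_sub_sinMean hT (h := fun n => ψ n ^ 2) (η := μ ^ 2)
    (by rw [norm_pow, hμ, one_pow]) (fun n => by rw [hper, mul_pow]) ω φ
  rw [← hβ] at hC₂
  have hf₁b : ∀ n, ‖f₁ n‖ ≤ C ^ 2 := fun n => by
    rw [hf₁, norm_mul, norm_mul, RCLike.norm_conj, Complex.norm_real, sq]
    exact (mul_le_of_le_one_right (by positivity) (Real.abs_sin_le_one _)).trans
      (mul_le_mul (hψC n) (hψC n) (norm_nonneg _) hC0)
  have hf₂b : ∀ n, ‖f₂ n‖ ≤ C ^ 2 := fun n => by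
    rw [hf₂, norm_mul, norm_pow, Complex.norm_real]
    exact (mul_le_of_le_one_right (by positivity) (Real.abs_sin_le_one _)).trans
      (pow_le_pow_left₀ (norm_nonneg _) (hψC n) 2)
  replace hC₂ : ∀ n, ‖∑ m ∈ Finset.range n, (f₂ m - β)‖ ≤ C₂ := hC₂
  clear_value f₁ f₂
  set k : ℂ := c / W with hk
  set S : ℕ → ℂ × ℂ →L[ℝ] ℂ × ℂ := fun n =>
    prodMatrix (k * f₁ n) (k * conj (f₂ n)) (-(k * f₂ n)) (-(k * f₁ n)) with hS
  set V : ℂ × ℂ →L[ℝ] ℂ × ℂ := prodMatrix 0 (k * conj β) (-(k * β)) 0 with hV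
  have hSb : ∀ n, ‖S n‖ ≤ 4 * (‖k‖ * C ^ 2) := fun n => by
    refine (prodMatrix_norm_le _ _ _ _).trans ?_
    rw [norm_neg, norm_neg, norm_mul, norm_mul, norm_mul, RCLike.norm_conj]
    have h1 := mul_le_mul_of_nonneg_left (hf₁b n) (norm_nonneg k)
    have h2 := mul_le_mul_of_nonneg_left (hf₂b n) (norm_nonneg k)
    linarith
  have hFb : ∀ n, ‖∑ m ∈ Finset.range n, (S m - V)‖ ≤ 2 * (‖k‖ * C₁) + 2 * (‖k‖ * C₂) := fun n => by
    have e : ∀ m, S m - V = prodMatrix (k * f₁ m) (k * conj (f₂ m - β)) (-(k * (f₂ m - β)))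
        (-(k * f₁ m)) := fun m => by
      rw [hS, hV, prodMatrix_sub, map_sub]
      congr 1 <;> ring
    simp only [e]
    rw [sum_prodMatrix]
    refine (prodMatrix_norm_le _ _ _ _).trans ?_
    simp only [Finset.sum_neg_distrib, ← Finset.mul_sum, ← map_sum]
    rw [norm_neg, norm_neg, norm_mul, norm_mul, norm_mul, RCLike.norm_conj]
    have h1 := mul_le_mul_of_nonneg_left (hC₁ n) (norm_nonneg k)
    have h2 := mul_le_mul_of_nonneg_left (hC₂ n) (norm_nonneg k)
    linarith
  have hγ2 : -(k * conj β * (k * β)) = ((γ ^ 2 : ℝ) : ℂ) := by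
    have hp2 : (p : ℂ) ≠ 0 := by exact_mod_cast abs_pos.1 hp'
    have hs2 : (Real.sin θ : ℂ) ≠ 0 := by exact_mod_cast hsin.ne'
    have ha2 : (a 0 : ℂ) ≠ 0 := by exact_mod_cast ha0.ne'
    have hγ' : γ ^ 2 = c ^ 2 * ‖β‖ ^ 2 / (4 * a 0 ^ 2 * p ^ 2 * Real.sin θ ^ 2) := by
      rw [hγ, norm_div, norm_mul, hnorm, hre, Complex.norm_real, Complex.norm_real, div_pow, mul_pow,
        div_pow, mul_pow, Real.norm_eq_abs, Real.norm_eq_abs, sq_abs, sq_abs, sq_abs]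
      field_simp
      ring
    have hββ : conj β * β = ((‖β‖ ^ 2 : ℝ) : ℂ) := by
      rw [mul_comm, Complex.mul_conj, Complex.normSq_eq_norm_sq]
    have hkk : k * k = -(((c ^ 2 / (4 * a 0 ^ 2 * p ^ 2 * Real.sin θ ^ 2) : ℝ)) : ℂ) := by
      rw [hk, hW]
      push_cast at hs2 ⊢
      field_simp
      rw [Complex.I_sq]
      ring
    rw [show -(k * conj β * (k * β)) = -(k * k) * (conj β * β) by ring, hkk, hββ, hγ']
    push_cast
    ring
  have hVV : V * V = γ ^ 2 • (1 : ℂ × ℂ →L[ℝ] ℂ × ℂ) := by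
    have h1 : ∀ z : ℂ, k * conj β * (-(k * β) * z) = γ ^ 2 * z := fun z => by
      have := hγ2; push_cast at this; linear_combination z * this
    have h2 : ∀ z : ℂ, -(k * β) * (k * conj β * z) = γ ^ 2 * z := fun z => by
      have := hγ2; push_cast at this; linear_combination z * this
    refine ContinuousLinearMap.ext fun v => ?_
    change V (V v) = γ ^ 2 • v
    rw [hV]
    refine Prod.ext ?_ ?_ <;>
      simp only [prodMatrix_apply, zero_mul, zero_add, add_zero, Prod.smul_fst, Prod.smul_snd,
        Complex.real_smul, Complex.ofReal_pow, h1, h2]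
  set e : ℂ × ℂ := (1, 0) - γ⁻¹ • V (1, 0) with he
  have hVe : V e = -γ • e := by
    have h1 : V (V (1, 0)) = γ ^ 2 • ((1, 0) : ℂ × ℂ) :=
      congrArg (fun A : ℂ × ℂ →L[ℝ] ℂ × ℂ => A (1, 0)) hVV
    rw [he, map_sub, map_smul, h1, smul_smul, smul_sub, smul_smul,
      show γ⁻¹ * γ ^ 2 = γ by field_simp, show -γ * γ⁻¹ = -1 by field_simp]
    module
  obtain ⟨X, N, hX, hlim⟩ := exists_decaying_solution_of_mean hγ0 hVV hSb hFb hVe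
  refine ⟨X, e, N, ?_, hlim, fun n hn => ?_⟩
  · rw [he, hV]
    simp
  · rw [hX n hn, hS]
    simp only [prodMatrix_apply, Prod.fst_add, Prod.snd_add, Prod.smul_fst, Prod.smul_snd,
      Complex.real_smul, hf₁, hf₂, hk, wvnPotential, map_mul, map_pow, Complex.conj_ofReal]
    push_cast
    constructor <;> ring

lemma memℓp_two_of_rpow_bound {u : ℕ → ℂ} {γ B : ℝ} (hγ : 1 / 2 < γ)
    (hB : ∀ᶠ n : ℕ in atTop, ‖u n‖ ≤ B * (n : ℝ) ^ (-γ)) : Memℓp u 2 := by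
  refine memℓp_gen ?_
  have hs : Summable fun n : ℕ => B ^ 2 * (n : ℝ) ^ (-(2 * γ)) :=
    (Real.summable_nat_rpow.2 (by linarith)).mul_left _
  refine summable_of_isBigO_nat hs (Asymptotics.IsBigO.of_bound 1 ?_)
  filter_upwards [hB] with n hn
  have h1 : ‖u n‖ ^ 2 ≤ (B * (n : ℝ) ^ (-γ)) ^ 2 := pow_le_pow_left₀ (norm_nonneg _) hn 2
  have h2 : (n : ℝ) ^ (-(2 * γ)) = ((n : ℝ) ^ (-γ)) ^ 2 := by
    rw [← Real.rpow_natCast, ← Real.rpow_mul (Nat.cast_nonneg n)]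
    congr 1
    push_cast
    ring
  rw [one_mul, h2, ← mul_pow, ENNReal.toReal_ofNat, Real.rpow_two, norm_pow, norm_norm]
  exact h1.trans (le_abs_self _)

lemma exists_subordinate_solution (hT : 0 < T) (ha : ∀ n, 0 < a n) (haT : ∀ n, a (n + T) = a n)
    (hbT : ∀ n, b (n + T) = b n) {x θ ω φ c γ : ℝ} (h : IsQuasiMomentum a b T x θ)
    (hq : QuantPlus T θ ω ∨ QuantMinus T θ ω)
    (hγ : γ = ‖(c : ℂ) * resonanceAmp a b T x θ ω φ / (Real.sin θ : ℂ)‖) (hγ0 : 0 < γ) :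
    ∃ u : ℕ → ℂ, IsSubordinate a b (wvnPotential c ω φ) x u ∧ Tendsto u atTop (𝓝 0) ∧
      (∃ v : ℕ → ℂ, IsSolution a b (fun _ => 0) x v ∧ NonzeroSeq v ∧
        Tendsto (fun n : ℕ => (((n : ℝ) ^ γ : ℝ) : ℂ) * u n - v n) atTop (𝓝 0)) ∧
      (1 / 2 < γ → Memℓp u 2) := by
  obtain ⟨X, e, N, he, hlim, hX⟩ := exists_coefficients hT ha haT hbT h hq hγ hγ0 rfl
  have hrec := recurrence_of_coefficients (b := b) (N := N) ha h haT (q := wvnPotential c ω φ)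
    (X := X) rfl (fun n => rfl) (fun n hn => (hX n hn).1) (fun n hn => (hX n hn).2)
  have hnot := not_tendsto_floquet_combination hT ha haT hbT h (e₂ := e.2) he
  have hr := floquetSol_rec (b := b) (T := T) ha x (Complex.exp (Complex.I * θ))
  obtain ⟨C, hC⟩ := exists_bound_of_periodic
    (f := fun n => ‖floquetSol a b T x (Complex.exp (Complex.I * θ)) n‖) hT fun n => by
      rw [floquetSol_add_period ha haT hbT h.2.2.1, norm_mul, Complex.norm_exp_I_mul_ofReal,
        one_mul]
  set ψ := floquetSol a b T x (Complex.exp (Complex.I * θ)) with hψ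
  have hψC : ∀ n, ‖ψ n‖ ≤ C := fun n => (le_abs_self _).trans (hC n)
  have hC0 : 0 ≤ C := (norm_nonneg _).trans (hψC 0)
  set v : ℕ → ℂ := fun n => e.1 * ψ n + e.2 * conj (ψ n) with hv
  obtain ⟨u, hu, huX⟩ := exists_isSolution_eventuallyEq (b := b) (q := wvnPotential c ω φ) (x := x)
    ha (N + 1) (fun n => (X n).1 * ψ n + (X n).2 * conj (ψ n)) fun n hn h2 => by
      have := hrec (n - 1) (by omega)
      rw [show n - 1 + 1 = n by omega, show n - 1 + 2 = n + 1 by omega] at this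
      exact this
  have hasymp : Tendsto (fun n : ℕ => (((n : ℝ) ^ γ : ℝ) : ℂ) * u n - v n) atTop (𝓝 0) := by
    have h0 : Tendsto (fun n : ℕ => ‖(n : ℝ) ^ γ • X n - e‖ * C + ‖(n : ℝ) ^ γ • X n - e‖ * C) atTop
        (𝓝 0) := by
      have := (tendsto_iff_norm_sub_tendsto_zero.1 hlim).mul_const C
      simpa using this.add this
    refine squeeze_zero_norm' ?_ h0
    filter_upwards [huX] with n hn
    have e1 : (((n : ℝ) ^ γ : ℝ) : ℂ) * u n - v n =
        ((n : ℝ) ^ γ • X n - e).1 * ψ n + ((n : ℝ) ^ γ • X n - e).2 * conj (ψ n) := by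
      rw [hn, hv]
      simp only [Prod.fst_sub, Prod.snd_sub, Prod.smul_fst, Prod.smul_snd, Complex.real_smul]
      ring
    rw [e1]
    refine (norm_add_le _ _).trans (add_le_add ?_ ?_)
    · rw [norm_mul]
      exact mul_le_mul (norm_fst_le _) (hψC n) (norm_nonneg _) (norm_nonneg _)
    · rw [norm_mul, RCLike.norm_conj]
      exact mul_le_mul (norm_snd_le _) (hψC n) (norm_nonneg _) (norm_nonneg _)
  have hvb : ∀ n, ‖v n‖ ≤ ‖e.1‖ * C + ‖e.2‖ * C := fun n => by
    refine (norm_add_le _ _).trans ?_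
    rw [norm_mul, norm_mul, RCLike.norm_conj]
    exact add_le_add (mul_le_mul_of_nonneg_left (hψC n) (norm_nonneg _))
      (mul_le_mul_of_nonneg_left (hψC n) (norm_nonneg _))
  set B := ‖e.1‖ * C + ‖e.2‖ * C + 1 with hB
  have hub : ∀ᶠ n : ℕ in atTop, ‖u n‖ ≤ B * (n : ℝ) ^ (-γ) := by
    filter_upwards [hasymp.norm.eventually_le_const (by simp : ‖(0 : ℂ)‖ < 1),
      eventually_gt_atTop 0] with n hn hn0
    have hn' : (0 : ℝ) < n := by exact_mod_cast hn0
    have hpos : 0 < (n : ℝ) ^ γ := Real.rpow_pos_of_pos hn' γ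
    have h1 : ‖(((n : ℝ) ^ γ : ℝ) : ℂ) * u n‖ ≤ B := by
      have := norm_add_le ((((n : ℝ) ^ γ : ℝ) : ℂ) * u n - v n) (v n)
      rw [sub_add_cancel] at this
      linarith [hvb n]
    rw [norm_mul, Complex.norm_real, Real.norm_of_nonneg hpos.le] at h1
    rw [Real.rpow_neg hn'.le, ← div_eq_mul_inv, le_div_iff₀ hpos]
    linarith
  have hu0 : Tendsto u atTop (𝓝 0) := by
    refine squeeze_zero_norm' hub ?_
    simpa using ((tendsto_rpow_neg_atTop hγ0).comp tendsto_natCast_atTop_atTop).const_mul B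
  have hunz : NonzeroSeq u := by
    by_contra hz
    refine hnot ((hasymp.neg).congr' ?_ |>.trans_eq ?_)
    · filter_upwards [eventually_ge_atTop 1] with n hn
      have : u n = 0 := by
        by_contra h'
        exact hz ⟨n, hn, h'⟩
      rw [this, mul_zero, zero_sub, neg_neg]
    · rw [neg_zero]
  have hvnz : NonzeroSeq v := by
    by_contra hz
    refine hnot (tendsto_const_nhds.congr' ?_)
    filter_upwards [eventually_ge_atTop 1] with n hn
    by_contra h'
    exact hz ⟨n, hn, Ne.symm h'⟩
  have hvsol : IsSolution a b (fun _ => 0) x v := by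
    intro n hn
    obtain ⟨m, rfl⟩ : ∃ m, n = m + 1 := ⟨n - 1, by omega⟩
    have hrc := congrArg conj (hr m)
    simp only [map_add, map_mul, Complex.conj_ofReal] at hrc
    simp only [hv, Nat.add_sub_cancel, Complex.ofReal_zero, add_zero]
    linear_combination e.1 * hr m + e.2 * hrc
  obtain ⟨A, hA⟩ := exists_bound_of_periodic hT haT
  exact ⟨u, isSubordinate_of_tendsto_zero ha hA hu hunz hu0, hu0, ⟨v, hvsol, hvnz, hasymp⟩,
    fun hγ1 => memℓp_two_of_rpow_bound hγ1 hub⟩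

end SubordinateSolution

theorem theorem1 (T : ℕ) (hT : 0 < T) (a b : ℕ → ℝ)
    (ha : ∀ n, 0 < a n) (haT : ∀ n, a (n + T) = a n) (hbT : ∀ n, b (n + T) = b n)
    (θ : ℝ → ℝ) (hθ : ∀ x ∈ ellipticSet a b T, IsQuasiMomentum a b T x (θ x)) :
    -- the choice of frequencies, and finiteness of the exceptional set
    (∃ (g : ℂ → ℂ) (ωp ωm : ℝ → ℝ),
      IsMultiplierRoot a b T g ∧
      (∀ x ∈ ellipticSet a b T,
        (0 < ωp x ∧ ωp x < 2 * Real.pi ∧ QuantPlus T (θ x) (ωp x) ∧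
          (Complex.exp (-(Complex.I * (ωp x : ℂ))) = g (x : ℂ) ∨
            Complex.exp (-(Complex.I * (ωp x : ℂ))) = star (g (x : ℂ)))) ∧
        (0 < ωm x ∧ ωm x < 2 * Real.pi ∧ QuantMinus T (θ x) (ωm x) ∧
          (Complex.exp (Complex.I * (ωm x : ℂ)) = g (x : ℂ) ∨
            Complex.exp (Complex.I * (ωm x : ℂ)) = star (g (x : ℂ))))) ∧
      ∀ φ : ℝ,
        {x ∈ ellipticSet a b T | resonanceAmp a b T x (θ x) (ωp x) φ = 0 ∨
          resonanceAmp a b T x (θ x) (ωm x) φ = 0}.Finite) ∧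
    -- the subordinate solution
    (∀ x ∈ ellipticSet a b T, ∀ ω φ : ℝ,
      (QuantPlus T (θ x) ω ∨ QuantMinus T (θ x) ω) →
      resonanceAmp a b T x (θ x) ω φ ≠ 0 →
      ∃ δ : ℝ, 0 < δ ∧ ∀ c : ℝ, c ≠ 0 →
        ∃ u : ℕ → ℂ,
          IsSubordinate a b (wvnPotential c ω φ) x u ∧
          Tendsto u atTop (𝓝 0) ∧
          (∃ v : ℕ → ℂ, IsSolution a b (fun _ => 0) x v ∧ NonzeroSeq v ∧
            Tendsto
              (fun n : ℕ =>
                (((n : ℝ) ^ ‖(c : ℂ) * resonanceAmp a b T x (θ x) ω φ /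
                    (Real.sin (θ x) : ℂ)‖ : ℝ) : ℂ) * u n - v n)
              atTop (𝓝 0)) ∧
          (δ < |c| → Memℓp u 2)) := by

  constructor
  · choose! ωp h0 h1 hquant hg using fun x (hx : x ∈ ellipticSet a b T) =>
      exists_frequency hT ha haT hbT (hθ x hx)
    refine ⟨weylRoot a b T, ωp, fun x => 2 * Real.pi - ωp x,
      isMultiplierRoot_weylRoot hT ha haT hbT hθ, fun x hx => ⟨⟨h0 x hx, h1 x hx, hquant x hx, ?_⟩,
        by linarith [h1 x hx], by linarith [h0 x hx], (hquant x hx).quantMinus, ?_⟩, fun φ => ?_⟩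
    · exact (hg x hx).imp And.left And.left
    · rw [Complex.exp_I_mul_two_pi_sub]
      exact (hg x hx).imp And.left And.left
    · refine (finite_resonanceFun_zeros hT ha haT hbT hθ).subset ?_
      rintro x ⟨hx, hR⟩
      exact ⟨hx, resonanceFun_eq_zero_of_amp hT ha haT (hθ x hx) (hquant x hx) (hg x hx) hR⟩
  · intro x hx ω φ hq hR
    have hs := (hθ x hx).sin_pos
    have hR' := norm_pos_iff.2 hR
    -- The exponent `|c R / sin θ|` exceeds `1 / 2` exactly when `|c|` exceeds this `δ`.
    refine ⟨Real.sin (θ x) / (2 * ‖resonanceAmp a b T x (θ x) ω φ‖), by positivity, fun c hc => ?_⟩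
    have hγ : ‖(c : ℂ) * resonanceAmp a b T x (θ x) ω φ / (Real.sin (θ x) : ℂ)‖ =
        |c| * ‖resonanceAmp a b T x (θ x) ω φ‖ / Real.sin (θ x) := by
      rw [norm_div, norm_mul, Complex.norm_real, Complex.norm_real, Real.norm_of_nonneg hs.le,
        Real.norm_eq_abs]
    have hc' := abs_pos.2 hc
    obtain ⟨u, h1, h2, h3, h4⟩ := exists_subordinate_solution hT ha haT hbT (hθ x hx) hq
      (c := c) rfl (by rw [hγ]; positivity)
    refine ⟨u, h1, h2, h3, fun hδ => h4 ?_⟩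
    rw [hγ, lt_div_iff₀ hs]
    rw [div_lt_iff₀ (by positivity)] at hδ
    linarith
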